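/- All manifolds are smooth, finite-dimensional, Hausdorff and second countable. Let $\mathfrak d$ be a finite-dimensional real Lie algebra with an invariant nondegenerate symmetric bilinear form $\langle\cdot,\cdot\rangle$, acting on a manifold $N$ by $a:\mathfrak d\to\mathfrak X(N)$ with coisotropic stabilizers, so that $\mathfrak d\times N$ is an action Courant algebroid. Let $\mathfrak h\subseteq\mathfrak d$ be a Lagrangian subalgebra, write $\mathbb TM=TM\oplus T^*M$ for the standard Courant algebroid, and let $$R:(\mathbb TM,TM)\dashrightarrow(\mathfrak d,\mathfrak h)\times N$$ be a morphism of Manin pairs over a smooth map $\mu:M\to N$; that is, $R\subseteq(\mathfrak d\times N)\times\overline{\mathbb TM}$ is a Dirac structure with support on the graph of $\mu$, such that $R\circ TM\subseteq\mathfrak h\times N$ and $\ker R\cap TM=0$. Let $\rho_R:\mathfrak h\to\mathfrak X(M)$ be the action determined by $\rho_R(\eta)\sim_R\eta$. For a Lagrangian subspace $\mathfrak k\subseteq\mathfrak d$ with $\mathfrak d=\mathfrak h\oplus\mathfrak k$, the quasi-Poisson bivector field $\pi_{\mathfrak k}$ on $M$ is determined by $\mathfrak k\circ R=\{\pi_{\mathfrak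 k}(\alpha,\cdot)+\alpha\mid\alpha\in T^*M\}$. Let $(\mathfrak c,S)$ be reductive data for $R$: $\mathfrak c\subseteq\mathfrak d$ is a subalgebra with $\mathfrak c^\perp\subseteq\mathfrak c$, and $S\subseteq N$ is a $\mathfrak c$-invariant submanifold, such that the $\mathfrak c^\perp$-orbits in $S$ form a regular foliation with quotient $q_N:S\to N_{\mathfrak c,S}$, the graph of $\mu$ intersects $S\times M$ cleanly, and the $\mathfrak h\cap\mathfrak c^\perp$-orbits in $\mu^{-1}(S)$ form a regular foliation with quotient $q_M:\mu^{-1}(S)\to M_{\mathfrak c,S}$. (A foliation is regular if its leaf space is a manifold for which the quotient map is a surjective submersion.) Let $i_M:\mu^{-1}(S)\to M$ be the inclusion, $\mathfrak d_{\mathfrak c}=\mathfrak c/\mathfrak c^\perp$ with the induced metric, and $\mathfrak h_{\mathfrak c}=(\mathfrak h\cap\mathfrak c)/(\mathfrak h\cap\mathfrak c^\perp)$. The reduced morphism $R_{\mathfrak c,S}:\mathbb TM_{\mathfrak c,S}\dashrightarrow\mathfrak d_{\mathfrak c}\times N_{\mathfrak c,S}$ is the relation in which $(q_M)_*u+\beta\in\mathbb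 T_{q_M(x)}M_{\mathfrak c,S}$ is related to $(\xi+\mathfrak c^\perp,\,q_N(\mu(x)))$ whenever $x\in\mu^{-1}(S)$, $u\in T_x\mu^{-1}(S)$, $\xi\in\mathfrak c$, $\alpha\in T^*_xM$, $i_M^*\alpha=q_M^*\beta$ and $u+\alpha\sim_R\xi$. Let $\mathfrak k'_{\mathfrak c}\subseteq\mathfrak d_{\mathfrak c}$ be a Lagrangian subspace with $\mathfrak d_{\mathfrak c}=\mathfrak h_{\mathfrak c}\oplus\mathfrak k'_{\mathfrak c}$, and let $\mathfrak k'\subseteq\mathfrak c$ be its preimage. Let $\pi_{\mathfrak k'_{\mathfrak c}}$ be the bivector field on $M_{\mathfrak c,S}$ determined by $\mathfrak k'_{\mathfrak c}\circ R_{\mathfrak c,S}=\{\pi_{\mathfrak k'_{\mathfrak c}}(\beta,\cdot)+\beta\}$, and let $\tau\in\wedge^2\big(\mathfrak h/(\mathfrak h\cap\mathfrak c^\perp)\big)$ be the element determined by $$\mathfrak k'=\{\xi+\tau^\sharp(\xi)+\eta\mid \xi\in\mathfrak k,\ \langle\xi,\cdot\rangle|_{\mathfrak h\cap\mathfrak c^\perp}=0,\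 \eta\in\mathfrak h\cap\mathfrak c^\perp\},\qquad \tau^\sharp(\xi)=\tau(\xi,\cdot),$$ where $\xi$ is viewed as an element of $\big(\mathfrak h/(\mathfrak h\cap\mathfrak c^\perp)\big)^*$ through the metric. Then $\pi_{\mathfrak k}$, $\tau$ and $\pi_{\mathfrak k'_{\mathfrak c}}$ exist, are unique, and the two bivector fields are smooth. Moreover $(\pi_{\mathfrak k}+\rho_R(\tau))|_{\mu^{-1}(S)}$ is a smooth $\mathfrak h\cap\mathfrak c^\perp$-invariant section of $$\wedge^2\big(T\mu^{-1}(S)/\rho_R(\mathfrak h\cap\mathfrak c^\perp)\big),$$ and it is mapped to $\pi_{\mathfrak k'_{\mathfrak c}}$ under the surjective submersion $q_M:\mu^{-1}(S)\to M_{\mathfrak c,S}$. -/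

import Mathlib

open scoped Manifold ContDiff

noncomputable section

namespace QuasiPoisson

/-! ### Quadratic linear algebra -/

section Algebra

/-- A metric on a Lie algebra: a nondegenerate symmetric invariant bilinear form. -/
structure IsInvariantMetric {𝔡 : Type*} [LieRing 𝔡] [LieAlgebra ℝ 𝔡]
    (B : LinearMap.BilinForm ℝ 𝔡) : Prop where
  symm : B.IsSymm
  nondegenerate : B.Nondegenerate
  invariant : B.lieInvariant 𝔡

/-- A subspace is Lagrangian if it equals its own orthogonal. -/
def IsLagrangian {V : Type*} [AddCommGroup V] [Module ℝ V] (B : LinearMap.BilinForm ℝ V)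
    (W : Submodule ℝ V) : Prop :=
  B.orthogonal W = W

variable {V : Type*} [AddCommGroup V] [Module ℝ V]

/-- The subspace `C ∩ C^⊥`, inside `C` (for coisotropic `C` it is `C^⊥`). -/
def coisoRadical (B : LinearMap.BilinForm ℝ V) (C : Submodule ℝ V) : Submodule ℝ ↥C :=
  (B.orthogonal C).comap C.subtype

/-- The quotient `C / C^⊥` of a coisotropic subspace `C`. -/
abbrev CoisoQuotient (B : LinearMap.BilinForm ℝ V) (C : Submodule ℝ V) : Type _ :=
  ↥C ⧸ coisoRadical B C

/-- The metric on `C / C^⊥` to which the metric of `V` descends. -/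
def reducedForm (B : LinearMap.BilinForm ℝ V) (hB : B.IsSymm) (C : Submodule ℝ V) :
    LinearMap.BilinForm ℝ (CoisoQuotient B C) :=
  (coisoRadical B C).liftQ
    { toFun := fun x => (coisoRadical B C).liftQ ((B (x : V)).comp C.subtype)
        (fun y hy => by
          have h : (y : V) ∈ B.orthogonal C := hy
          simpa using (LinearMap.BilinForm.mem_orthogonal_iff.mp h) x x.2)
      map_add' := fun x y => by
        apply Submodule.linearMap_qext
        ext z
        simp
      map_smul' := fun r x => by
        apply Submodule.linearMap_qext
        ext z
        simp }
    (fun x hx => by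
      have h : (x : V) ∈ B.orthogonal C := hx
      rw [LinearMap.mem_ker]
      apply Submodule.linearMap_qext
      ext z
      have h2 := (LinearMap.BilinForm.mem_orthogonal_iff.mp h) z z.2
      have h3 : B (x : V) (z : V) = 0 := by rw [hB.eq]; exact h2
      simpa using h3)

theorem reducedForm_mk (B : LinearMap.BilinForm ℝ V) (hB : B.IsSymm) (C : Submodule ℝ V)
    (x y : ↥C) :
    reducedForm B hB C (Submodule.Quotient.mk x) (Submodule.Quotient.mk y) = B (x : V) (y : V) :=
  rfl

/-- The image `H_C = (H ∩ C) / (H ∩ C^⊥)` of `H` in `C / C^⊥`. -/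
def reducedSubspace (B : LinearMap.BilinForm ℝ V) (C H : Submodule ℝ V) :
    Submodule ℝ (CoisoQuotient B C) :=
  (H.comap C.subtype).map (coisoRadical B C).mkQ

/-- The preimage in `C ⊆ V` of a subspace of `C / C^⊥`. -/
def liftSubspace (B : LinearMap.BilinForm ℝ V) (C : Submodule ℝ V)
    (K : Submodule ℝ (CoisoQuotient B C)) : Submodule ℝ V :=
  (K.comap (coisoRadical B C).mkQ).map C.subtype

/-- The subspace `H ∩ C^⊥`, inside `H`. -/
def stab (B : LinearMap.BilinForm ℝ V) (C H : Submodule ℝ V) : Submodule ℝ ↥H :=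
  (B.orthogonal C).comap H.subtype

/-- `⋀² V` for a finite-dimensional space `V`, as the space of alternating bilinear forms
on the dual of `V`. -/
abbrev Bivector (V : Type*) [AddCommGroup V] [Module ℝ V] : Type _ :=
  (Module.Dual ℝ V) [⋀^Fin 2]→ₗ[ℝ] ℝ

/-- The map `⋀² V → ⋀² W` induced by a linear map `V → W`. -/
def Bivector.push {W : Type*} [AddCommGroup W] [Module ℝ W] (f : V →ₗ[ℝ] W)
    (b : Bivector V) : Bivector W :=
  b.compLinearMap f.dualMap

/-- The graph `{ b(α, ·) + α }` of a bivector, in `V × V*`. -/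
def Bivector.graph (b : Bivector V) : Set (V × Module.Dual ℝ V) :=
  {p | ∀ β : Module.Dual ℝ V, β p.1 = b ![p.2, β]}

/-- `τ ∈ ⋀² (H / (H ∩ C^⊥))` corresponds to a Lagrangian complement `K'` of `H_C` in `C / C^⊥`
(relative to the complement `K` of `H` in `V`): the preimage of `K'` in `V` is
`{ ξ + τ^♯ ξ + η | ξ ∈ K ∩ (H ∩ C^⊥)^⊥, η ∈ H ∩ C^⊥ }`. Below `κ` is the functional on
`H / (H ∩ C^⊥)` defined by `ξ`, and `w ∈ H` runs over the elements `τ^♯ ξ + η`, that is, over the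
representatives of `τ^♯ ξ = τ(κ, ·)`. -/
def IsTwist (B : LinearMap.BilinForm ℝ V) (C H K : Submodule ℝ V)
    (K' : Submodule ℝ (CoisoQuotient B C)) (τ : Bivector (↥H ⧸ stab B C H)) : Prop :=
  ∀ v : V, v ∈ liftSubspace B C K' ↔
    ∃ ξ ∈ K, ∃ κ : Module.Dual ℝ (↥H ⧸ stab B C H),
      (∀ u : ↥H, κ (Submodule.Quotient.mk u) = B ξ (u : V)) ∧
      ∃ w : ↥H, v = ξ + (w : V) ∧
        ∀ ν : Module.Dual ℝ (↥H ⧸ stab B C H), ν (Submodule.Quotient.mk w) = τ ![κ, ν]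

end Algebra

/-! ### Manifolds, vector fields, orbits -/

section Manifolds

variable (E : Type*) [NormedAddCommGroup E] [NormedSpace ℝ E]
  {M : Type*} [TopologicalSpace M] [ChartedSpace E M]

/-- The tangent space of a manifold modelled on `E`. -/
abbrev Tan (m : M) : Type _ := TangentSpace 𝓘(ℝ, E) m

/-- The cotangent space (the spaces `E` that occur below have finite dimension). -/
abbrev Cot (m : M) : Type _ := Module.Dual ℝ (TangentSpace 𝓘(ℝ, E) m)

variable {E}

/-- The derivative of a function in the direction of a tangent vector. -/
def dirDeriv (f : M → ℝ) (m : M) (v : Tan E m) : ℝ :=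
  mfderiv 𝓘(ℝ, E) 𝓘(ℝ, ℝ) f m v

/-- The differential of a function, as a covector. -/
def diff (f : M → ℝ) (m : M) : Cot E m :=
  (mfderiv 𝓘(ℝ, E) 𝓘(ℝ, ℝ) f m).toLinearMap

/-- Smoothness of a vector field. -/
def SmoothField [IsManifold 𝓘(ℝ, E) ∞ M] (X : (m : M) → Tan E m) : Prop :=
  ContMDiff 𝓘(ℝ, E) 𝓘(ℝ, E).tangent ∞ (fun m => (⟨m, X m⟩ : TangentBundle 𝓘(ℝ, E) M))

/-- A bivector field is smooth if the bracket of any two smooth functions is smooth. -/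
def SmoothBivectorField (π : (m : M) → Bivector (Tan E m)) : Prop :=
  ∀ f g : M → ℝ, ContMDiff 𝓘(ℝ, E) 𝓘(ℝ, ℝ) ∞ f → ContMDiff 𝓘(ℝ, E) 𝓘(ℝ, ℝ) ∞ g →
    ContMDiff 𝓘(ℝ, E) 𝓘(ℝ, ℝ) ∞ (fun m => π m ![diff f m, diff g m])

/-- Smoothness of a section of `⋀² (TM / F)`: it is smooth on all smooth sections of
`(TM / F)^*`. -/
def SmoothQuotientBivector [IsManifold 𝓘(ℝ, E) ∞ M] (F : (m : M) → Submodule ℝ (Tan E m))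
    (σ : (m : M) → Bivector (Tan E m ⧸ F m)) : Prop :=
  ∀ α β : (m : M) → Module.Dual ℝ (Tan E m ⧸ F m),
    (∀ Z : (m : M) → Tan E m, SmoothField Z →
      ContMDiff 𝓘(ℝ, E) 𝓘(ℝ, ℝ) ∞ (fun m => α m (Submodule.Quotient.mk (Z m)))) →
    (∀ Z : (m : M) → Tan E m, SmoothField Z →
      ContMDiff 𝓘(ℝ, E) 𝓘(ℝ, ℝ) ∞ (fun m => β m (Submodule.Quotient.mk (Z m)))) →
    ContMDiff 𝓘(ℝ, E) 𝓘(ℝ, ℝ) ∞ (fun m => σ m ![α m, β m])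

/-- An action of a Lie algebra on a manifold: a homomorphism to the smooth vector fields. -/
structure LieAction (𝔡 : Type*) [LieRing 𝔡] [LieAlgebra ℝ 𝔡] (E : Type*) [NormedAddCommGroup E]
    [NormedSpace ℝ E] (M : Type*) [TopologicalSpace M] [ChartedSpace E M]
    [IsManifold 𝓘(ℝ, E) ∞ M] where
  field : 𝔡 →ₗ[ℝ] ((m : M) → Tan E m)
  smooth : ∀ ξ, SmoothField (field ξ)
  map_lie : ∀ ξ η m,
    field ⁅ξ, η⁆ m = VectorField.mlieBracket 𝓘(ℝ, E) (field ξ) (field η) m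

/-- The stabilizer of a point. -/
def LieAction.stabilizer {𝔡 : Type*} [LieRing 𝔡] [LieAlgebra ℝ 𝔡] [IsManifold 𝓘(ℝ, E) ∞ M]
    (a : LieAction 𝔡 E M) (m : M) : Submodule ℝ 𝔡 :=
  LinearMap.ker ((LinearMap.proj m).comp a.field)

/-- The derivative of an immersion is injective. -/
theorem mfderiv_injective_of_immersion
    {E' : Type*} [NormedAddCommGroup E'] [NormedSpace ℝ E']
    {S : Type*} [TopologicalSpace S] [ChartedSpace E' S] {i : S → M}
    (h : Manifold.IsImmersion 𝓘(ℝ, E') 𝓘(ℝ, E) ∞ i) (s : S) :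
    Function.Injective (mfderiv 𝓘(ℝ, E') 𝓘(ℝ, E) i s) := by
  have hs := h.isImmersionAt s
  let c := hs.domChart
  let d := hs.codChart
  have hc : s ∈ c.source := hs.mem_domChart_source
  have hd : i s ∈ d.source := hs.mem_codChart_source
  let g : M → S := (c.extend 𝓘(ℝ, E')).symm ∘ (fun y => (hs.equiv.symm y).1) ∘ d.extend 𝓘(ℝ, E)
  have key : ∀ x ∈ c.source, g (i x) = x := by
    intro x hx
    have hx' : (c.extend 𝓘(ℝ, E')) x ∈ (c.extend 𝓘(ℝ, E')).target :=
      (c.extend 𝓘(ℝ, E')).map_source (by rwa [c.extend_source])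
    have h1 := hs.writtenInCharts hx'
    have h2 : (c.extend 𝓘(ℝ, E')).symm ((c.extend 𝓘(ℝ, E')) x) = x :=
      (c.extend 𝓘(ℝ, E')).left_inv (by rwa [c.extend_source])
    simp only [Function.comp_apply] at h1
    have h1' : (d.extend 𝓘(ℝ, E)) (i x) = hs.equiv ((c.extend 𝓘(ℝ, E')) x, 0) := by
      rw [← h1]
      change _ = (d.extend 𝓘(ℝ, E)) (i ((c.extend 𝓘(ℝ, E')).symm ((c.extend 𝓘(ℝ, E')) x)))
      rw [h2]
    change (c.extend 𝓘(ℝ, E')).symm ((hs.equiv.symm ((d.extend 𝓘(ℝ, E)) (i x))).1) = x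
    rw [h1']
    simpa using h2
  have hne : (∞ : ℕ∞ω) ≠ 0 := by simp
  have hg : MDifferentiableAt 𝓘(ℝ, E) 𝓘(ℝ, E') g (i s) := by
    have e1 : MDifferentiableAt 𝓘(ℝ, E) 𝓘(ℝ, E) (d.extend 𝓘(ℝ, E)) (i s) :=
      (OpenPartialHomeomorph.contMDiffAt_extend hs.codChart_mem_maximalAtlas
        hd).mdifferentiableAt hne
    have e2 : MDifferentiableAt 𝓘(ℝ, E) 𝓘(ℝ, E')
        (fun y => (hs.equiv.symm y).1) (d.extend 𝓘(ℝ, E) (i s)) := by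
      apply DifferentiableAt.mdifferentiableAt
      fun_prop
    have e3 : MDifferentiableAt 𝓘(ℝ, E') 𝓘(ℝ, E') (c.extend 𝓘(ℝ, E')).symm
        ((hs.equiv.symm (d.extend 𝓘(ℝ, E) (i s))).1) := by
      have h1 : (hs.equiv.symm (d.extend 𝓘(ℝ, E) (i s))).1 = c.extend 𝓘(ℝ, E') s := by
        have hx' : (c.extend 𝓘(ℝ, E')) s ∈ (c.extend 𝓘(ℝ, E')).target :=
          (c.extend 𝓘(ℝ, E')).map_source (by rwa [c.extend_source])
        have h1 := hs.writtenInCharts hx'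
        have h2 : (c.extend 𝓘(ℝ, E')).symm ((c.extend 𝓘(ℝ, E')) s) = s :=
          (c.extend 𝓘(ℝ, E')).left_inv (by rwa [c.extend_source])
        simp only [Function.comp_apply] at h1
        have h1' : (d.extend 𝓘(ℝ, E)) (i s) = hs.equiv ((c.extend 𝓘(ℝ, E')) s, 0) := by
          rw [← h1]
          change _ = (d.extend 𝓘(ℝ, E)) (i ((c.extend 𝓘(ℝ, E')).symm ((c.extend 𝓘(ℝ, E')) s)))
          rw [h2]
        rw [h1']; simp
      rw [h1]
      have ho : IsOpen (c.extend 𝓘(ℝ, E')).target := c.isOpen_extend_target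
      have := contMDiffOn_extend_symm (I := 𝓘(ℝ, E')) hs.domChart_mem_maximalAtlas
      refine (ContMDiffOn.contMDiffAt this ?_).mdifferentiableAt hne
      have ht : c.extend 𝓘(ℝ, E') s ∈ (c.extend 𝓘(ℝ, E')).target :=
        (c.extend 𝓘(ℝ, E')).map_source (by rwa [c.extend_source])
      refine Filter.mem_of_superset (ho.mem_nhds ht) ?_
      intro y hy
      simpa [c] using hy
    exact e3.comp (i s) (e2.comp (i s) e1)
  have hi : MDifferentiableAt 𝓘(ℝ, E') 𝓘(ℝ, E) i s := h.contMDiff.mdifferentiableAt hne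
  have hcomp : HasMFDerivAt 𝓘(ℝ, E') 𝓘(ℝ, E') (g ∘ i) s
      ((mfderiv 𝓘(ℝ, E) 𝓘(ℝ, E') g (i s)).comp (mfderiv 𝓘(ℝ, E') 𝓘(ℝ, E) i s)) :=
    hg.hasMFDerivAt.comp s hi.hasMFDerivAt
  have hid : HasMFDerivAt 𝓘(ℝ, E') 𝓘(ℝ, E') (g ∘ i) s (ContinuousLinearMap.id ℝ _) :=
    (hasMFDerivAt_id s).congr_of_eventuallyEq
      (Filter.eventuallyEq_of_mem (c.open_source.mem_nhds hc) key)
  have heq := hasMFDerivAt_unique hcomp hid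
  intro u v huv
  have hu := DFunLike.congr_fun heq u
  have hv := DFunLike.congr_fun heq v
  simp only [ContinuousLinearMap.comp_apply] at hu hv
  rw [huv] at hu
  exact hu.symm.trans hv

/-- The vector field on the source of an immersion `i` that is `i`-related to `X`, for a vector
field `X` that is tangent to the image of `i`. -/
def restrictField {E' : Type*} [NormedAddCommGroup E'] [NormedSpace ℝ E']
    {S : Type*} [TopologicalSpace S] [ChartedSpace E' S] (i : S → M) (X : (m : M) → Tan E m)
    (s : S) : Tan E' s :=
  Function.invFun (mfderiv 𝓘(ℝ, E') 𝓘(ℝ, E) i s) (X (i s))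

/-- Two points lie on the same orbit of a family of vector fields if they are joined by finitely
many pieces of integral curves. -/
def SameOrbit {A : Type*} (act : A → (m : M) → Tan E m) : M → M → Prop :=
  Relation.EqvGen fun x y => ∃ (ζ : A) (γ : ℝ → M) (r s : ℝ),
    IsMIntegralCurveOn γ (act ζ) (Set.Ioo r s) ∧
      ∃ t₀ ∈ Set.Ioo r s, ∃ t₁ ∈ Set.Ioo r s, γ t₀ = x ∧ γ t₁ = y

/-- The orbits of `act` form a regular foliation with leaf space `Q`: `q` is a surjective
submersion whose fibres are the orbits, and the tangent spaces of the fibres are spanned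
by `act`. -/
structure IsRegularQuotient {E' : Type*} [NormedAddCommGroup E'] [NormedSpace ℝ E']
    {Q : Type*} [TopologicalSpace Q] [ChartedSpace E' Q] {A : Type*}
    (act : A → (m : M) → Tan E m) (q : M → Q) : Prop where
  submersion : Manifold.IsSubmersion 𝓘(ℝ, E) 𝓘(ℝ, E') ∞ q
  surjective : Function.Surjective q
  fibre : ∀ x y, q x = q y ↔ SameOrbit act x y
  tangent : ∀ (x : M) (v : Tan E x),
    mfderiv 𝓘(ℝ, E) 𝓘(ℝ, E') q x v = 0 ↔ ∃ ζ, act ζ x = v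

/-- `φ` is a smooth local flow of `X`, for times in `(-ε, ε)` and initial points in the open
set `U`. -/
structure IsLocalFlow (X : (m : M) → Tan E m) (φ : ℝ → M → M) (ε : ℝ) (U : Set M) : Prop where
  isOpen : IsOpen U
  smooth : ContMDiffOn (𝓘(ℝ, ℝ).prod 𝓘(ℝ, E)) 𝓘(ℝ, E) ∞ (fun p : ℝ × M => φ p.1 p.2)
    (Set.Ioo (-ε) ε ×ˢ U)
  initial : ∀ x ∈ U, φ 0 x = x
  integral : ∀ x ∈ U, IsMIntegralCurveOn (fun t => φ t x) X (Set.Ioo (-ε) ε)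

/-- Invariance of a section `σ` of `⋀² (TM / F)` under a family of vector fields: their local
flows preserve `F`, and the maps induced on `⋀² (TM / F)` preserve `σ`. -/
def IsInvariant {A : Type*} (act : A → (m : M) → Tan E m) (F : (m : M) → Submodule ℝ (Tan E m))
    (σ : (m : M) → Bivector (Tan E m ⧸ F m)) : Prop :=
  ∀ (ζ : A) (φ : ℝ → M → M) (ε : ℝ) (U : Set M), IsLocalFlow (act ζ) φ ε U →
    ∀ t ∈ Set.Ioo (-ε) ε, ∀ x ∈ U,
      ∃ hF : F x ≤ (F (φ t x)).comap (mfderiv 𝓘(ℝ, E) 𝓘(ℝ, E) (φ t) x).toLinearMap,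
        (σ x).push (Submodule.mapQ (F x) (F (φ t x))
          (mfderiv 𝓘(ℝ, E) 𝓘(ℝ, E) (φ t) x).toLinearMap hF) = σ (φ t x)

end Manifolds

/-! ### Morphisms of Manin pairs `(𝕋M, TM) ⇢ (𝔡, 𝔥) × N` -/

section Manin

variable {𝔡 : Type*} [LieRing 𝔡] [LieAlgebra ℝ 𝔡]
  {EN : Type*} [NormedAddCommGroup EN] [NormedSpace ℝ EN]
  {N : Type*} [TopologicalSpace N] [ChartedSpace EN N] [IsManifold 𝓘(ℝ, EN) ∞ N]
  {EM : Type*} [NormedAddCommGroup EM] [NormedSpace ℝ EM]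
  {M : Type*} [TopologicalSpace M] [ChartedSpace EM M] [IsManifold 𝓘(ℝ, EM) ∞ M]

/-- A smooth section, over `N × M`, of the vector bundle `(𝔡 × N) × 𝕋M`, where
`𝕋M = TM ⊕ T*M`. -/
structure CourantSection (𝔡 : Type*) [LieRing 𝔡] [LieAlgebra ℝ 𝔡]
    (EN : Type*) [NormedAddCommGroup EN] [NormedSpace ℝ EN]
    (N : Type*) [TopologicalSpace N] [ChartedSpace EN N]
    (EM : Type*) [NormedAddCommGroup EM] [NormedSpace ℝ EM]
    (M : Type*) [TopologicalSpace M] [ChartedSpace EM M] [IsManifold 𝓘(ℝ, EM) ∞ M] where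
  lie : N → M → 𝔡
  vec : N → (m : M) → Tan EM m
  cov : N → (m : M) → Cot EM m
  smooth_lie : ∀ l : Module.Dual ℝ 𝔡,
    ContMDiff (𝓘(ℝ, EN).prod 𝓘(ℝ, EM)) 𝓘(ℝ, ℝ) ∞ (fun p : N × M => l (lie p.1 p.2))
  smooth_vec : ContMDiff (𝓘(ℝ, EN).prod 𝓘(ℝ, EM)) 𝓘(ℝ, EM).tangent ∞
    (fun p : N × M => (⟨p.2, vec p.1 p.2⟩ : TangentBundle 𝓘(ℝ, EM) M))
  smooth_cov : ∀ Z : (m : M) → Tan EM m, SmoothField Z →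
    ContMDiff (𝓘(ℝ, EN).prod 𝓘(ℝ, EM)) 𝓘(ℝ, ℝ) ∞ (fun p : N × M => cov p.1 p.2 (Z p.2))

/-- The value of a section at a point of `N × M`. -/
def CourantSection.val (e : CourantSection 𝔡 EN N EM M) (n : N) (m : M) :
    𝔡 × Tan EM m × Cot EM m :=
  (e.lie n m, e.vec n m, e.cov n m)

/-- The derivative of a function on `N × M` in the direction of the anchor of
`(ξ, X + α)`, which is `(a ξ, X)`. -/
def anchorDeriv (a : LieAction 𝔡 EN N) (f : N → M → ℝ) (n : N) (m : M)
    (v : 𝔡 × Tan EM m × Cot EM m) : ℝ :=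
  dirDeriv (fun n' => f n' m) n (a.field v.1 n) + dirDeriv (fun m' => f n m') m v.2.1

/-- `v` is the value at `(n, m)` of the bracket of `e₁` and `e₂` in the Courant algebroid
`(𝔡 × N) × 𝕋M⁻` over `N × M`, the product of the action Courant algebroid of `a` and of the
standard Courant algebroid of `M` with its metric negated. The three fields describe the three
components of the bracket by their pairings with constant elements of `𝔡`, with covectors, and
with vector fields.

On sections that are pulled back from the two factors the bracket is
`([ξ₁, ξ₂] + ℒ_{a ξ₁} ξ₂ - ℒ_{a ξ₂} ξ₁ + a^*⟨dξ₁, ξ₂⟩, [X₁, X₂], ℒ_{X₁} α₂ - ι_{X₂} dα₁)`, and it is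
extended to all sections by the Leibniz rules; the term `⟨de₁, e₂⟩` is formed with the metric
`⟨ξ₁, ξ₂⟩ - α₁(X₂) - α₂(X₁)`, and the dual of the anchor sends `(ν, θ) ∈ T*N × T*M` to
`(a^* ν, - θ)`. -/
structure IsCourantBracket (B : LinearMap.BilinForm ℝ 𝔡) (a : LieAction 𝔡 EN N)
    (e₁ e₂ : CourantSection 𝔡 EN N EM M) (n : N) (m : M) (v : 𝔡 × Tan EM m × Cot EM m) :
    Prop where
  lie_eq : ∀ ζ : 𝔡, B v.1 ζ =
    B ⁅e₁.lie n m, e₂.lie n m⁆ ζ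
      + anchorDeriv a (fun n' m' => B (e₂.lie n' m') ζ) n m (e₁.val n m)
      - anchorDeriv a (fun n' m' => B (e₁.lie n' m') ζ) n m (e₂.val n m)
      + (dirDeriv (fun n' => B (e₁.lie n' m) (e₂.lie n m)) n (a.field ζ n)
        - dirDeriv (fun n' => e₁.cov n' m (e₂.vec n m)) n (a.field ζ n)
        - dirDeriv (fun n' => e₂.cov n m (e₁.vec n' m)) n (a.field ζ n))
  vec_eq : ∀ ν : Cot EM m, ν v.2.1 =
    ν (VectorField.mlieBracket 𝓘(ℝ, EM) (e₁.vec n) (e₂.vec n) m)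
      + dirDeriv (fun n' => ν (e₂.vec n' m)) n (a.field (e₁.lie n m) n)
      - dirDeriv (fun n' => ν (e₁.vec n' m)) n (a.field (e₂.lie n m) n)
  cov_eq : ∀ Z : (m' : M) → Tan EM m', SmoothField Z → v.2.2 (Z m) =
    (dirDeriv (fun m' => e₂.cov n m' (Z m')) m (e₁.vec n m)
        - e₂.cov n m (VectorField.mlieBracket 𝓘(ℝ, EM) (e₁.vec n) Z m))
      - (dirDeriv (fun m' => e₁.cov n m' (Z m')) m (e₂.vec n m)
        - dirDeriv (fun m' => e₁.cov n m' (e₂.vec n m')) m (Z m)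
        - e₁.cov n m (VectorField.mlieBracket 𝓘(ℝ, EM) (e₂.vec n) Z m))
      + dirDeriv (fun n' => e₂.cov n' m (Z m)) n (a.field (e₁.lie n m) n)
      - dirDeriv (fun n' => e₁.cov n' m (Z m)) n (a.field (e₂.lie n m) n)
      - dirDeriv (fun m' => B (e₁.lie n m') (e₂.lie n m)) m (Z m)

/-- A Courant morphism `R : 𝕋M ⇢ 𝔡 × N` over the smooth map `μ`: a Dirac structure in
`(𝔡 × N) × 𝕋M⁻` with support on the graph of `μ`. Its fibre over `(μ m, m)` is `R m`. -/
structure IsCourantMorphism (B : LinearMap.BilinForm ℝ 𝔡) (a : LieAction 𝔡 EN N) (μ : M → N)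
    (R : (m : M) → Submodule ℝ (𝔡 × Tan EM m × Cot EM m)) : Prop where
  smooth : ContMDiff 𝓘(ℝ, EM) 𝓘(ℝ, EN) ∞ μ
  /-- `R` is a smooth subbundle along the graph (its rank is constant, as it is Lagrangian). -/
  exists_section : ∀ (m : M), ∀ v ∈ R m, ∃ e : CourantSection 𝔡 EN N EM M,
    (∀ m', e.val (μ m') m' ∈ R m') ∧ e.val (μ m) m = v
  lagrangian : ∀ (m : M) (v : 𝔡 × Tan EM m × Cot EM m),
    v ∈ R m ↔ ∀ w ∈ R m, B v.1 w.1 - (v.2.2 w.2.1 + w.2.2 v.2.1) = 0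
  involutive : ∀ e₁ e₂ : CourantSection 𝔡 EN N EM M,
    (∀ m, e₁.val (μ m) m ∈ R m) → (∀ m, e₂.val (μ m) m ∈ R m) →
    ∀ m, ∃ v ∈ R m, IsCourantBracket B a e₁ e₂ (μ m) m v

/-- A morphism of Manin pairs `R : (𝕋M, TM) ⇢ (𝔡, 𝔥) × N`. -/
structure IsManinMorphism (B : LinearMap.BilinForm ℝ 𝔡) (a : LieAction 𝔡 EN N)
    (𝔥 : Submodule ℝ 𝔡) (μ : M → N)
    (R : (m : M) → Submodule ℝ (𝔡 × Tan EM m × Cot EM m)) : Prop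
    extends IsCourantMorphism B a μ R where
  /-- `R ∘ TM ⊆ 𝔥 × N` -/
  range_le : ∀ (m : M) (ξ : 𝔡) (X : Tan EM m), (ξ, X, 0) ∈ R m → ξ ∈ 𝔥
  /-- `ker R ∩ TM = 0` -/
  ker_inf : ∀ (m : M) (X : Tan EM m), (0, X, 0) ∈ R m → X = 0

/-- For every `η ∈ 𝔥` there is exactly one `X ∈ TM` with `X ∼_R η`. -/
theorem IsManinMorphism.existsUnique_vec [FiniteDimensional ℝ EM]
    {B : LinearMap.BilinForm ℝ 𝔡} {a : LieAction 𝔡 EN N} {𝔥 : Submodule ℝ 𝔡} {μ : M → N}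
    {R : (m : M) → Submodule ℝ (𝔡 × Tan EM m × Cot EM m)}
    (hR : IsManinMorphism B a 𝔥 μ R) (hB : B.IsSymm) (h𝔥 : IsLagrangian B 𝔥) (m : M) (η : ↥𝔥) :
    ∃! X : Tan EM m, ((η : 𝔡), X, (0 : Cot EM m)) ∈ R m := by
  have : FiniteDimensional ℝ (Tan EM m) := inferInstanceAs (FiniteDimensional ℝ EM)
  refine existsUnique_of_exists_of_unique ?_ ?_
  · let g : ↥(R m) →ₗ[ℝ] ℝ := (B (η : 𝔡)).comp ((LinearMap.fst ℝ _ _).comp (R m).subtype)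
    let f : ↥(R m) →ₗ[ℝ] Cot EM m :=
      ((LinearMap.snd ℝ _ _).comp (LinearMap.snd ℝ _ _)).comp (R m).subtype
    have hg : g ∈ LinearMap.range f.dualMap := by
      refine (LinearMap.range_dualMap_eq_dualAnnihilator_ker (K := ℝ) (V₁ := ↥(R m))
        (V₂ := Cot EM m) f).symm ▸
        (Submodule.mem_dualAnnihilator g).2 ?_
      rintro ⟨⟨ξ, X, α⟩, hw⟩ hk
      have hα : α = 0 := hk
      subst hα
      have h1 : ξ ∈ 𝔥 := hR.range_le m ξ X hw
      have h2 : (η : 𝔡) ∈ B.orthogonal 𝔥 := by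
        have h3 : B.orthogonal 𝔥 = 𝔥 := h𝔥
        rw [h3]
        exact η.2
      have h4 : B ξ (η : 𝔡) = 0 := (LinearMap.BilinForm.mem_orthogonal_iff.mp h2) ξ h1
      change B (η : 𝔡) ξ = 0
      rw [hB.eq]
      exact h4
    obtain ⟨φ, hφ⟩ := hg
    refine ⟨(Module.evalEquiv ℝ (Tan EM m)).symm φ, (hR.lagrangian m _).2 ?_⟩
    intro w hw
    have h5 : φ w.2.2 = B (η : 𝔡) w.1 := LinearMap.congr_fun hφ ⟨w, hw⟩
    have h6 : w.2.2 ((Module.evalEquiv ℝ (Tan EM m)).symm φ) = φ w.2.2 := by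
      simp
    simp only [LinearMap.zero_apply]
    rw [h6, h5]
    ring
  · intro X Y hX hY
    have h := (R m).sub_mem hX hY
    have h' : ((0 : 𝔡), X - Y, (0 : Cot EM m)) ∈ R m := by simpa using h
    exact sub_eq_zero.mp (hR.ker_inf m _ h')

/-- The action `ρ_R` of `𝔥` on `M`: `ρ_R(η) ∼_R η`. -/
def IsManinMorphism.rho [FiniteDimensional ℝ EM]
    {B : LinearMap.BilinForm ℝ 𝔡} {a : LieAction 𝔡 EN N} {𝔥 : Submodule ℝ 𝔡} {μ : M → N}
    {R : (m : M) → Submodule ℝ (𝔡 × Tan EM m × Cot EM m)}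
    (hR : IsManinMorphism B a 𝔥 μ R) (hB : B.IsSymm) (h𝔥 : IsLagrangian B 𝔥) (m : M) :
    ↥𝔥 →ₗ[ℝ] Tan EM m where
  toFun η := (hR.existsUnique_vec hB h𝔥 m η).choose
  map_add' η η' := by
    refine (hR.existsUnique_vec hB h𝔥 m (η + η')).unique
      (hR.existsUnique_vec hB h𝔥 m (η + η')).choose_spec.1 ?_
    have h := (R m).add_mem (hR.existsUnique_vec hB h𝔥 m η).choose_spec.1
      (hR.existsUnique_vec hB h𝔥 m η').choose_spec.1
    simpa using h
  map_smul' r η := by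
    refine (hR.existsUnique_vec hB h𝔥 m (r • η)).unique
      (hR.existsUnique_vec hB h𝔥 m (r • η)).choose_spec.1 ?_
    have h := (R m).smul_mem r (hR.existsUnique_vec hB h𝔥 m η).choose_spec.1
    simpa using h

theorem IsManinMorphism.rho_mem [FiniteDimensional ℝ EM]
    {B : LinearMap.BilinForm ℝ 𝔡} {a : LieAction 𝔡 EN N} {𝔥 : Submodule ℝ 𝔡} {μ : M → N}
    {R : (m : M) → Submodule ℝ (𝔡 × Tan EM m × Cot EM m)}
    (hR : IsManinMorphism B a 𝔥 μ R) (hB : B.IsSymm) (h𝔥 : IsLagrangian B 𝔥) (m : M) (η : ↥𝔥) :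
    ((η : 𝔡), hR.rho hB h𝔥 m η, (0 : Cot EM m)) ∈ R m :=
  (hR.existsUnique_vec hB h𝔥 m η).choose_spec.1

end Manin

/-! ### Quasi-Poisson bivector fields -/

section Bivectors

variable {D : Type*} [AddCommGroup D] [Module ℝ D]
  {EM : Type*} [NormedAddCommGroup EM] [NormedSpace ℝ EM]
  {M : Type*} [TopologicalSpace M] [ChartedSpace EM M] {N : Type*}

/-- A relation `𝕋M ⇢ D × N` that is supported on the graph of `μ`, given by its fibres. -/
def graphRelation (μ : M → N) (R : (m : M) → Submodule ℝ (D × Tan EM m × Cot EM m))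
    (n : N) (m : M) : Set (D × Tan EM m × Cot EM m) :=
  {v | n = μ m ∧ v ∈ R m}

/-- The subset `K ∘ R` of `𝕋M`, for a relation `R : 𝕋M ⇢ D × N` and a subspace `K` of `D`. -/
def composeSubspace (K : Submodule ℝ D)
    (R : N → (m : M) → Set (D × Tan EM m × Cot EM m)) (m : M) : Set (Tan EM m × Cot EM m) :=
  {p | ∃ n : N, ∃ ξ ∈ K, (ξ, p.1, p.2) ∈ R n m}

/-- `π` is the quasi-Poisson bivector field `π_K` of `R` for the Lagrangian complement `K`:
`K ∘ R = gr(π^♯)`. -/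
structure IsQuasiPoissonBivector (K : Submodule ℝ D)
    (R : N → (m : M) → Set (D × Tan EM m × Cot EM m)) (π : (m : M) → Bivector (Tan EM m)) :
    Prop where
  smooth : SmoothBivectorField π
  graph_eq : ∀ m, composeSubspace K R m = (π m).graph

end Bivectors

/-! ### Reduction -/

section Reduction

variable {𝔡 : Type*} [LieRing 𝔡] [LieAlgebra ℝ 𝔡]
  {EN : Type*} [NormedAddCommGroup EN] [NormedSpace ℝ EN]
  {N : Type*} [TopologicalSpace N] [ChartedSpace EN N] [IsManifold 𝓘(ℝ, EN) ∞ N]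
  {EM : Type*} [NormedAddCommGroup EM] [NormedSpace ℝ EM] [FiniteDimensional ℝ EM]
  {M : Type*} [TopologicalSpace M] [ChartedSpace EM M] [IsManifold 𝓘(ℝ, EM) ∞ M]
  {ES : Type*} [NormedAddCommGroup ES] [NormedSpace ℝ ES]
  {S : Type*} [TopologicalSpace S] [ChartedSpace ES S]
  {EP : Type*} [NormedAddCommGroup EP] [NormedSpace ℝ EP]
  {P : Type*} [TopologicalSpace P] [ChartedSpace EP P]
  {ENr : Type*} [NormedAddCommGroup ENr] [NormedSpace ℝ ENr]
  {Nr : Type*} [TopologicalSpace Nr] [ChartedSpace ENr Nr]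
  {EMr : Type*} [NormedAddCommGroup EMr] [NormedSpace ℝ EMr]
  {Mr : Type*} [TopologicalSpace Mr] [ChartedSpace EMr Mr]

/-- The action of `𝔥 ∩ 𝔠^⊥` on `P = μ⁻¹(S)`, by restriction of `ρ_R`. -/
def IsManinMorphism.stabAction {B : LinearMap.BilinForm ℝ 𝔡} {a : LieAction 𝔡 EN N}
    {𝔥 : Submodule ℝ 𝔡} {μ : M → N} {R : (m : M) → Submodule ℝ (𝔡 × Tan EM m × Cot EM m)}
    (hR : IsManinMorphism B a 𝔥 μ R) (hB : B.IsSymm) (h𝔥 : IsLagrangian B 𝔥)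
    (𝔠 : Submodule ℝ 𝔡) (iM : P → M) (ζ : ↥(stab B 𝔠 𝔥)) : (x : P) → Tan EP x :=
  restrictField iM (fun m => hR.rho hB h𝔥 m (ζ : ↥𝔥))

/-- The subspace `ρ_R(𝔥 ∩ 𝔠^⊥)` of `T_m M`. -/
def IsManinMorphism.stabRange {B : LinearMap.BilinForm ℝ 𝔡} {a : LieAction 𝔡 EN N}
    {𝔥 : Submodule ℝ 𝔡} {μ : M → N} {R : (m : M) → Submodule ℝ (𝔡 × Tan EM m × Cot EM m)}
    (hR : IsManinMorphism B a 𝔥 μ R) (hB : B.IsSymm) (h𝔥 : IsLagrangian B 𝔥)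
    (𝔠 : Submodule ℝ 𝔡) (m : M) : Submodule ℝ (Tan EM m) :=
  (stab B 𝔠 𝔥).map (hR.rho hB h𝔥 m)

/-- The subspace `ρ_R(𝔥 ∩ 𝔠^⊥)` of `T_x P`, for `P = μ⁻¹(S)`. -/
def IsManinMorphism.stabTangent {B : LinearMap.BilinForm ℝ 𝔡} {a : LieAction 𝔡 EN N}
    {𝔥 : Submodule ℝ 𝔡} {μ : M → N} {R : (m : M) → Submodule ℝ (𝔡 × Tan EM m × Cot EM m)}
    (hR : IsManinMorphism B a 𝔥 μ R) (hB : B.IsSymm) (h𝔥 : IsLagrangian B 𝔥)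
    (𝔠 : Submodule ℝ 𝔡) (iM : P → M) (x : P) : Submodule ℝ (Tan EP x) :=
  (hR.stabRange hB h𝔥 𝔠 (iM x)).comap (mfderiv 𝓘(ℝ, EP) 𝓘(ℝ, EM) iM x).toLinearMap

/-- The map `ρ_R : 𝔥 / (𝔥 ∩ 𝔠^⊥) → T_m M / ρ_R(𝔥 ∩ 𝔠^⊥)`. -/
def IsManinMorphism.rhoQuotient {B : LinearMap.BilinForm ℝ 𝔡} {a : LieAction 𝔡 EN N}
    {𝔥 : Submodule ℝ 𝔡} {μ : M → N} {R : (m : M) → Submodule ℝ (𝔡 × Tan EM m × Cot EM m)}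
    (hR : IsManinMorphism B a 𝔥 μ R) (hB : B.IsSymm) (h𝔥 : IsLagrangian B 𝔥)
    (𝔠 : Submodule ℝ 𝔡) (m : M) :
    (↥𝔥 ⧸ stab B 𝔠 𝔥) →ₗ[ℝ] (Tan EM m ⧸ hR.stabRange hB h𝔥 𝔠 m) :=
  Submodule.mapQ _ _ (hR.rho hB h𝔥 m) (Submodule.le_comap_map _ _)

/-- The inclusion `T_x P / ρ_R(𝔥 ∩ 𝔠^⊥) → T_x M / ρ_R(𝔥 ∩ 𝔠^⊥)`, for `P = μ⁻¹(S)`. -/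
def IsManinMorphism.inclQuotient {B : LinearMap.BilinForm ℝ 𝔡} {a : LieAction 𝔡 EN N}
    {𝔥 : Submodule ℝ 𝔡} {μ : M → N} {R : (m : M) → Submodule ℝ (𝔡 × Tan EM m × Cot EM m)}
    (hR : IsManinMorphism B a 𝔥 μ R) (hB : B.IsSymm) (h𝔥 : IsLagrangian B 𝔥)
    (𝔠 : Submodule ℝ 𝔡) (iM : P → M) (x : P) :
    (Tan EP x ⧸ (hR.stabTangent hB h𝔥 𝔠 iM x : Submodule ℝ (Tan EP x))) →ₗ[ℝ]
      (Tan EM (iM x) ⧸ hR.stabRange hB h𝔥 𝔠 (iM x)) :=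
  Submodule.mapQ _ _ (mfderiv 𝓘(ℝ, EP) 𝓘(ℝ, EM) iM x).toLinearMap le_rfl

/-- Reductive data `(𝔠, S)` for `R`. The submanifold `S` of `N` is given by an injective immersion
`iN`, the submanifold `P = μ⁻¹(S)` of `M` by an injective immersion `iM`, and the restriction of
`μ` by `μS : P → S`. The quotients are `qN : S → Nr = N_{𝔠,S}` and `qM : P → Mr = M_{𝔠,S}`.

The fields from `immersion_iM` to `clean` say that the graph of `μ` intersects `S × M` cleanly:
`(μS, iM)` identifies `P` with the subset `{(s, m) | iN s = μ m}` of `S × M`, as a submanifold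
whose tangent spaces are the intersections of the tangent spaces. -/
structure IsReductiveData {B : LinearMap.BilinForm ℝ 𝔡} {a : LieAction 𝔡 EN N}
    {𝔥 : Submodule ℝ 𝔡} {μ : M → N} {R : (m : M) → Submodule ℝ (𝔡 × Tan EM m × Cot EM m)}
    (hR : IsManinMorphism B a 𝔥 μ R) (hB : B.IsSymm) (h𝔥 : IsLagrangian B 𝔥)
    (𝔠 : Submodule ℝ 𝔡) (iN : S → N) (iM : P → M) (μS : P → S) (qN : S → Nr) (qM : P → Mr) :
    Prop where
  coisotropic : B.orthogonal 𝔠 ≤ 𝔠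
  immersion_iN : Manifold.IsImmersion 𝓘(ℝ, ES) 𝓘(ℝ, EN) ∞ iN
  injective_iN : Function.Injective iN
  invariant : ∀ ξ ∈ 𝔠, ∀ s : S,
    ∃ v : Tan ES s, mfderiv 𝓘(ℝ, ES) 𝓘(ℝ, EN) iN s v = a.field ξ (iN s)
  immersion_iM : Manifold.IsImmersion 𝓘(ℝ, EP) 𝓘(ℝ, EM) ∞ iM
  injective_iM : Function.Injective iM
  smooth_μS : ContMDiff 𝓘(ℝ, EP) 𝓘(ℝ, ES) ∞ μS
  embedding : Topology.IsEmbedding (fun x : P => (μS x, iM x))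
  range_eq : Set.range iM = μ ⁻¹' Set.range iN
  commutes : ∀ x, iN (μS x) = μ (iM x)
  clean : ∀ (x : P) (w : Tan EM (iM x)) (v : Tan ES (μS x)),
    (mfderiv 𝓘(ℝ, ES) 𝓘(ℝ, EN) iN (μS x) v : EN) = mfderiv 𝓘(ℝ, EM) 𝓘(ℝ, EN) μ (iM x) w →
      ∃ u : Tan EP x, mfderiv 𝓘(ℝ, EP) 𝓘(ℝ, EM) iM x u = w ∧
        mfderiv 𝓘(ℝ, EP) 𝓘(ℝ, ES) μS x u = v
  quotient_N : IsRegularQuotient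
    (fun ζ : ↥(B.orthogonal 𝔠) => restrictField iN (a.field (ζ : 𝔡)) (E' := ES)) qN (E' := ENr)
  quotient_M : IsRegularQuotient (hR.stabAction hB h𝔥 𝔠 iM (EP := EP)) qM (E' := EMr)

/-- The reduced relation `R_{𝔠,S} = R₂ ∘ R ∘ R₁^⊤ : 𝕋Mr ⇢ (𝔠 / 𝔠^⊥) × Nr`. Here `R₁` relates
`X + α` at `iM x` with `Z + β` at `qM x` if there is `u ∈ T_x P` with `X = iM_* u`, `Z = qM_* u`
and `iM^* α = qM^* β`; and `R₂` relates `(ξ, iN s)` with `(ξ + 𝔠^⊥, qN s)` for `ξ ∈ 𝔠`. -/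
def reducedRelation (B : LinearMap.BilinForm ℝ 𝔡)
    (R : (m : M) → Submodule ℝ (𝔡 × Tan EM m × Cot EM m)) (𝔠 : Submodule ℝ 𝔡) (μ : M → N)
    (iN : S → N) (iM : P → M) (qN : S → Nr) (qM : P → Mr) (n : Nr) (m : Mr) :
    Set (CoisoQuotient B 𝔠 × Tan EMr m × Cot EMr m) :=
  {v | ∃ (x : P) (s : S) (ξ : ↥𝔠) (X : Tan EM (iM x)) (α : Cot EM (iM x)) (u : Tan EP x),
    ((ξ : 𝔡), X, α) ∈ R (iM x) ∧
    iN s = μ (iM x) ∧ qN s = n ∧ Submodule.Quotient.mk ξ = v.1 ∧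
    qM x = m ∧ mfderiv 𝓘(ℝ, EP) 𝓘(ℝ, EM) iM x u = X ∧
    (mfderiv 𝓘(ℝ, EP) 𝓘(ℝ, EMr) qM x u : EMr) = v.2.1 ∧
    ∀ w : Tan EP x, α (mfderiv 𝓘(ℝ, EP) 𝓘(ℝ, EM) iM x w) =
      v.2.2 (mfderiv 𝓘(ℝ, EP) 𝓘(ℝ, EMr) qM x w : EMr)}

/-- The tangent spaces of the orbits are killed by `qM_*`. -/
theorem IsReductiveData.stabTangent_le {B : LinearMap.BilinForm ℝ 𝔡} {a : LieAction 𝔡 EN N}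
    {𝔥 : Submodule ℝ 𝔡} {μ : M → N} {R : (m : M) → Submodule ℝ (𝔡 × Tan EM m × Cot EM m)}
    {hR : IsManinMorphism B a 𝔥 μ R} {hB : B.IsSymm} {h𝔥 : IsLagrangian B 𝔥}
    {𝔠 : Submodule ℝ 𝔡} {iN : S → N} {iM : P → M} {μS : P → S} {qN : S → Nr} {qM : P → Mr}
    (h : IsReductiveData hR hB h𝔥 𝔠 iN iM μS qN qM (ES := ES) (EP := EP) (ENr := ENr)
      (EMr := EMr)) (x : P) :
    (hR.stabTangent hB h𝔥 𝔠 iM x : Submodule ℝ (Tan EP x)) ≤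
      LinearMap.ker (mfderiv 𝓘(ℝ, EP) 𝓘(ℝ, EMr) qM x).toLinearMap := by
  intro v hv
  obtain ⟨ζ, hζ, hv⟩ := hv
  refine LinearMap.mem_ker.2 ((h.quotient_M.tangent x v).2 ⟨⟨ζ, hζ⟩, ?_⟩)
  refine mfderiv_injective_of_immersion h.immersion_iM x ?_
  exact (Function.invFun_eq ⟨v, hv.symm⟩).trans hv

/-- The map `T_x P / ρ_R(𝔥 ∩ 𝔠^⊥) → T_{qM x} Mr` induced by `qM_*`. -/
def IsReductiveData.projQuotient {B : LinearMap.BilinForm ℝ 𝔡} {a : LieAction 𝔡 EN N}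
    {𝔥 : Submodule ℝ 𝔡} {μ : M → N} {R : (m : M) → Submodule ℝ (𝔡 × Tan EM m × Cot EM m)}
    {hR : IsManinMorphism B a 𝔥 μ R} {hB : B.IsSymm} {h𝔥 : IsLagrangian B 𝔥}
    {𝔠 : Submodule ℝ 𝔡} {iN : S → N} {iM : P → M} {μS : P → S} {qN : S → Nr} {qM : P → Mr}
    (h : IsReductiveData hR hB h𝔥 𝔠 iN iM μS qN qM (ES := ES) (EP := EP) (ENr := ENr)
      (EMr := EMr)) (x : P) :
    (Tan EP x ⧸ (hR.stabTangent hB h𝔥 𝔠 iM x : Submodule ℝ (Tan EP x))) →ₗ[ℝ] Tan EMr (qM x) :=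
  Submodule.liftQ _ (mfderiv 𝓘(ℝ, EP) 𝓘(ℝ, EMr) qM x).toLinearMap (h.stabTangent_le x)

end Reduction

end QuasiPoisson

end

open QuasiPoisson

/-!
The theorem compares two ways of producing a bivector field on `Mr = M_{𝔠,S}`: composing the reduced
relation with `𝔨'_𝔠`, and projecting `π_𝔨 + ρ_R(τ)`. The link between them is a fibrewise
computation. For `x ∈ P = μ⁻¹(S)` consider the elements `(ζ, X, α)` of `R` over `iM x` with `ζ` in
the preimage `𝔨'` of `𝔨'_𝔠` and with `iM^* α = qM^* β` for a covector `β` of `Mr`. Since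
`ζ ∈ 𝔠` and `S` is `𝔠`-invariant, clean intersection makes `X` tangent to `P`, and the pairs
`(qM_* X, β)` form an isotropic relation in which every covector `β` occurs, that is, the graph of a
bivector `b x` at `qM x` (`IsReductiveData.existsUnique_graph_eq_reducedFibre`).

* Writing `ζ = ξ + w` with `ξ ∈ 𝔨` and `w ∈ 𝔥`, the element `X` splits as `π_𝔨(α, ·) + ρ_R(w)`, and
  `w` represents `τ^♯ ξ`. So the lift of `b x` to `TP / ρ_R(𝔥 ∩ 𝔠^⊥)` is the restriction of
  `π_𝔨 + ρ_R(τ)` (`IsReductiveData.push_inclQuotient`).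
* The bivector `b x` depends only on `qM x`. This is where involutivity of `R` enters. Functions
  `f`, `g` on `Mr` are covered, near a point of `P`, by functions on `M` whose differentials lift to
  smooth sections of `R` with `𝔡`-component in `𝔨'` along `P`
  (`IsReductiveData.exists_adapted_section`). Bracketing such a section with `η + ρ_R(η)`, for
  `η ∈ 𝔥 ∩ 𝔠^⊥`, and pairing with the other section gives a formula for the derivative along
  `ρ_R(η)` of `b(df, dg)` (`IsManinMorphism.dirDeriv_rho_dirDeriv`). All its terms vanish along `P`,
  since `f` and `g` are constant on orbits and `⟨[𝔠^⊥, 𝔠], 𝔠⟩ = 0`. Hence `b(df, dg)` is constant on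
  the orbits, which are the fibres of `qM` (`IsReductiveData.contMDiff_bracket`), and `b` is the
  reduced bivector field (`IsReductiveData.composeSubspace_eq`).
* Since `qM` is a submersion whose vertical spaces are the `ρ_R(𝔥 ∩ 𝔠^⊥)`, the quotient
  `TP / ρ_R(𝔥 ∩ 𝔠^⊥)` is the pullback of `T Mr`, and `σ` is the pullback of the reduced bivector
  field. Its smoothness, invariance and uniqueness follow.

Smoothness statements rest on one fact: an element of `R` is determined by its covector and by the
`𝔥`-part of its `𝔡`-component, and depends smoothly on them (`IsManinMorphism.smooth_of_mem`).
-/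

namespace QuasiPoisson

open Filter Topology

/-! ### Derivatives of functions along vector fields -/

section Calculus

variable {E : Type*} [NormedAddCommGroup E] [NormedSpace ℝ E]
  {M : Type*} [TopologicalSpace M] [ChartedSpace E M]
  {E' : Type*} [NormedAddCommGroup E'] [NormedSpace ℝ E']
  {Q : Type*} [TopologicalSpace Q] [ChartedSpace E' Q]

theorem diff_apply (f : M → ℝ) (m : M) (v : Tan E m) : diff f m v = dirDeriv f m v := rfl

theorem dirDeriv_const (c : ℝ) (m : M) (v : Tan E m) : dirDeriv (fun _ => c) m v = 0 := by
  unfold dirDeriv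
  rw [mfderiv_const]
  rfl

theorem dirDeriv_zero_right (f : M → ℝ) (m : M) : dirDeriv f m (0 : Tan E m) = 0 :=
  (mfderiv 𝓘(ℝ, E) 𝓘(ℝ, ℝ) f m).map_zero

theorem dirDeriv_congr {f g : M → ℝ} {m : M} (h : f =ᶠ[𝓝 m] g) (v : Tan E m) :
    dirDeriv f m v = dirDeriv g m v := by
  unfold dirDeriv
  rw [h.mfderiv_eq]
  rfl

theorem diff_congr {f g : M → ℝ} {m : M} (h : f =ᶠ[𝓝 m] g) :
    (diff f m : Cot E m) = diff g m :=
  LinearMap.ext fun v => dirDeriv_congr h v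

theorem dirDeriv_mul {f g : M → ℝ} {m : M} (hf : MDifferentiableAt 𝓘(ℝ, E) 𝓘(ℝ, ℝ) f m)
    (hg : MDifferentiableAt 𝓘(ℝ, E) 𝓘(ℝ, ℝ) g m) (v : Tan E m) :
    dirDeriv (fun m' => f m' * g m') m v = f m * dirDeriv g m v + dirDeriv f m v * g m := by
  have h := hf.hasMFDerivAt.mul' hg.hasMFDerivAt
  unfold dirDeriv
  have h2 : mfderiv 𝓘(ℝ, E) 𝓘(ℝ, ℝ) (fun m' => f m' * g m') m = _ := h.mfderiv
  rw [h2]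
  rfl

theorem dirDeriv_mul_const {f : M → ℝ} {m : M} (hf : MDifferentiableAt 𝓘(ℝ, E) 𝓘(ℝ, ℝ) f m)
    (c : ℝ) (v : Tan E m) : dirDeriv (fun m' => f m' * c) m v = dirDeriv f m v * c := by
  rw [dirDeriv_mul hf mdifferentiableAt_const, dirDeriv_const, mul_zero, zero_add]

theorem dirDeriv_sub_const {f : M → ℝ} {m : M} (hf : MDifferentiableAt 𝓘(ℝ, E) 𝓘(ℝ, ℝ) f m)
    (c : ℝ) (v : Tan E m) : dirDeriv (fun m' => f m' - c) m v = dirDeriv f m v := by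
  have h := hf.hasMFDerivAt.sub (hasMFDerivAt_const c m)
  unfold dirDeriv
  have h2 : mfderiv 𝓘(ℝ, E) 𝓘(ℝ, ℝ) (fun m' => f m' - c) m = _ := h.mfderiv
  rw [h2]
  change dirDeriv f m v - (0 : ℝ) = dirDeriv f m v
  rw [sub_zero]

theorem dirDeriv_const_sub {f : M → ℝ} {m : M} (hf : MDifferentiableAt 𝓘(ℝ, E) 𝓘(ℝ, ℝ) f m)
    (c : ℝ) (v : Tan E m) : dirDeriv (fun m' => c - f m') m v = - dirDeriv f m v := by
  have h := (hasMFDerivAt_const c m).sub hf.hasMFDerivAt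
  unfold dirDeriv
  have h2 : mfderiv 𝓘(ℝ, E) 𝓘(ℝ, ℝ) (fun m' => c - f m') m = _ := h.mfderiv
  rw [h2]
  change (0 : ℝ) - dirDeriv f m v = - dirDeriv f m v
  rw [zero_sub]

theorem dirDeriv_comp {f : Q → ℝ} {q : M → Q} {m : M}
    (hf : MDifferentiableAt 𝓘(ℝ, E') 𝓘(ℝ, ℝ) f (q m))
    (hq : MDifferentiableAt 𝓘(ℝ, E) 𝓘(ℝ, E') q m) (v : Tan E m) :
    dirDeriv (fun x => f (q x)) m v = dirDeriv f (q m) (mfderiv 𝓘(ℝ, E) 𝓘(ℝ, E') q m v) :=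
  mfderiv_comp_apply m hf hq v

variable [IsManifold 𝓘(ℝ, E) ∞ M]

theorem SmoothField.contMDiffAt_dirDeriv {X : (m : M) → Tan E m} {m : M}
    (hX : ContMDiffAt 𝓘(ℝ, E) 𝓘(ℝ, E).tangent ∞
      (fun m => (⟨m, X m⟩ : TangentBundle 𝓘(ℝ, E) M)) m)
    {f : M → ℝ} (hf : ContMDiff 𝓘(ℝ, E) 𝓘(ℝ, ℝ) ∞ f) :
    ContMDiffAt 𝓘(ℝ, E) 𝓘(ℝ, ℝ) ∞ (fun m => dirDeriv f m (X m)) m := by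
  have h1 := (hf.contMDiff_tangentMap (m := ∞) le_rfl).contMDiffAt.comp m hX
  exact (contMDiff_snd_tangentBundle_modelSpace ℝ 𝓘(ℝ, ℝ)).contMDiffAt.comp m h1

theorem SmoothField.contMDiff_dirDeriv {X : (m : M) → Tan E m} (hX : SmoothField X)
    {f : M → ℝ} (hf : ContMDiff 𝓘(ℝ, E) 𝓘(ℝ, ℝ) ∞ f) :
    ContMDiff 𝓘(ℝ, E) 𝓘(ℝ, ℝ) ∞ (fun m => dirDeriv f m (X m)) :=
  fun m => SmoothField.contMDiffAt_dirDeriv (hX m) hf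

/-- In the chart at a point, the derivative along a vector field becomes the derivative along
its pullback to the model space. -/
theorem fderiv_comp_extChartAt_symm (V : (m : M) → Tan E m) (x : M) {F : M → ℝ} {y : E}
    (hy : y ∈ (extChartAt 𝓘(ℝ, E) x).target)
    (hF : MDifferentiableAt 𝓘(ℝ, E) 𝓘(ℝ, ℝ) F ((extChartAt 𝓘(ℝ, E) x).symm y)) :
    fderiv ℝ (F ∘ (extChartAt 𝓘(ℝ, E) x).symm) y
        (VectorField.mpullbackWithin 𝓘(ℝ, E) 𝓘(ℝ, E) (extChartAt 𝓘(ℝ, E) x).symm V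
          (Set.range 𝓘(ℝ, E)) y) =
      dirDeriv F ((extChartAt 𝓘(ℝ, E) x).symm y) (V ((extChartAt 𝓘(ℝ, E) x).symm y)) := by
  have hinv := isInvertible_mfderivWithin_extChartAt_symm (I := 𝓘(ℝ, E)) hy
  have hr : Set.range 𝓘(ℝ, E) = Set.univ := by simp
  rw [VectorField.mpullbackWithin_apply]
  have hd : MDifferentiableAt 𝓘(ℝ, E) 𝓘(ℝ, E) (extChartAt 𝓘(ℝ, E) x).symm y := by
    have := mdifferentiableWithinAt_extChartAt_symm (I := 𝓘(ℝ, E)) hy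
    rwa [hr, mdifferentiableWithinAt_univ] at this
  have hw : mfderivWithin 𝓘(ℝ, E) 𝓘(ℝ, E) (extChartAt 𝓘(ℝ, E) x).symm (Set.range 𝓘(ℝ, E)) y =
      mfderiv 𝓘(ℝ, E) 𝓘(ℝ, E) (extChartAt 𝓘(ℝ, E) x).symm y := by
    rw [hr, mfderivWithin_univ]
  have h1 : fderiv ℝ (F ∘ (extChartAt 𝓘(ℝ, E) x).symm) y =
      mfderiv 𝓘(ℝ, E) 𝓘(ℝ, ℝ) (F ∘ (extChartAt 𝓘(ℝ, E) x).symm) y := by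
    rw [mfderiv_eq_fderiv]
  rw [h1]
  refine (mfderiv_comp_apply y hF hd _).trans ?_
  rw [← hw]
  unfold dirDeriv
  congr 1
  rw [← ContinuousLinearMap.comp_apply, hinv.self_comp_inverse]
  rfl

variable [FiniteDimensional ℝ E]

/-- The Lie bracket of vector fields is the commutator of the derivations that they define. -/
theorem dirDeriv_mlieBracket {V W : (m : M) → Tan E m} (hV : SmoothField V) (hW : SmoothField W)
    {f : M → ℝ} (hf : ContMDiff 𝓘(ℝ, E) 𝓘(ℝ, ℝ) ∞ f) (m : M) :
    dirDeriv f m (VectorField.mlieBracket 𝓘(ℝ, E) V W m) =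
      dirDeriv (fun m' => dirDeriv f m' (W m')) m (V m) -
        dirDeriv (fun m' => dirDeriv f m' (V m')) m (W m) := by
  have : CompleteSpace E := FiniteDimensional.complete ℝ E
  have hne : (∞ : ℕ∞ω) ≠ 0 := by simp
  set φ := extChartAt 𝓘(ℝ, E) m with hφ
  have hm : φ m ∈ φ.target := mem_extChartAt_target m
  have hs : φ.symm (φ m) = m := extChartAt_to_inv m
  have key : ∀ (X : (m : M) → Tan E m) {F : M → ℝ} {y : E}, y ∈ φ.target →
      ContMDiff 𝓘(ℝ, E) 𝓘(ℝ, ℝ) ∞ F →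
      fderiv ℝ (F ∘ φ.symm) y
        (VectorField.mpullbackWithin 𝓘(ℝ, E) 𝓘(ℝ, E) φ.symm X (Set.range 𝓘(ℝ, E)) y) =
      dirDeriv F (φ.symm y) (X (φ.symm y)) := fun X F y hy hF =>
    fderiv_comp_extChartAt_symm X m hy (hF.mdifferentiableAt hne)
  have hVd : DifferentiableAt ℝ
      (VectorField.mpullbackWithin 𝓘(ℝ, E) 𝓘(ℝ, E) φ.symm V (Set.range 𝓘(ℝ, E))) (φ m) := by
    have h := (hV.mdifferentiableAt (x := m) hne).mdifferentiableWithinAt (s := Set.univ)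
    exact h.differentiableWithinAt_mpullbackWithin_vectorField.differentiableAt
      (by simp)
  have hWd : DifferentiableAt ℝ
      (VectorField.mpullbackWithin 𝓘(ℝ, E) 𝓘(ℝ, E) φ.symm W (Set.range 𝓘(ℝ, E))) (φ m) := by
    have h := (hW.mdifferentiableAt (x := m) hne).mdifferentiableWithinAt (s := Set.univ)
    exact h.differentiableWithinAt_mpullbackWithin_vectorField.differentiableAt
      (by simp)
  have hfd : ContDiffAt ℝ ∞ (f ∘ φ.symm) (φ m) := by
    have h1 : ContMDiffAt 𝓘(ℝ, E) 𝓘(ℝ, E) ∞ φ.symm (φ m) :=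
      (contMDiffOn_extChartAt_symm (I := 𝓘(ℝ, E)) m).contMDiffAt
        ((isOpen_extChartAt_target m).mem_nhds hm)
    exact (hf.contMDiffAt.comp (φ m) h1).contDiffAt
  have hgerm : ∀ {X : (m : M) → Tan E m}, SmoothField X →
      (fun y => fderiv ℝ (f ∘ φ.symm) y
        (VectorField.mpullbackWithin 𝓘(ℝ, E) 𝓘(ℝ, E) φ.symm X (Set.range 𝓘(ℝ, E)) y)) =ᶠ[𝓝 (φ m)]
      (fun m' => dirDeriv f m' (X m')) ∘ φ.symm := fun {X} hX => by
    filter_upwards [(isOpen_extChartAt_target m).mem_nhds hm] with y hy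
    exact key X hy hf
  -- in the chart, the manifold bracket is the bracket of vector fields on the model space
  have e1 : dirDeriv f m (VectorField.mlieBracket 𝓘(ℝ, E) V W m) =
      fderiv ℝ (f ∘ φ.symm) (φ m) (VectorField.lieBracket ℝ
        (VectorField.mpullbackWithin 𝓘(ℝ, E) 𝓘(ℝ, E) φ.symm V (Set.range 𝓘(ℝ, E)))
        (VectorField.mpullbackWithin 𝓘(ℝ, E) 𝓘(ℝ, E) φ.symm W (Set.range 𝓘(ℝ, E))) (φ m)) := by
    have h1 : MDifferentiableAt 𝓘(ℝ, E) 𝓘(ℝ, ℝ) (f ∘ φ.symm) (φ m) :=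
      (hfd.differentiableAt hne).mdifferentiableAt
    have h2 : f =ᶠ[𝓝 m] (f ∘ φ.symm) ∘ φ := by
      filter_upwards [(isOpen_extChartAt_source (I := 𝓘(ℝ, E)) m).mem_nhds
        (mem_extChartAt_source m)] with y hy
      simp only [Function.comp_apply]
      rw [φ.left_inv hy]
    rw [dirDeriv_congr h2]
    refine (mfderiv_comp_apply m h1
      (mdifferentiableAt_extChartAt (mem_chart_source E m)) _).trans ?_
    rw [mfderiv_eq_fderiv]
    congr 1
    rw [← VectorField.mlieBracketWithin_univ, VectorField.mlieBracketWithin_apply]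
    refine (DFunLike.congr_fun (isInvertible_mfderiv_extChartAt (I := 𝓘(ℝ, E))
      (mem_extChartAt_source m)).self_comp_inverse _).trans ?_
    have hset : (extChartAt 𝓘(ℝ, E) m).symm ⁻¹' Set.univ ∩ Set.range 𝓘(ℝ, E) = Set.univ := by
      simp
    rw [hset]
    exact congrFun (@VectorField.lieBracketWithin_univ ℝ _ E _ _ _ _) _
  rw [e1, VectorField.fderiv_apply_lieBracket hfd
      (by rw [minSmoothness_of_isRCLikeNormedField]; exact ENat.LEInfty.out) hWd hVd,
    (hgerm hW).fderiv_eq, (hgerm hV).fderiv_eq,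
    key V hm (SmoothField.contMDiff_dirDeriv hW hf),
    key W hm (SmoothField.contMDiff_dirDeriv hV hf), hs]

end Calculus

/-! ### Extensions of functions and vector fields, sections of submersions -/

section Extension

variable {E : Type*} [NormedAddCommGroup E] [NormedSpace ℝ E] [FiniteDimensional ℝ E]
  {M : Type*} [TopologicalSpace M] [ChartedSpace E M] [IsManifold 𝓘(ℝ, E) ∞ M] [T2Space M]

/-- A smooth function on an open set agrees near each point of the set with a smooth function on
the whole manifold. -/
theorem exists_contMDiff_eventuallyEq {U : Set M} (hU : IsOpen U) {f : M → ℝ}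
    (hf : ContMDiffOn 𝓘(ℝ, E) 𝓘(ℝ, ℝ) ∞ f U) {m : M} (hm : m ∈ U) :
    ∃ g : M → ℝ, ContMDiff 𝓘(ℝ, E) 𝓘(ℝ, ℝ) ∞ g ∧ g =ᶠ[𝓝 m] f := by
  obtain ⟨χ, -, hχ⟩ := (SmoothBumpFunction.nhds_basis_tsupport (I := 𝓘(ℝ, E)) m).mem_iff.1
    (hU.mem_nhds hm)
  refine ⟨fun x => χ x • f x, contMDiff_of_tsupport fun x hx => ?_, ?_⟩
  · have hxU : x ∈ U := hχ (tsupport_smul_subset_left _ _ hx)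
    exact χ.contMDiffAt.smul (hf.contMDiffAt (hU.mem_nhds hxU))
  · filter_upwards [χ.eventuallyEq_one] with x hx
    simp [hx]

/-- Every tangent vector is the value of a smooth vector field. -/
theorem exists_smoothField (m : M) (v : Tan E m) :
    ∃ X : (m : M) → Tan E m, SmoothField X ∧ X m = v := by
  obtain ⟨s, hs, hX⟩ := FiberBundle.exists_contMDiffOn_extend 𝓘(ℝ, E) E (k := ∞)
    (V := TangentSpace 𝓘(ℝ, E)) (x₀ := m) v
  obtain ⟨U, hUs, hU, hm⟩ := mem_nhds_iff.1 hs
  obtain ⟨χ, -, hχ⟩ := (SmoothBumpFunction.nhds_basis_tsupport (I := 𝓘(ℝ, E)) m).mem_iff.1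
    (hU.mem_nhds hm)
  refine ⟨(χ : M → ℝ) • FiberBundle.extend E v, fun x => ?_, ?_⟩
  · by_cases hx : x ∈ tsupport χ
    · exact χ.contMDiffAt.smul_section (hX.contMDiffAt (mem_of_superset (hU.mem_nhds (hχ hx)) hUs))
    · have h0 : (χ : M → ℝ) =ᶠ[𝓝 x] 0 := notMem_tsupport_iff_eventuallyEq.1 hx
      have hz : ContMDiffAt 𝓘(ℝ, E) 𝓘(ℝ, E).tangent ∞
          (fun x => (⟨x, (0 : TangentSpace 𝓘(ℝ, E) x)⟩ : TangentBundle 𝓘(ℝ, E) M)) x :=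
        (Bundle.contMDiff_zeroSection ℝ (TangentSpace 𝓘(ℝ, E) : M → Type _)).contMDiffAt
      refine hz.congr_of_eventuallyEq ?_
      filter_upwards [h0] with y hy
      simp [hy]
  · simp

/-- Every covector is the differential of a smooth function. -/
theorem exists_diff_eq (m : M) (c : Cot E m) :
    ∃ f : M → ℝ, ContMDiff 𝓘(ℝ, E) 𝓘(ℝ, ℝ) ∞ f ∧ diff f m = c := by
  have hinv := isInvertible_mfderiv_extChartAt (mem_extChartAt_source (I := 𝓘(ℝ, E)) m)
  let D : E →L[ℝ] E := mfderiv 𝓘(ℝ, E) 𝓘(ℝ, E) (extChartAt 𝓘(ℝ, E) m) m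
  have hD : D.inverse.comp D = ContinuousLinearMap.id ℝ E := hinv.inverse_comp_self
  let c' : E →ₗ[ℝ] ℝ := c
  let l : E →L[ℝ] ℝ := (LinearMap.toContinuousLinearMap c').comp D.inverse
  have hsm : ContMDiffOn 𝓘(ℝ, E) 𝓘(ℝ, ℝ) ∞ (fun x => l (extChartAt 𝓘(ℝ, E) m x))
      (chartAt E m).source :=
    l.contMDiff.comp_contMDiffOn (contMDiffOn_extChartAt (I := 𝓘(ℝ, E)) (n := ∞) (x := m))
  obtain ⟨f, hf, hfe⟩ := exists_contMDiff_eventuallyEq (chartAt E m).open_source hsm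
    (mem_chart_source E m)
  refine ⟨f, hf, ?_⟩
  rw [diff_congr hfe]
  refine LinearMap.ext fun v => ?_
  have h1 : dirDeriv (fun x => l (extChartAt 𝓘(ℝ, E) m x)) m v = l (D v) := by
    refine (dirDeriv_comp (f := l) l.differentiableAt.mdifferentiableAt
      (mdifferentiableAt_extChartAt (mem_chart_source E m)) v).trans ?_
    unfold dirDeriv
    rw [mfderiv_eq_fderiv, l.fderiv]
    rfl
  refine h1.trans ?_
  change c' (D.inverse (D v)) = c' v
  exact congrArg c' (DFunLike.congr_fun hD v)

variable {E' : Type*} [NormedAddCommGroup E'] [NormedSpace ℝ E']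
  {S : Type*} [TopologicalSpace S] [ChartedSpace E' S]

omit [FiniteDimensional ℝ E] [IsManifold 𝓘(ℝ, E) ∞ M] [T2Space M] in
/-- An immersion has smooth local left inverses. -/
theorem exists_leftInverse_of_immersion {i : S → M}
    (h : Manifold.IsImmersion 𝓘(ℝ, E') 𝓘(ℝ, E) ∞ i) (s : S) :
    ∃ (r : M → S) (U : Set M), IsOpen U ∧ i s ∈ U ∧ ContMDiffOn 𝓘(ℝ, E) 𝓘(ℝ, E') ∞ r U ∧
      ∀ᶠ x in 𝓝 s, r (i x) = x := by
  have hs := h.isImmersionAt s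
  let c := hs.domChart
  let d := hs.codChart
  have hc : s ∈ c.source := hs.mem_domChart_source
  have hd : i s ∈ d.source := hs.mem_codChart_source
  have key : ∀ x ∈ c.source, (hs.equiv.symm (d.extend 𝓘(ℝ, E) (i x))).1 =
      c.extend 𝓘(ℝ, E') x := by
    intro x hx
    have hx' : (c.extend 𝓘(ℝ, E')) x ∈ (c.extend 𝓘(ℝ, E')).target :=
      (c.extend 𝓘(ℝ, E')).map_source (by rwa [c.extend_source])
    have h1 := hs.writtenInCharts hx'
    have h2 : (c.extend 𝓘(ℝ, E')).symm ((c.extend 𝓘(ℝ, E')) x) = x :=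
      (c.extend 𝓘(ℝ, E')).left_inv (by rwa [c.extend_source])
    simp only [Function.comp_apply] at h1
    have h1' : (d.extend 𝓘(ℝ, E)) (i x) = hs.equiv ((c.extend 𝓘(ℝ, E')) x, 0) := by
      rw [← h1]
      change _ = (d.extend 𝓘(ℝ, E)) (i ((c.extend 𝓘(ℝ, E')).symm ((c.extend 𝓘(ℝ, E')) x)))
      rw [h2]
    rw [h1']
    simp
  -- in slice charts the immersion is `z ↦ (z, 0)`, and `p` is the projection to the first factor
  let p : M → E' := fun y => (hs.equiv.symm (d.extend 𝓘(ℝ, E) y)).1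
  have hp : ContMDiffOn 𝓘(ℝ, E) 𝓘(ℝ, E') ∞ p d.source := by
    intro y hy
    have e1 : ContMDiffAt 𝓘(ℝ, E) 𝓘(ℝ, E) ∞ (d.extend 𝓘(ℝ, E)) y :=
      OpenPartialHomeomorph.contMDiffAt_extend hs.codChart_mem_maximalAtlas hy
    have e2 : ContDiff ℝ ∞ (fun z : E => (hs.equiv.symm z).1) := by fun_prop
    exact (e2.contMDiff.contMDiffAt.comp y e1).contMDiffWithinAt
  refine ⟨(c.extend 𝓘(ℝ, E')).symm ∘ p, d.source ∩ p ⁻¹' (c.extend 𝓘(ℝ, E')).target,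
    hp.continuousOn.isOpen_inter_preimage d.open_source c.isOpen_extend_target, ⟨hd, ?_⟩, ?_, ?_⟩
  · change (hs.equiv.symm (d.extend 𝓘(ℝ, E) (i s))).1 ∈ (c.extend 𝓘(ℝ, E')).target
    rw [key s hc]
    exact (c.extend 𝓘(ℝ, E')).map_source (by rwa [c.extend_source])
  · have h3 := contMDiffOn_extend_symm (I := 𝓘(ℝ, E')) hs.domChart_mem_maximalAtlas
    refine ContMDiffOn.comp (t := (c.extend 𝓘(ℝ, E')).target) (h3.mono ?_)
      (hp.mono Set.inter_subset_left) Set.inter_subset_right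
    intro y hy
    simpa [c] using hy
  · filter_upwards [c.open_source.mem_nhds hc] with x hx
    change (c.extend 𝓘(ℝ, E')).symm (hs.equiv.symm (d.extend 𝓘(ℝ, E) (i x))).1 = x
    rw [key x hx]
    exact (c.extend 𝓘(ℝ, E')).left_inv (by rwa [c.extend_source])

/-- A smooth function on the source of an immersion extends, locally on the source, to the
target. -/
theorem exists_extension_of_immersion {i : S → M}
    (h : Manifold.IsImmersion 𝓘(ℝ, E') 𝓘(ℝ, E) ∞ i) {f : S → ℝ}
    (hf : ContMDiff 𝓘(ℝ, E') 𝓘(ℝ, ℝ) ∞ f) (s : S) :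
    ∃ g : M → ℝ, ContMDiff 𝓘(ℝ, E) 𝓘(ℝ, ℝ) ∞ g ∧ ∀ᶠ x in 𝓝 s, g (i x) = f x := by
  obtain ⟨r, U, hU, hsU, hr, hri⟩ := exists_leftInverse_of_immersion h s
  obtain ⟨g, hg, hge⟩ := exists_contMDiff_eventuallyEq hU (hf.comp_contMDiffOn hr) hsU
  refine ⟨g, hg, ?_⟩
  filter_upwards [hri, (h.contMDiff.continuous.continuousAt (x := s)).eventually hge] with x h1 h2
  rw [h2, Function.comp_apply, h1]

omit [FiniteDimensional ℝ E] [IsManifold 𝓘(ℝ, E) ∞ M] [T2Space M] in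
/-- A submersion has smooth local sections. -/
theorem exists_section_of_submersion {q : M → S}
    (h : Manifold.IsSubmersion 𝓘(ℝ, E) 𝓘(ℝ, E') ∞ q) (m : M) :
    ∃ r : S → M, ContMDiffAt 𝓘(ℝ, E') 𝓘(ℝ, E) ∞ r (q m) ∧ r (q m) = m ∧
      ∀ᶠ y in 𝓝 (q m), q (r y) = y := by
  have hs := h.isSubmersionAt m
  let c := hs.domChart
  let d := hs.codChart
  have hc : m ∈ c.source := hs.mem_domChart_source
  have hd : q m ∈ d.source := hs.mem_codChart_source
  have hcm : c.extend 𝓘(ℝ, E) m ∈ (c.extend 𝓘(ℝ, E)).target :=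
    (c.extend 𝓘(ℝ, E)).map_source (by rwa [c.extend_source])
  have hleft : (c.extend 𝓘(ℝ, E)).symm (c.extend 𝓘(ℝ, E) m) = m :=
    (c.extend 𝓘(ℝ, E)).left_inv (by rwa [c.extend_source])
  have key : ∀ z ∈ (c.extend 𝓘(ℝ, E)).target,
      d.extend 𝓘(ℝ, E') (q ((c.extend 𝓘(ℝ, E)).symm z)) = (hs.equiv z).1 :=
    fun z hz => hs.writtenInCharts hz
  let p : S → E := fun y =>
    hs.equiv.symm (d.extend 𝓘(ℝ, E') y, (hs.equiv (c.extend 𝓘(ℝ, E) m)).2)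
  have hpm : p (q m) = c.extend 𝓘(ℝ, E) m := by
    have h1 : d.extend 𝓘(ℝ, E') (q m) = (hs.equiv (c.extend 𝓘(ℝ, E) m)).1 := by
      have := key _ hcm
      rwa [hleft] at this
    simp only [p]
    rw [h1]
    simp
  have hp : ContMDiffAt 𝓘(ℝ, E') 𝓘(ℝ, E) ∞ p (q m) := by
    have e1 : ContMDiffAt 𝓘(ℝ, E') 𝓘(ℝ, E') ∞ (d.extend 𝓘(ℝ, E')) (q m) :=
      OpenPartialHomeomorph.contMDiffAt_extend hs.codChart_mem_maximalAtlas hd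
    have e2 : ContDiff ℝ ∞
        (fun z : E' => hs.equiv.symm (z, (hs.equiv (c.extend 𝓘(ℝ, E) m)).2)) := by fun_prop
    exact e2.contMDiff.contMDiffAt.comp (q m) e1
  have hcs : ContMDiffAt 𝓘(ℝ, E) 𝓘(ℝ, E) ∞ (c.extend 𝓘(ℝ, E)).symm (p (q m)) := by
    have h3 := contMDiffOn_extend_symm (I := 𝓘(ℝ, E)) hs.domChart_mem_maximalAtlas
    refine (h3.mono ?_).contMDiffAt (c.isOpen_extend_target.mem_nhds (hpm ▸ hcm))
    intro y hy
    simpa [c] using hy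
  have hr : ContMDiffAt 𝓘(ℝ, E') 𝓘(ℝ, E) ∞ ((c.extend 𝓘(ℝ, E)).symm ∘ p) (q m) :=
    hcs.comp (q m) hp
  have hrm : ((c.extend 𝓘(ℝ, E)).symm ∘ p) (q m) = m := by
    rw [Function.comp_apply, hpm, hleft]
  refine ⟨(c.extend 𝓘(ℝ, E)).symm ∘ p, hr, hrm, ?_⟩
  have hqr : ContinuousAt (fun y => q (((c.extend 𝓘(ℝ, E)).symm ∘ p) y)) (q m) := by
    refine ContinuousAt.comp ?_ hr.continuousAt
    rw [hrm]
    exact h.contMDiff.continuous.continuousAt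
  have hd' : d.source ∈ 𝓝 (q (((c.extend 𝓘(ℝ, E)).symm ∘ p) (q m))) := by
    rw [hrm]
    exact d.open_source.mem_nhds hd
  filter_upwards [hp.continuousAt.eventually (c.isOpen_extend_target.mem_nhds (hpm ▸ hcm)),
    hqr.eventually hd', d.open_source.mem_nhds hd] with y hy1 hy2 hy3
  have h4 := key (p y) hy1
  have h5 : (hs.equiv (p y)).1 = d.extend 𝓘(ℝ, E') y := by simp [p]
  rw [h5] at h4
  exact (d.extend 𝓘(ℝ, E')).injOn (by rwa [d.extend_source]) (by rwa [d.extend_source]) h4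

omit [FiniteDimensional ℝ E] [IsManifold 𝓘(ℝ, E) ∞ M] [T2Space M] in
theorem mfderiv_surjective_of_submersion {q : M → S}
    (h : Manifold.IsSubmersion 𝓘(ℝ, E) 𝓘(ℝ, E') ∞ q) (m : M) :
    Function.Surjective (mfderiv 𝓘(ℝ, E) 𝓘(ℝ, E') q m) := by
  obtain ⟨r, hr, hrm, hqr⟩ := exists_section_of_submersion h m
  have hne : (∞ : ℕ∞ω) ≠ 0 := by simp
  have hq : MDifferentiableAt 𝓘(ℝ, E) 𝓘(ℝ, E') q (r (q m)) :=
    h.contMDiff.mdifferentiableAt hne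
  have h1 : HasMFDerivAt 𝓘(ℝ, E') 𝓘(ℝ, E') (q ∘ r) (q m)
      ((mfderiv 𝓘(ℝ, E) 𝓘(ℝ, E') q (r (q m))).comp (mfderiv 𝓘(ℝ, E') 𝓘(ℝ, E) r (q m))) :=
    hq.hasMFDerivAt.comp (q m) (hr.mdifferentiableAt hne).hasMFDerivAt
  have h2 : HasMFDerivAt 𝓘(ℝ, E') 𝓘(ℝ, E') (q ∘ r) (q m) (ContinuousLinearMap.id ℝ _) :=
    (hasMFDerivAt_id (q m)).congr_of_eventuallyEq hqr
  have h3 := hasMFDerivAt_unique h1 h2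
  intro v
  have h4 := DFunLike.congr_fun h3 v
  have h5 : ∀ m', m' = m → ∀ u : E, (mfderiv 𝓘(ℝ, E) 𝓘(ℝ, E') q m' u : E') =
      mfderiv 𝓘(ℝ, E) 𝓘(ℝ, E') q m u := by
    rintro _ rfl u
    rfl
  exact ⟨mfderiv 𝓘(ℝ, E') 𝓘(ℝ, E) r (q m) v, (h5 _ hrm _).symm.trans h4⟩

omit [FiniteDimensional ℝ E] [IsManifold 𝓘(ℝ, E) ∞ M] [T2Space M] in
/-- A function is smooth if its pullback along a surjective submersion is. -/
theorem contMDiff_of_comp_submersion {q : M → S}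
    (h : Manifold.IsSubmersion 𝓘(ℝ, E) 𝓘(ℝ, E') ∞ q) (hq : Function.Surjective q) {f : S → ℝ}
    (hf : ContMDiff 𝓘(ℝ, E) 𝓘(ℝ, ℝ) ∞ (fun m => f (q m))) :
    ContMDiff 𝓘(ℝ, E') 𝓘(ℝ, ℝ) ∞ f := by
  intro y
  obtain ⟨m, rfl⟩ := hq y
  obtain ⟨r, hr, -, hqr⟩ := exists_section_of_submersion h m
  have h1 : ContMDiffAt 𝓘(ℝ, E') 𝓘(ℝ, ℝ) ∞ ((fun m => f (q m)) ∘ r) (q m) :=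
    hf.contMDiffAt.comp (q m) hr
  refine h1.congr_of_eventuallyEq ?_
  filter_upwards [hqr] with y hy
  simp [hy]

end Extension

/-! ### Functions constant along orbits -/

section Orbits

variable {E : Type*} [NormedAddCommGroup E] [NormedSpace ℝ E]
  {M : Type*} [TopologicalSpace M] [ChartedSpace E M]

/-- A function whose derivative along a family of vector fields vanishes is constant on the
orbits. -/
theorem SameOrbit.eq_of_dirDeriv_eq_zero {A : Type*} {act : A → (m : M) → Tan E m} {f : M → ℝ}
    (hf : MDifferentiable 𝓘(ℝ, E) 𝓘(ℝ, ℝ) f) (h0 : ∀ ζ m, dirDeriv f m (act ζ m) = 0)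
    {x y : M} (h : SameOrbit act x y) : f x = f y := by
  induction h with
  | refl => rfl
  | symm _ _ _ ih => exact ih.symm
  | trans _ _ _ _ _ ih1 ih2 => exact ih1.trans ih2
  | rel x y hxy =>
    obtain ⟨ζ, γ, r, s, hγ, t₀, ht₀, t₁, ht₁, rfl, rfl⟩ := hxy
    have hd : ∀ t ∈ Set.Ioo r s, HasDerivAt (f ∘ γ) 0 t := by
      intro t ht
      have h1 := (hγ t ht).hasMFDerivAt (isOpen_Ioo.mem_nhds ht)
      let L : ℝ →L[ℝ] ℝ := (mfderiv 𝓘(ℝ, E) 𝓘(ℝ, ℝ) f (γ t)).comp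
        (ContinuousLinearMap.smulRight (1 : ℝ →L[ℝ] ℝ) (act ζ (γ t)))
      have h2 : HasFDerivAt (f ∘ γ) L t := ((hf (γ t)).hasMFDerivAt.comp t h1).hasFDerivAt
      refine h2.hasDerivAt.congr_deriv ?_
      change dirDeriv f (γ t) ((1 : ℝ) • act ζ (γ t)) = 0
      rw [one_smul]
      exact h0 ζ (γ t)
    exact isOpen_Ioo.is_const_of_deriv_eq_zero isPreconnected_Ioo
      (fun t ht => (hd t ht).differentiableAt.differentiableWithinAt)
      (fun t ht => (hd t ht).deriv) ht₀ ht₁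

end Orbits

/-! ### Linear systems with smooth coefficients -/

section Matrix

variable {E : Type*} [NormedAddCommGroup E] [NormedSpace ℝ E]
  {M : Type*} [TopologicalSpace M] [ChartedSpace E M] {ι : Type*} [Fintype ι] [DecidableEq ι]

theorem contMDiffAt_det {A : M → Matrix ι ι ℝ} {m : M}
    (hA : ∀ i j, ContMDiffAt 𝓘(ℝ, E) 𝓘(ℝ, ℝ) ∞ (fun x => A x i j) m) :
    ContMDiffAt 𝓘(ℝ, E) 𝓘(ℝ, ℝ) ∞ (fun x => (A x).det) m := by
  simp only [Matrix.det_apply']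
  exact contMDiffAt_finsetSum fun σ _ =>
    contMDiffAt_const.mul (contMDiffAt_finsetProd fun i _ => hA (σ i) i)

/-- The solution of a linear system depends smoothly on the system. -/
theorem contMDiffAt_inv_mulVec {A : M → Matrix ι ι ℝ} {y : M → ι → ℝ} {m : M}
    (hA : ∀ i j, ContMDiffAt 𝓘(ℝ, E) 𝓘(ℝ, ℝ) ∞ (fun x => A x i j) m)
    (hy : ∀ i, ContMDiffAt 𝓘(ℝ, E) 𝓘(ℝ, ℝ) ∞ (fun x => y x i) m) (hm : (A m).det ≠ 0) (i : ι) :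
    ContMDiffAt 𝓘(ℝ, E) 𝓘(ℝ, ℝ) ∞ (fun x => ((A x)⁻¹.mulVec (y x)) i) m := by
  simp only [Matrix.mulVec, dotProduct, Matrix.inv_def, Matrix.smul_apply, Ring.inverse_eq_inv',
    smul_eq_mul]
  refine contMDiffAt_finsetSum fun j _ => ContMDiffAt.mul (ContMDiffAt.mul ?_ ?_) (hy j)
  · exact (contMDiffAt_det hA).inv₀ hm
  · simp only [Matrix.adjugate_apply]
    refine contMDiffAt_det fun k l => ?_
    by_cases hk : k = j
    · subst hk
      simp only [Matrix.updateRow_self]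
      exact contMDiffAt_const
    · simp only [Matrix.updateRow_ne hk]
      exact hA k l

end Matrix

/-! ### Bivectors -/

section LinearAlgebra

variable {V : Type*} [AddCommGroup V] [Module ℝ V]

theorem Bivector.ext_apply {b c : Bivector V} (h : ∀ α β, b ![α, β] = c ![α, β]) : b = c := by
  refine AlternatingMap.ext fun v => ?_
  have hv : v = ![v 0, v 1] := by
    funext k
    fin_cases k <;> rfl
  rw [hv]
  exact h _ _

theorem Bivector.push_apply {W : Type*} [AddCommGroup W] [Module ℝ W] (f : V →ₗ[ℝ] W)
    (b : Bivector V) (α β : Module.Dual ℝ W) :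
    b.push f ![α, β] = b ![α.comp f, β.comp f] := by
  rw [Bivector.push, AlternatingMap.compLinearMap_apply]
  congr 1
  funext k
  fin_cases k <;> rfl

theorem Bivector.push_injective {W : Type*} [AddCommGroup W] [Module ℝ W] {f : V →ₗ[ℝ] W}
    (hf : Function.Injective f) : Function.Injective (Bivector.push f) := by
  intro b c h
  obtain ⟨g, hg⟩ := f.exists_leftInverse_of_injective (LinearMap.ker_eq_bot.2 hf)
  refine Bivector.ext_apply fun α β => ?_
  have h1 : ∀ α : Module.Dual ℝ V, (α.comp g).comp f = α := fun α => by
    rw [LinearMap.comp_assoc, hg, LinearMap.comp_id]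
  have h2 := congrArg (fun d => d ![α.comp g, β.comp g]) h
  simpa only [Bivector.push_apply, h1] using h2

/-- A bivector can be evaluated by linear combinations in both arguments. -/
theorem Bivector.apply_sum {ι : Type*} [Fintype ι] (b : Bivector V) (c d : ι → ℝ)
    (e : ι → Module.Dual ℝ V) :
    b ![∑ i, c i • e i, ∑ j, d j • e j] = ∑ i, ∑ j, c i * d j * b ![e i, e j] := by
  have h0 : ∀ α β γ : Module.Dual ℝ V, Function.update ![α, β] 0 γ = ![γ, β] := fun α β γ => by
    funext k
    fin_cases k <;> rfl
  have h1 : ∀ α β γ : Module.Dual ℝ V, Function.update ![α, β] 1 γ = ![α, γ] := fun α β γ => by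
    funext k
    fin_cases k <;> rfl
  let f : Module.Dual ℝ V →ₗ[ℝ] Module.Dual ℝ V →ₗ[ℝ] ℝ := LinearMap.mk₂ ℝ (fun α β => b ![α, β])
    (fun α α' β => by simpa only [h0] using b.map_update_add ![α, β] 0 α α')
    (fun r α β => by simpa only [h0] using b.map_update_smul ![α, β] 0 r α)
    (fun α β β' => by simpa only [h1] using b.map_update_add ![α, β] 1 β β')
    (fun r α β => by simpa only [h1] using b.map_update_smul ![α, β] 1 r β)
  change f (∑ i, c i • e i) (∑ j, d j • e j) = ∑ i, ∑ j, c i * d j * f (e i) (e j)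
  simp only [map_sum, map_smul, LinearMap.sum_apply, LinearMap.smul_apply, smul_eq_mul,
    Finset.mul_sum]
  rw [Finset.sum_comm]
  exact Finset.sum_congr rfl fun i _ => Finset.sum_congr rfl fun j _ => by ring

/-- An isotropic relation `G ⊆ V × V*` in which every covector occurs is the graph of exactly one
bivector; linearity of `G` is automatic. -/
theorem Bivector.existsUnique_graph_eq {G : Set (V × Module.Dual ℝ V)}
    (hG : ∀ α, ∃ X, (X, α) ∈ G) (hiso : ∀ p ∈ G, ∀ p' ∈ G, p.2 p'.1 + p'.2 p.1 = 0) :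
    ∃! b : Bivector V, G = b.graph := by
  choose X hX using hG
  have key : ∀ Y Z : V, (∀ β : Module.Dual ℝ V, β Y = β Z) → Y = Z := fun Y Z h => by
    rw [← sub_eq_zero, ← Module.forall_dual_apply_eq_zero_iff ℝ]
    intro β
    rw [map_sub, h, sub_self]
  have hs : ∀ α β : Module.Dual ℝ V, β (X α) = - α (X β) := fun α β => by
    have := hiso _ (hX α) _ (hX β)
    linarith
  have hadd : ∀ α α', X (α + α') = X α + X α' := fun α α' => key _ _ fun β => by
    rw [hs, map_add, hs α, hs α', LinearMap.add_apply]
    ring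
  have hsmul : ∀ (r : ℝ) α, X (r • α) = r • X α := fun r α => key _ _ fun β => by
    rw [hs, map_smul, hs α, LinearMap.smul_apply, smul_neg]
  let b : Bivector V :=
    { toFun := fun v => v 1 (X (v 0))
      map_update_add' := by
        intro _ v i x y
        fin_cases i
        · simp [hadd]
        · simp
      map_update_smul' := by
        intro _ v i r x
        fin_cases i
        · simp [hsmul]
        · simp
      map_eq_zero_of_eq' := by
        intro v i j hv hij
        have h01 : v 0 = v 1 := by
          fin_cases i <;> fin_cases j <;> first | exact absurd rfl hij | exact hv | exact hv.symm
        have h1 := hs (v 1) (v 1)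
        change v 1 (X (v 0)) = 0
        rw [h01]
        linarith }
  have hb : ∀ α β, b ![α, β] = β (X α) := fun α β => rfl
  refine ⟨b, ?_, ?_⟩
  · ext ⟨Y, α⟩
    constructor
    · intro h β
      change β Y = b ![α, β]
      rw [hb, hs]
      have := hiso _ h _ (hX β)
      simp only at this
      linarith
    · intro h
      have : Y = X α := key _ _ fun β => (h β).trans (hb α β)
      rw [this]
      exact hX α
  · intro c hc
    refine Bivector.ext_apply fun α β => ?_
    have h := hX α
    rw [hc] at h
    exact (h β).symm.trans (hb α β).symm

end LinearAlgebra

/-! ### Lagrangian complements and twists -/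

section Lagrangian

variable {V : Type*} [AddCommGroup V] [Module ℝ V] {B : LinearMap.BilinForm ℝ V}

theorem IsLagrangian.apply_eq_zero {W : Submodule ℝ V} (h : IsLagrangian B W) {x y : V}
    (hx : x ∈ W) (hy : y ∈ W) : B x y = 0 := by
  have hy' : y ∈ B.orthogonal W := by
    rw [IsLagrangian] at h
    rwa [h]
  exact (LinearMap.BilinForm.mem_orthogonal_iff.mp hy') x hx

theorem IsLagrangian.mem_of_forall {W : Submodule ℝ V} (h : IsLagrangian B W) {y : V}
    (hy : ∀ x ∈ W, B x y = 0) : y ∈ W := by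
  have hy' : y ∈ B.orthogonal W := LinearMap.BilinForm.mem_orthogonal_iff.mpr hy
  rw [IsLagrangian] at h
  rwa [h] at hy'

/-- A Lagrangian complement `K` of `H` is identified with the dual of `H`. -/
theorem IsLagrangian.exists_mem_forall_apply_eq [FiniteDimensional ℝ V] (hB : B.IsSymm)
    (hnd : B.Nondegenerate) {H K : Submodule ℝ V} (hK : IsLagrangian B K) (hHK : IsCompl H K)
    (f : ↥H →ₗ[ℝ] ℝ) : ∃ ξ ∈ K, ∀ u : ↥H, B ξ (u : V) = f u := by
  let g : Module.Dual ℝ V := f.comp (H.projectionOnto K hHK)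
  have hg : ∀ v, B ((B.toDual hnd).symm g) v = f (H.projectionOnto K hHK v) := fun v => by
    rw [LinearMap.BilinForm.apply_toDual_symm_apply]
    rfl
  refine ⟨(B.toDual hnd).symm g, hK.mem_of_forall fun x hx => ?_, fun u => ?_⟩
  · rw [hB.eq, hg, (Submodule.projectionOnto_apply_eq_zero_iff hHK).2 hx, map_zero]
  · rw [hg, Submodule.projectionOnto_apply_left]

variable {C H K : Submodule ℝ V} {K' : Submodule ℝ (CoisoQuotient B C)}

theorem mem_liftSubspace {v : V} :
    v ∈ liftSubspace B C K' ↔ ∃ h : v ∈ C, Submodule.Quotient.mk ⟨v, h⟩ ∈ K' := by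
  constructor
  · rintro ⟨x, hx, rfl⟩
    exact ⟨x.2, hx⟩
  · rintro ⟨h, hx⟩
    exact ⟨⟨v, h⟩, hx, rfl⟩

theorem liftSubspace_le : liftSubspace B C K' ≤ C := fun _ hv => (mem_liftSubspace.1 hv).1

theorem orthogonal_le_liftSubspace (hC : B.orthogonal C ≤ C) :
    B.orthogonal C ≤ liftSubspace B C K' := by
  intro v hv
  refine mem_liftSubspace.2 ⟨hC hv, ?_⟩
  have h0 : (Submodule.Quotient.mk ⟨v, hC hv⟩ : CoisoQuotient B C) = 0 :=
    (Submodule.Quotient.mk_eq_zero _).2 hv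
  rw [h0]
  exact K'.zero_mem

theorem apply_eq_zero_of_mem_liftSubspace (hB : B.IsSymm)
    (hK' : IsLagrangian (reducedForm B hB C) K') {v w : V} (hv : v ∈ liftSubspace B C K')
    (hw : w ∈ liftSubspace B C K') : B v w = 0 := by
  obtain ⟨hv1, hv2⟩ := mem_liftSubspace.1 hv
  obtain ⟨hw1, hw2⟩ := mem_liftSubspace.1 hw
  exact hK'.apply_eq_zero hv2 hw2

/-- An element that annihilates `H ∩ C^⊥` lies in `H + C`, so that it can be moved into the
preimage of the complement `K'` of `H_C` by an element of `H`. -/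
theorem exists_add_mem_liftSubspace [FiniteDimensional ℝ V] (hB : B.IsSymm)
    (hnd : B.Nondegenerate) (hH : IsLagrangian B H)
    (hHK' : IsCompl (reducedSubspace B C H) K') {ξ : V}
    (hξ : ∀ u ∈ H, u ∈ B.orthogonal C → B ξ u = 0) :
    ∃ w ∈ H, ξ + w ∈ liftSubspace B C K' := by
  have h1 : ξ ∈ H ⊔ C := by
    rw [← LinearMap.BilinForm.orthogonal_orthogonal hnd hB.isRefl (H ⊔ C)]
    refine LinearMap.BilinForm.mem_orthogonal_iff.2 fun u hu => ?_
    rw [LinearMap.BilinForm.mem_orthogonal_iff] at hu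
    change B u ξ = 0
    rw [hB.eq]
    exact hξ u (hH.mem_of_forall fun x hx => hu x (Submodule.mem_sup_left hx))
      (LinearMap.BilinForm.mem_orthogonal_iff.2 fun x hx => hu x (Submodule.mem_sup_right hx))
  obtain ⟨h, hh, c, hc, rfl⟩ := Submodule.mem_sup.1 h1
  have h2 : (Submodule.Quotient.mk ⟨c, hc⟩ : CoisoQuotient B C) ∈ reducedSubspace B C H ⊔ K' := by
    rw [hHK'.sup_eq_top]
    trivial
  obtain ⟨_, ⟨y, hy, rfl⟩, z, hz, hyz⟩ := Submodule.mem_sup.1 h2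
  refine ⟨-h - y, H.sub_mem (H.neg_mem hh) hy, mem_liftSubspace.2 ?_⟩
  have h3 : h + c + (-h - (y : V)) = c - y := by abel
  rw [h3]
  refine ⟨C.sub_mem hc y.2, ?_⟩
  have h4 : z = Submodule.Quotient.mk (⟨c, hc⟩ - y) := by
    rw [Submodule.Quotient.mk_sub, ← hyz]
    simp
  rw [h4] at hz
  exact hz

theorem apply_eq_zero_of_add_mem_liftSubspace (hH : IsLagrangian B H) {ξ w u : V}
    (hw : w ∈ H) (hξw : ξ + w ∈ liftSubspace B C K') (hu : u ∈ H) (huC : u ∈ B.orthogonal C) :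
    B ξ u = 0 := by
  have h1 : B (ξ + w) u = 0 :=
    (LinearMap.BilinForm.mem_orthogonal_iff.1 huC) _ (liftSubspace_le hξw)
  have h2 : B w u = 0 := hH.apply_eq_zero hw hu
  rw [map_add, LinearMap.add_apply, h2, add_zero] at h1
  exact h1

/-- The relation between `H / (H ∩ C^⊥)` and its dual that is the graph of `τ^♯`, as read off from
the preimage of `K'`. -/
def twistGraph (B : LinearMap.BilinForm ℝ V) (C H K : Submodule ℝ V)
    (K' : Submodule ℝ (CoisoQuotient B C)) :
    Set ((↥H ⧸ stab B C H) × Module.Dual ℝ (↥H ⧸ stab B C H)) :=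
  {p | ∃ ξ ∈ K, (∀ u : ↥H, p.2 (Submodule.Quotient.mk u) = B ξ (u : V)) ∧
    ∃ w : ↥H, Submodule.Quotient.mk w = p.1 ∧ ξ + (w : V) ∈ liftSubspace B C K'}

/-- The functional on `H / (H ∩ C^⊥)` defined by an element that annihilates `H ∩ C^⊥`. -/
theorem exists_dual_eq {ξ : V} (hξ : ∀ u ∈ H, u ∈ B.orthogonal C → B ξ u = 0) :
    ∃ κ : Module.Dual ℝ (↥H ⧸ stab B C H),
      ∀ u : ↥H, κ (Submodule.Quotient.mk u) = B ξ (u : V) :=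
  ⟨(stab B C H).liftQ ((B ξ).comp H.subtype) fun u hu => hξ u u.2 hu, fun _ => rfl⟩

theorem eq_of_add_eq_add (hHK : IsCompl H K) {ξ ξ' w w' : V} (hξ : ξ ∈ K) (hξ' : ξ' ∈ K)
    (hw : w ∈ H) (hw' : w' ∈ H) (h : ξ + w = ξ' + w') : ξ = ξ' ∧ w = w' := by
  have h1 : ξ - ξ' = w' - w := by
    rw [sub_eq_sub_iff_add_eq_add, h, add_comm]
  have h2 : ξ - ξ' ∈ H ⊓ K := ⟨h1 ▸ H.sub_mem hw' hw, K.sub_mem hξ hξ'⟩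
  have h3 : ξ - ξ' = 0 := hHK.disjoint.le_bot h2
  refine ⟨sub_eq_zero.1 h3, ?_⟩
  rw [h3] at h1
  exact (sub_eq_zero.1 h1.symm).symm

theorem eq_zero_of_mem_of_forall (hH : IsLagrangian B H) (hB : B.IsSymm) (hHK : IsCompl H K)
    {ξ : V} (hξ : ξ ∈ K) (h : ∀ u ∈ H, B ξ u = 0) : ξ = 0 := by
  have h1 : ξ ∈ H := hH.mem_of_forall fun x hx => by
    rw [hB.eq]
    exact h x hx
  exact hHK.disjoint.le_bot ⟨h1, hξ⟩

/-- The decomposition of the preimage of `K'` by `τ` says that `twistGraph` is the graph of `τ`; so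
the twist exists and is unique by the general criterion for graphs of bivectors. -/
theorem isTwist_iff [FiniteDimensional ℝ V] (hB : B.IsSymm) (hnd : B.Nondegenerate)
    (hH : IsLagrangian B H) (hK : IsLagrangian B K) (hHK : IsCompl H K)
    (hC : B.orthogonal C ≤ C) {τ : Bivector (↥H ⧸ stab B C H)} :
    IsTwist B C H K K' τ ↔ twistGraph B C H K K' = τ.graph := by
  constructor
  · intro hτ
    ext ⟨X, κ⟩
    constructor
    · rintro ⟨ξ, hξ, hκ, w, rfl, hL⟩
      obtain ⟨ξ', hξ', κ', hκ', w', hv, hν⟩ := (hτ _).1 hL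
      obtain ⟨rfl, hww⟩ := eq_of_add_eq_add hHK hξ hξ' w.2 w'.2 hv
      obtain rfl : w = w' := Subtype.ext hww
      obtain rfl : κ = κ' := by
        refine LinearMap.ext fun x => ?_
        obtain ⟨u, rfl⟩ := Submodule.Quotient.mk_surjective _ x
        rw [hκ', ← hκ u]
      exact hν
    · intro h
      obtain ⟨w, rfl⟩ := Submodule.Quotient.mk_surjective _ X
      obtain ⟨ξ, hξ, hξκ⟩ := hK.exists_mem_forall_apply_eq hB hnd hHK
        (κ.comp (stab B C H).mkQ)
      have hκ : ∀ u : ↥H, κ (Submodule.Quotient.mk u) = B ξ (u : V) := fun u => (hξκ u).symm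
      exact ⟨ξ, hξ, hκ, w, rfl, (hτ _).2 ⟨ξ, hξ, κ, hκ, w, rfl, h⟩⟩
  · intro hG v
    constructor
    · intro hv
      obtain ⟨w, hw, ξ, hξ, rfl⟩ := Submodule.mem_sup.1
        (hHK.sup_eq_top ▸ Submodule.mem_top : v ∈ H ⊔ K)
      rw [add_comm] at hv
      obtain ⟨κ, hκ⟩ := exists_dual_eq (B := B) (C := C) (H := H) (ξ := ξ)
        fun u hu huC => apply_eq_zero_of_add_mem_liftSubspace hH hw hv hu huC
      have h1 : ((Submodule.Quotient.mk ⟨w, hw⟩, κ) :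
          (↥H ⧸ stab B C H) × Module.Dual ℝ (↥H ⧸ stab B C H)) ∈ twistGraph B C H K K' :=
        ⟨ξ, hξ, hκ, ⟨w, hw⟩, rfl, hv⟩
      rw [hG] at h1
      exact ⟨ξ, hξ, κ, hκ, ⟨w, hw⟩, add_comm _ _, h1⟩
    · rintro ⟨ξ, hξ, κ, hκ, w, rfl, hν⟩
      have h1 : ((Submodule.Quotient.mk w, κ) :
          (↥H ⧸ stab B C H) × Module.Dual ℝ (↥H ⧸ stab B C H)) ∈ τ.graph := hν
      rw [← hG] at h1
      obtain ⟨ξ', hξ', hκ', w', hw', hL⟩ := h1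
      have hξξ : ξ = ξ' := by
        refine sub_eq_zero.1 (eq_zero_of_mem_of_forall hH hB hHK (K.sub_mem hξ hξ') fun u hu => ?_)
        rw [map_sub, LinearMap.sub_apply, ← hκ ⟨u, hu⟩, ← hκ' ⟨u, hu⟩, sub_self]
      subst hξξ
      have h2 : (w : V) - w' ∈ B.orthogonal C := (Submodule.Quotient.eq (stab B C H)).1 hw'.symm
      have h3 := (liftSubspace B C K').add_mem hL (orthogonal_le_liftSubspace hC h2)
      have h4 : ξ + (w' : V) + ((w : V) - w') = ξ + w := by abel
      rwa [h4] at h3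

/-- The twist of a Lagrangian complement of `H_C` in `C / C^⊥` exists and is unique. -/
theorem existsUnique_isTwist [FiniteDimensional ℝ V] (hB : B.IsSymm) (hnd : B.Nondegenerate)
    (hH : IsLagrangian B H) (hK : IsLagrangian B K) (hHK : IsCompl H K)
    (hC : B.orthogonal C ≤ C) (hK' : IsLagrangian (reducedForm B hB C) K')
    (hHK' : IsCompl (reducedSubspace B C H) K') :
    ∃! τ : Bivector (↥H ⧸ stab B C H), IsTwist B C H K K' τ := by
  simp only [isTwist_iff hB hnd hH hK hHK hC]
  refine Bivector.existsUnique_graph_eq (fun κ => ?_) ?_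
  · obtain ⟨ξ, hξ, hξκ⟩ := hK.exists_mem_forall_apply_eq hB hnd hHK (κ.comp (stab B C H).mkQ)
    obtain ⟨w, hw, hL⟩ := exists_add_mem_liftSubspace (ξ := ξ) hB hnd hH hHK' fun u hu huC => by
      rw [hξκ ⟨u, hu⟩]
      have h0 : (stab B C H).mkQ ⟨u, hu⟩ = 0 := (Submodule.Quotient.mk_eq_zero _).2 huC
      rw [LinearMap.comp_apply, h0, map_zero]
    exact ⟨Submodule.Quotient.mk ⟨w, hw⟩, ξ, hξ, fun u => (hξκ u).symm, ⟨w, hw⟩, rfl, hL⟩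
  · rintro ⟨_, κ⟩ ⟨ξ, hξ, hκ, w, rfl, hL⟩ ⟨_, κ'⟩ ⟨ξ', hξ', hκ', w', rfl, hL'⟩
    have h1 := apply_eq_zero_of_mem_liftSubspace hB hK' hL hL'
    have h2 := hK.apply_eq_zero hξ hξ'
    have h3 := hH.apply_eq_zero w.2 w'.2
    have h4 := hB.eq ξ' w
    change κ (Submodule.Quotient.mk w') + κ' (Submodule.Quotient.mk w) = 0
    rw [hκ, hκ', h4]
    simp only [map_add, LinearMap.add_apply] at h1
    linarith

/-- The element of `H` that moves an element of `K` annihilating `H ∩ C^⊥` into the preimage of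
`K'` can be chosen linearly. -/
theorem exists_linear_twist [FiniteDimensional ℝ V] (hB : B.IsSymm) (hnd : B.Nondegenerate)
    (hH : IsLagrangian B H) (hHK : IsCompl H K)
    (hHK' : IsCompl (reducedSubspace B C H) K') :
    ∃ T : V →ₗ[ℝ] ↥H, ∀ ξ ∈ K, (∀ u ∈ H, u ∈ B.orthogonal C → B ξ u = 0) →
      ξ + (T ξ : V) ∈ liftSubspace B C K' := by
  let p : ↥(liftSubspace B C K') →ₗ[ℝ] V :=
    (K.projection H hHK.symm).comp (liftSubspace B C K').subtype
  obtain ⟨s, hs⟩ := p.rangeRestrict.exists_rightInverse_of_surjective p.range_rangeRestrict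
  obtain ⟨T, hT⟩ := LinearMap.exists_extend
    ((H.projectionOnto K hHK).comp ((liftSubspace B C K').subtype.comp s))
  refine ⟨T, fun ξ hξ hann => ?_⟩
  obtain ⟨w, hw, hL⟩ := exists_add_mem_liftSubspace hB hnd hH hHK' hann
  have hpξ : p ⟨ξ + w, hL⟩ = ξ := by
    change K.projection H hHK.symm (ξ + w) = ξ
    rw [map_add, (Submodule.projection_apply_eq_zero_iff hHK.symm).2 hw, add_zero]
    exact Submodule.projection_apply_left hHK.symm ⟨ξ, hξ⟩
  let x : ↥(LinearMap.range p) := ⟨ξ, ⟨_, hpξ⟩⟩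
  have h1 : p (s x) = ξ := congrArg Subtype.val (DFunLike.congr_fun hs x)
  have h2 : T ξ = H.projectionOnto K hHK (s x) := DFunLike.congr_fun hT x
  have h3 := Submodule.projection_add_projection_eq_self hHK (s x : V)
  have h4 : ((s x : V)) = ξ + (T ξ : V) := by
    rw [h2, Submodule.coe_projectionOnto_apply, add_comm]
    change K.projection H hHK.symm (s x) = ξ at h1
    rw [h1] at h3
    exact h3.symm
  rw [← h4]
  exact (s x).2

end Lagrangian

/-! ### Fibres and smooth sections of a morphism of Manin pairs -/

section Manin

variable {𝔡 : Type*} [LieRing 𝔡] [LieAlgebra ℝ 𝔡] [FiniteDimensional ℝ 𝔡]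
  {EN : Type*} [NormedAddCommGroup EN] [NormedSpace ℝ EN]
  {N : Type*} [TopologicalSpace N] [ChartedSpace EN N] [IsManifold 𝓘(ℝ, EN) ∞ N]
  {EM : Type*} [NormedAddCommGroup EM] [NormedSpace ℝ EM] [FiniteDimensional ℝ EM]
  {M : Type*} [TopologicalSpace M] [ChartedSpace EM M] [IsManifold 𝓘(ℝ, EM) ∞ M]
  {B : LinearMap.BilinForm ℝ 𝔡} {a : LieAction 𝔡 EN N} {H K : Submodule ℝ 𝔡} {μ : M → N}
  {R : (m : M) → Submodule ℝ (𝔡 × Tan EM m × Cot EM m)}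

instance (m : M) : FiniteDimensional ℝ (Tan EM m) := inferInstanceAs (FiniteDimensional ℝ EM)

omit [FiniteDimensional ℝ 𝔡] [FiniteDimensional ℝ EM] in
theorem IsCourantMorphism.isotropic (hR : IsCourantMorphism B a μ R) {m : M}
    {v w : 𝔡 × Tan EM m × Cot EM m} (hv : v ∈ R m) (hw : w ∈ R m) :
    B v.1 w.1 = v.2.2 w.2.1 + w.2.2 v.2.1 :=
  sub_eq_zero.1 ((hR.lagrangian m v).1 hv w hw)

omit [FiniteDimensional ℝ 𝔡] in
/-- The pairing of an element of `R` with `𝔥` is determined by its covector. -/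
theorem IsManinMorphism.apply_eq_cov_rho (hR : IsManinMorphism B a H μ R) (hB : B.IsSymm)
    (hH : IsLagrangian B H) {m : M} {v : 𝔡 × Tan EM m × Cot EM m} (hv : v ∈ R m) (η : ↥H) :
    B v.1 η = v.2.2 (hR.rho hB hH m η) := by
  have h := hR.toIsCourantMorphism.isotropic hv (hR.rho_mem hB hH m η)
  simpa using h

omit [FiniteDimensional ℝ 𝔡] [FiniteDimensional ℝ EM] in
theorem IsManinMorphism.eq_zero_of_mem (hR : IsManinMorphism B a H μ R) (hHK : IsCompl H K)
    {m : M} {κ : 𝔡} (hκ : κ ∈ K) {X : Tan EM m} (h : (κ, X, (0 : Cot EM m)) ∈ R m) :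
    κ = 0 ∧ X = 0 := by
  have h1 : κ = 0 := hHK.disjoint.le_bot ⟨hR.range_le m κ X h, hκ⟩
  subst h1
  exact ⟨rfl, hR.ker_inf m X h⟩

/-- The fibre of `R` is parametrized by `𝔥 × T*M`. -/
theorem IsManinMorphism.exists_mem (hR : IsManinMorphism B a H μ R) (hB : IsInvariantMetric B)
    (hK : IsLagrangian B K) (hHK : IsCompl H K) (m : M) (η : ↥H) (α : Cot EM m) :
    ∃ κ ∈ K, ∃ X : Tan EM m, ((η : 𝔡) + κ, X, α) ∈ R m := by
  let g : ↥(R m) →ₗ[ℝ] ↥H × Cot EM m :=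
    (((H.projectionOnto K hHK).comp (LinearMap.fst ℝ _ _)).prod
      ((LinearMap.snd ℝ _ _).comp (LinearMap.snd ℝ _ _))).comp (R m).subtype
  have hg : LinearMap.range g = ⊤ := by
    by_contra hne
    obtain ⟨f, hf0, hf⟩ := Submodule.exists_le_ker_of_lt_top _ (lt_top_iff_ne_top.2 hne)
    obtain ⟨κ, hκ, hκf⟩ := hK.exists_mem_forall_apply_eq hB.symm hB.nondegenerate hHK
      (f.comp (LinearMap.inl ℝ ↥H (Cot EM m)))
    let Y : Tan EM m := (Module.evalEquiv ℝ (Tan EM m)).symm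
      (f.comp (LinearMap.inr ℝ ↥H (Cot EM m)))
    have hY : ∀ β : Cot EM m, β Y = f (0, β) := fun β => by simp [Y]
    have hf' : ∀ (u : ↥H) (β : Cot EM m), f (u, β) = B κ u + β Y := fun u β => by
      rw [hκf, hY, LinearMap.comp_apply, ← map_add]
      simp
    have hmem : (κ, -Y, (0 : Cot EM m)) ∈ R m := by
      refine (hR.lagrangian m _).2 fun w hw => ?_
      have h1 : f (g ⟨w, hw⟩) = 0 := hf ⟨_, rfl⟩
      have h2 : f (g ⟨w, hw⟩) = B κ (H.projectionOnto K hHK w.1) + w.2.2 Y := hf' _ _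
      have h3 : B κ w.1 = B κ (H.projectionOnto K hHK w.1) := by
        rw [Submodule.coe_projectionOnto_apply]
        conv_lhs => rw [← Submodule.projection_add_projection_eq_self hHK w.1]
        rw [map_add, hK.apply_eq_zero hκ (Submodule.projection_apply_mem hHK.symm _), add_zero]
      simp only [LinearMap.zero_apply, map_neg]
      rw [h3]
      linarith
    obtain ⟨rfl, hY0⟩ := hR.eq_zero_of_mem hHK hκ hmem
    refine hf0 (LinearMap.ext fun p => ?_)
    obtain ⟨u, β⟩ := p
    rw [hf', neg_eq_zero.1 hY0]
    simp
  obtain ⟨⟨⟨ξ, X, α'⟩, hv⟩, hvg⟩ := (hg ▸ Submodule.mem_top : (η, α) ∈ LinearMap.range g)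
  have h1 : H.projectionOnto K hHK ξ = η := congrArg Prod.fst hvg
  have h2 : α' = α := congrArg Prod.snd hvg
  subst h2
  refine ⟨K.projection H hHK.symm ξ, Submodule.projection_apply_mem _ _, X, ?_⟩
  rw [← h1, Submodule.coe_projectionOnto_apply, Submodule.projection_add_projection_eq_self]
  exact hv

omit [FiniteDimensional ℝ 𝔡] [IsManifold 𝓘(ℝ, EN) ∞ N] [FiniteDimensional ℝ EM] in
theorem CourantSection.contMDiff_vec (e : CourantSection 𝔡 EN N EM M)
    (hμ : ContMDiff 𝓘(ℝ, EM) 𝓘(ℝ, EN) ∞ μ) : SmoothField (fun m => e.vec (μ m) m) :=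
  e.smooth_vec.comp (hμ.prodMk contMDiff_id)

omit [FiniteDimensional ℝ 𝔡] [IsManifold 𝓘(ℝ, EN) ∞ N] [FiniteDimensional ℝ EM] in
theorem CourantSection.contMDiff_lie (e : CourantSection 𝔡 EN N EM M)
    (hμ : ContMDiff 𝓘(ℝ, EM) 𝓘(ℝ, EN) ∞ μ) (l : Module.Dual ℝ 𝔡) :
    ContMDiff 𝓘(ℝ, EM) 𝓘(ℝ, ℝ) ∞ (fun m => l (e.lie (μ m) m)) :=
  (e.smooth_lie l).comp (hμ.prodMk contMDiff_id)

omit [FiniteDimensional ℝ 𝔡] [IsManifold 𝓘(ℝ, EN) ∞ N] [FiniteDimensional ℝ EM] in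
theorem CourantSection.contMDiff_cov (e : CourantSection 𝔡 EN N EM M)
    (hμ : ContMDiff 𝓘(ℝ, EM) 𝓘(ℝ, EN) ∞ μ) {Z : (m : M) → Tan EM m} (hZ : SmoothField Z) :
    ContMDiff 𝓘(ℝ, EM) 𝓘(ℝ, ℝ) ∞ (fun m => e.cov (μ m) m (Z m)) :=
  (e.smooth_cov Z hZ).comp (hμ.prodMk contMDiff_id)

variable [T2Space M]

/-- A section of `R` is smooth if its component in `𝔥` (along `𝔨`) and its covector are smooth:
near each point it is a combination of smooth sections of `R`, with coefficients that solve a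
smooth linear system. -/
theorem IsManinMorphism.smooth_of_mem (hR : IsManinMorphism B a H μ R)
    (hB : IsInvariantMetric B) (hK : IsLagrangian B K) (hHK : IsCompl H K)
    {η ξ : M → 𝔡} {X : (m : M) → Tan EM m} {α : (m : M) → Cot EM m}
    (hmem : ∀ m, (ξ m, X m, α m) ∈ R m) (hξη : ∀ m, ξ m - η m ∈ K)
    (hηs : ∀ l : Module.Dual ℝ 𝔡, ContMDiff 𝓘(ℝ, EM) 𝓘(ℝ, ℝ) ∞ (fun m => l (η m)))
    (hαs : ∀ Z : (m : M) → Tan EM m, SmoothField Z →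
      ContMDiff 𝓘(ℝ, EM) 𝓘(ℝ, ℝ) ∞ (fun m => α m (Z m))) :
    SmoothField X ∧
      ∀ l : Module.Dual ℝ 𝔡, ContMDiff 𝓘(ℝ, EM) 𝓘(ℝ, ℝ) ∞ (fun m => l (ξ m)) := by
  suffices h : ∀ m₀ : M, ContMDiffAt 𝓘(ℝ, EM) 𝓘(ℝ, EM).tangent ∞
      (fun m => (⟨m, X m⟩ : TangentBundle 𝓘(ℝ, EM) M)) m₀ ∧
      ∀ l : Module.Dual ℝ 𝔡, ContMDiffAt 𝓘(ℝ, EM) 𝓘(ℝ, ℝ) ∞ (fun m => l (ξ m)) m₀ from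
    ⟨fun m₀ => (h m₀).1, fun l m₀ => (h m₀).2 l⟩
  intro m₀
  let b := Module.finBasis ℝ ↥H
  let c := Module.finBasis ℝ (Tan EM m₀)
  choose Z hZs hZ using fun j => exists_smoothField m₀ (c j)
  let β : Fin (Module.finrank ℝ ↥H) → Module.Dual ℝ 𝔡 := fun k =>
    (b.coord k).comp (H.projectionOnto K hHK)
  let ι := Fin (Module.finrank ℝ ↥H) ⊕ Fin (Module.finrank ℝ (Tan EM m₀))
  -- `Φ m` records the `𝔥`-component and the covector of an element, the latter in the frame `Z`
  -- near `m₀`; it is injective on `R m` for `m` near `m₀`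
  let Φ : (m : M) → (𝔡 × Tan EM m × Cot EM m) →ₗ[ℝ] ι → ℝ := fun m =>
    LinearMap.pi (Sum.elim (fun k => (β k).comp (LinearMap.fst ℝ _ _))
      (fun j => (LinearMap.applyₗ (Z j m)).comp
        ((LinearMap.snd ℝ _ _).comp (LinearMap.snd ℝ _ _))))
  -- sections of `R` through a basis of `R m₀` dual to `Φ m₀`, so that `A m₀ = 1` below
  have hex : ∀ i : ι, ∃ v ∈ R m₀, Φ m₀ v = Pi.single i 1 := by
    rintro (k | j)
    · obtain ⟨κ, hκ, Y, hv⟩ := hR.exists_mem hB hK hHK m₀ (b k) 0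
      refine ⟨_, hv, ?_⟩
      funext i
      rcases i with k' | j'
      · change b.repr (H.projectionOnto K hHK ((b k : 𝔡) + κ)) k' = _
        rw [map_add, (Submodule.projectionOnto_apply_eq_zero_iff hHK).2 hκ, add_zero,
          Submodule.projectionOnto_apply_left, b.repr_self, Finsupp.single_apply]
        rcases eq_or_ne k k' with rfl | h
        · rw [if_pos rfl, Pi.single_eq_same]
        · rw [if_neg h, Pi.single_eq_of_ne fun h' => h (Sum.inl.inj h').symm]
      · change (0 : ℝ) = _
        rw [Pi.single_eq_of_ne Sum.inr_ne_inl]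
    · obtain ⟨κ, hκ, Y, hv⟩ := hR.exists_mem hB hK hHK m₀ 0 (c.coord j)
      refine ⟨_, hv, ?_⟩
      funext i
      rcases i with k' | j'
      · change b.repr (H.projectionOnto K hHK (((0 : ↥H) : 𝔡) + κ)) k' = _
        rw [map_add, (Submodule.projectionOnto_apply_eq_zero_iff hHK).2 hκ, add_zero,
          Submodule.projectionOnto_apply_left, map_zero, Pi.single_eq_of_ne Sum.inl_ne_inr]
        rfl
      · change c.coord j (Z j' m₀) = _
        rw [hZ, Module.Basis.coord_apply, c.repr_self, Finsupp.single_apply]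
        rcases eq_or_ne j' j with rfl | h
        · rw [if_pos rfl, Pi.single_eq_same]
        · rw [if_neg h, Pi.single_eq_of_ne fun h' => h (Sum.inr.inj h')]
  choose v hv hΦv using hex
  choose e heR hev using fun i => hR.exists_section m₀ (v i) (hv i)
  let A : M → Matrix ι ι ℝ := fun m => Matrix.of fun i j => Φ m ((e j).val (μ m) m) i
  let y : M → ι → ℝ := fun m => Φ m (ξ m, X m, α m)
  have hAs : ∀ i j, ContMDiffAt 𝓘(ℝ, EM) 𝓘(ℝ, ℝ) ∞ (fun m => A m i j) m₀ := by
    rintro (k | l) j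
    · exact ((e j).contMDiff_lie hR.smooth (β k)).contMDiffAt
    · exact ((e j).contMDiff_cov hR.smooth (hZs l)).contMDiffAt
  have hys : ∀ i, ContMDiffAt 𝓘(ℝ, EM) 𝓘(ℝ, ℝ) ∞ (fun m => y m i) m₀ := by
    rintro (k | l)
    · refine (hηs (β k)).contMDiffAt.congr_of_eventuallyEq (Eventually.of_forall fun m => ?_)
      change b.coord k (H.projectionOnto K hHK (ξ m)) = b.coord k (H.projectionOnto K hHK (η m))
      have h1 := (Submodule.projectionOnto_apply_eq_zero_iff hHK).2 (hξη m)
      rw [map_sub, sub_eq_zero] at h1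
      rw [h1]
    · exact (hαs (Z l) (hZs l)).contMDiffAt
  have hA0 : A m₀ = 1 := by
    ext i j
    change Φ m₀ ((e j).val (μ m₀) m₀) i = _
    rw [hev, hΦv, Matrix.one_apply, Pi.single_apply]
  have hdet0 : (A m₀).det ≠ 0 := by
    rw [hA0, Matrix.det_one]
    exact one_ne_zero
  have hdet : ∀ᶠ m in 𝓝 m₀, (A m).det ≠ 0 :=
    (contMDiffAt_det hAs).continuousAt.eventually_ne hdet0
  let t : ι → M → ℝ := fun j m => (A m)⁻¹.mulVec (y m) j
  have hts : ∀ j, ContMDiffAt 𝓘(ℝ, EM) 𝓘(ℝ, ℝ) ∞ (t j) m₀ := fun j =>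
    contMDiffAt_inv_mulVec hAs hys hdet0 j
  have heq : ∀ᶠ m in 𝓝 m₀, (ξ m, X m, α m) = ∑ j, t j m • (e j).val (μ m) m := by
    filter_upwards [hdet] with m hm
    have hunit : IsUnit (A m).det := isUnit_iff_ne_zero.2 hm
    rw [← sub_eq_zero]
    set w := (ξ m, X m, α m) - ∑ j, t j m • (e j).val (μ m) m with hw
    have hwR : w ∈ R m := (R m).sub_mem (hmem m)
      ((R m).sum_mem fun j _ => (R m).smul_mem _ (heR j m))
    have hΦw : Φ m w = 0 := by
      rw [hw, map_sub, map_sum, sub_eq_zero]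
      have h1 : (A m).mulVec ((A m)⁻¹.mulVec (y m)) = y m := by
        rw [Matrix.mulVec_mulVec, Matrix.mul_nonsing_inv _ hunit, Matrix.one_mulVec]
      refine h1.symm.trans ?_
      funext i
      rw [Finset.sum_apply]
      change ∑ j, A m i j * t j m = _
      refine Finset.sum_congr rfl fun j _ => ?_
      rw [map_smul, Pi.smul_apply, smul_eq_mul, mul_comm]
      rfl
    have hwK : w.1 ∈ K := by
      refine (Submodule.projectionOnto_apply_eq_zero_iff hHK).1 (b.ext_elem fun k => ?_)
      exact (congrFun hΦw (Sum.inl k)).trans (by simp)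
    -- invertibility of `A m` makes the fields `Z j` a frame at `m`
    have hinj : LinearIndependent ℝ (fun j => Z j m) := by
      rw [Fintype.linearIndependent_iff]
      intro g hg
      have h1 : Matrix.vecMul (Sum.elim (0 : Fin (Module.finrank ℝ ↥H) → ℝ) g : ι → ℝ) (A m) =
          0 := by
        funext j
        change ∑ i : ι, Sum.elim (0 : Fin (Module.finrank ℝ ↥H) → ℝ) g i *
          Φ m ((e j).val (μ m) m) i = 0
        rw [Fintype.sum_sum_type]
        have h2 : ((e j).val (μ m) m).2.2 (∑ i, g i • Z i m) = 0 := by rw [hg, map_zero]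
        rw [map_sum] at h2
        simp only [map_smul, smul_eq_mul] at h2
        simp only [Sum.elim_inl, Sum.elim_inr, Pi.zero_apply, zero_mul, Finset.sum_const_zero,
          zero_add]
        exact h2
      have h3 : (Sum.elim (0 : Fin (Module.finrank ℝ ↥H) → ℝ) g : ι → ℝ) = 0 := by
        have h4 := congrArg (fun u => Matrix.vecMul u (A m)⁻¹) h1
        simpa only [Matrix.vecMul_vecMul, Matrix.mul_nonsing_inv _ hunit, Matrix.vecMul_one,
          Matrix.zero_vecMul] using h4
      exact fun i => congrFun h3 (Sum.inr i)
    have hspan : Submodule.span ℝ (Set.range fun j => Z j m) = ⊤ :=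
      hinj.span_eq_top_of_card_eq_finrank' (Fintype.card_fin _)
    have hw0 : w.2.2 = 0 := by
      refine LinearMap.ext_on_range hspan fun j => ?_
      exact (congrFun hΦw (Sum.inr j)).trans (by simp)
    have hwR' : (w.1, w.2.1, (0 : Cot EM m)) ∈ R m := by
      rw [← hw0]
      exact hwR
    obtain ⟨h5, h6⟩ := hR.eq_zero_of_mem hHK hwK hwR'
    exact Prod.ext h5 (Prod.ext h6 hw0)
  constructor
  · have h1 : ContMDiffAt 𝓘(ℝ, EM) 𝓘(ℝ, EM).tangent ∞
        (fun m => (⟨m, ∑ j, (t j • fun m' => (e j).vec (μ m') m') m⟩ :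
          TangentBundle 𝓘(ℝ, EM) M)) m₀ :=
      ContMDiffAt.sum_section fun j _ =>
        (hts j).smul_section ((e j).contMDiff_vec hR.smooth).contMDiffAt
    refine h1.congr_of_eventuallyEq ?_
    filter_upwards [heq] with m hm
    have h2 := congrArg (fun w => w.2.1) hm
    simp only [Prod.snd_sum, Prod.fst_sum, Prod.smul_snd, Prod.smul_fst] at h2
    simp only [Pi.smul_apply']
    rw [h2]
    rfl
  · intro l
    have h1 : ContMDiffAt 𝓘(ℝ, EM) 𝓘(ℝ, ℝ) ∞
        (fun m => ∑ j, t j m * l ((e j).lie (μ m) m)) m₀ :=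
      contMDiffAt_finsetSum fun j _ =>
        (hts j).mul ((e j).contMDiff_lie hR.smooth l).contMDiffAt
    refine h1.congr_of_eventuallyEq ?_
    filter_upwards [heq] with m hm
    have h2 := congrArg (fun w => w.1) hm
    simp only [Prod.fst_sum, Prod.smul_fst] at h2
    rw [h2, map_sum]
    exact Finset.sum_congr rfl fun j _ => by rw [map_smul]; rfl

end Manin

/-! ### Hamiltonian sections and the quasi-Poisson bivector field -/

section Sections

variable {𝔡 : Type*} [LieRing 𝔡] [LieAlgebra ℝ 𝔡] [FiniteDimensional ℝ 𝔡]
  {EN : Type*} [NormedAddCommGroup EN] [NormedSpace ℝ EN]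
  {N : Type*} [TopologicalSpace N] [ChartedSpace EN N] [IsManifold 𝓘(ℝ, EN) ∞ N]
  {EM : Type*} [NormedAddCommGroup EM] [NormedSpace ℝ EM] [FiniteDimensional ℝ EM]
  {M : Type*} [TopologicalSpace M] [ChartedSpace EM M] [IsManifold 𝓘(ℝ, EM) ∞ M]
  [T2Space M]
  {B : LinearMap.BilinForm ℝ 𝔡} {a : LieAction 𝔡 EN N} {H K : Submodule ℝ 𝔡} {μ : M → N}
  {R : (m : M) → Submodule ℝ (𝔡 × Tan EM m × Cot EM m)}

theorem IsManinMorphism.smoothField_rho (hR : IsManinMorphism B a H μ R)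
    (hB : IsInvariantMetric B) (hH : IsLagrangian B H) (hK : IsLagrangian B K)
    (hHK : IsCompl H K) (η : ↥H) : SmoothField (fun m => hR.rho hB.symm hH m η) :=
  (hR.smooth_of_mem hB hK hHK (η := fun _ => (η : 𝔡)) (hR.rho_mem hB.symm hH · η)
    (fun m => by rw [sub_self]; exact K.zero_mem) (fun _ => contMDiff_const)
    (fun _ _ => contMDiff_const)).1

/-- Let `T : 𝔡 → 𝔥` be linear. Every smooth function `f` on `M` gives a smooth section of `R` with
covector `df` whose component in `𝔡` has the form `ξ + T ξ` with `ξ ∈ 𝔨`. For `T = 0` its vector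
field is the Hamiltonian vector field of `f` with respect to `π_𝔨`. -/
theorem IsManinMorphism.exists_hamiltonian_section (hR : IsManinMorphism B a H μ R)
    (hB : IsInvariantMetric B) (hH : IsLagrangian B H) (hK : IsLagrangian B K)
    (hHK : IsCompl H K) (T : 𝔡 →ₗ[ℝ] ↥H) {f : M → ℝ} (hf : ContMDiff 𝓘(ℝ, EM) 𝓘(ℝ, ℝ) ∞ f) :
    ∃ (ξ : M → 𝔡) (X : (m : M) → Tan EM m), (∀ m, ξ m ∈ K) ∧
      (∀ m, (ξ m + (T (ξ m) : 𝔡), X m, diff f m) ∈ R m) ∧ SmoothField X ∧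
      ∀ l : Module.Dual ℝ 𝔡, ContMDiff 𝓘(ℝ, EM) 𝓘(ℝ, ℝ) ∞
        (fun m => l (ξ m + (T (ξ m) : 𝔡))) := by
  choose ξ hξ X₀ hX₀ using fun m => hR.exists_mem hB hK hHK m 0 (diff f m)
  have hX₀' : ∀ m, (ξ m, X₀ m, diff f m) ∈ R m := fun m => by simpa using hX₀ m
  have hdf : ∀ Z : (m : M) → Tan EM m, SmoothField Z →
      ContMDiff 𝓘(ℝ, EM) 𝓘(ℝ, ℝ) ∞ (fun m => diff f m (Z m)) :=
    fun Z hZ => SmoothField.contMDiff_dirDeriv hZ hf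
  have h0 := hR.smooth_of_mem hB hK hHK (η := fun _ => 0) hX₀'
    (fun m => by rw [sub_zero]; exact hξ m) (fun l => by simpa using contMDiff_const) hdf
  have hX : ∀ m, (ξ m + (T (ξ m) : 𝔡), X₀ m + hR.rho hB.symm hH m (T (ξ m)), diff f m) ∈ R m :=
    fun m => by
      simpa using (R m).add_mem (hX₀' m) (hR.rho_mem hB.symm hH m (T (ξ m)))
  have h1 := hR.smooth_of_mem hB hK hHK (η := fun m => (T (ξ m) : 𝔡)) hX
    (fun m => by rw [add_sub_cancel_right]; exact hξ m)
    (fun l => h0.2 (l.comp (H.subtype.comp T))) hdf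
  exact ⟨ξ, _, hξ, hX, h1.1, h1.2⟩

/-- The quasi-Poisson bivector field of a Lagrangian complement exists and is unique. -/
theorem IsManinMorphism.existsUnique_bivector (hR : IsManinMorphism B a H μ R)
    (hB : IsInvariantMetric B) (hH : IsLagrangian B H) (hK : IsLagrangian B K)
    (hHK : IsCompl H K) : ∃! π : (m : M) → Bivector (Tan EM m),
      IsQuasiPoissonBivector K (graphRelation μ R) π := by
  have hp : ∀ m, ∃! b : Bivector (Tan EM m), composeSubspace K (graphRelation μ R) m = b.graph := by
    intro m
    refine Bivector.existsUnique_graph_eq (fun α => ?_) ?_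
    · obtain ⟨ξ, hξ, X, hX⟩ := hR.exists_mem hB hK hHK m 0 α
      exact ⟨X, μ m, ξ, hξ, rfl, by simpa using hX⟩
    · rintro ⟨X, α⟩ ⟨_, ξ, hξ, rfl, h⟩ ⟨X', α'⟩ ⟨_, ξ', hξ', -, h'⟩
      rw [← hR.toIsCourantMorphism.isotropic h h']
      exact hK.apply_eq_zero hξ hξ'
  choose π hπ hπu using hp
  refine ⟨π, ⟨fun f g hf hg => ?_, hπ⟩, fun π' hπ' => funext fun m => hπu m _ (hπ'.graph_eq m)⟩
  obtain ⟨ξ, X, hξ, hX, hXs, -⟩ := hR.exists_hamiltonian_section hB hH hK hHK 0 hf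
  refine (SmoothField.contMDiff_dirDeriv hXs hg).congr fun m => ?_
  have h1 : (X m, diff f m) ∈ (π m).graph := by
    rw [← hπ m]
    exact ⟨μ m, ξ m, hξ m, rfl, by simpa using hX m⟩
  exact (h1 (diff g m)).symm

omit [FiniteDimensional ℝ 𝔡] [T2Space M] [IsManifold 𝓘(ℝ, EN) ∞ N] [FiniteDimensional ℝ EM] in
/-- The differential of a function, as a section of `𝔡 × 𝕋M` over `N × M` with coefficient
`g n - g (μ m)`, which vanishes on the graph of `μ`. -/
theorem exists_courantSection_vanishing (hμ : ContMDiff 𝓘(ℝ, EM) 𝓘(ℝ, EN) ∞ μ) (ζ : 𝔡)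
    {g : N → ℝ} (hg : ContMDiff 𝓘(ℝ, EN) 𝓘(ℝ, ℝ) ∞ g)
    {h : M → ℝ} (hh : ContMDiff 𝓘(ℝ, EM) 𝓘(ℝ, ℝ) ∞ h) :
    ∃ e : CourantSection 𝔡 EN N EM M, (∀ n m, e.lie n m = (g n - g (μ m)) • ζ) ∧
      (∀ n m, e.vec n m = 0) ∧ ∀ n m, e.cov n m = (g n - g (μ m)) • diff h m := by
  have hc : ContMDiff (𝓘(ℝ, EN).prod 𝓘(ℝ, EM)) 𝓘(ℝ, ℝ) ∞
      (fun p : N × M => g p.1 - g (μ p.2)) :=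
    (hg.comp contMDiff_fst).sub (hg.comp (hμ.comp contMDiff_snd))
  refine ⟨⟨fun n m => (g n - g (μ m)) • ζ, fun _ _ => 0,
    fun n m => (g n - g (μ m)) • diff h m, fun l => ?_, ?_, fun Z hZ => ?_⟩,
    fun _ _ => rfl, fun _ _ => rfl, fun _ _ => rfl⟩
  · simp only [map_smul, smul_eq_mul]
    exact hc.mul contMDiff_const
  · exact (Bundle.contMDiff_zeroSection ℝ (TangentSpace 𝓘(ℝ, EM) : M → Type _)).comp
      contMDiff_snd
  · simp only [LinearMap.smul_apply, smul_eq_mul]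
    exact hc.mul ((SmoothField.contMDiff_dirDeriv hZ hh).comp contMDiff_snd)

end Sections

/-! ### Compatibility with the anchor -/

section Anchor

variable {𝔡 : Type*} [LieRing 𝔡] [LieAlgebra ℝ 𝔡]
  {EN : Type*} [NormedAddCommGroup EN] [NormedSpace ℝ EN] [FiniteDimensional ℝ EN]
  {N : Type*} [TopologicalSpace N] [ChartedSpace EN N] [IsManifold 𝓘(ℝ, EN) ∞ N] [T2Space N]
  {EM : Type*} [NormedAddCommGroup EM] [NormedSpace ℝ EM] [FiniteDimensional ℝ EM]
  {M : Type*} [TopologicalSpace M] [ChartedSpace EM M] [IsManifold 𝓘(ℝ, EM) ∞ M]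
  [T2Space M]
  {B : LinearMap.BilinForm ℝ 𝔡} {a : LieAction 𝔡 EN N} {H : Submodule ℝ 𝔡} {μ : M → N}
  {R : (m : M) → Submodule ℝ (𝔡 × Tan EM m × Cot EM m)}

/-- The anchor maps `R` to the tangent bundle of the graph of `μ`. If it did not, the bracket of
a section of `R` with sections that vanish on the graph would produce the elements `(ζ, 0, dh)`
of `R` for all `ζ` and `h`, and then the anchor of `R` would vanish. -/
theorem IsCourantMorphism.anchor_eq (hR : IsCourantMorphism B a μ R)
    (hB : IsInvariantMetric B) {m : M} {v : 𝔡 × Tan EM m × Cot EM m} (hv : v ∈ R m) :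
    mfderiv 𝓘(ℝ, EM) 𝓘(ℝ, EN) μ m v.2.1 = a.field v.1 (μ m) := by
  have hne : (∞ : ℕ∞ω) ≠ 0 := by simp
  by_contra hcon
  let w : Tan EN (μ m) := a.field v.1 (μ m) - mfderiv 𝓘(ℝ, EM) 𝓘(ℝ, EN) μ m v.2.1
  have hw : w ≠ 0 := fun h => hcon (sub_eq_zero.1 h).symm
  obtain ⟨c, hc⟩ : ∃ c : Cot EN (μ m), c w ≠ 0 := by
    by_contra hall
    push Not at hall
    exact hw ((Module.forall_dual_apply_eq_zero_iff ℝ w).1 hall)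
  obtain ⟨g, hg, hgc⟩ := exists_diff_eq (μ m) c
  obtain ⟨e₁, he₁, hev⟩ := hR.exists_section m v hv
  have hlie : e₁.lie (μ m) m = v.1 := congrArg (fun p => p.1) hev
  have hvec : e₁.vec (μ m) m = v.2.1 := congrArg (fun p => p.2.1) hev
  -- `s` is the derivative of `g n - g (μ m)` in the direction of the anchor of `v`
  set s : ℝ := dirDeriv g (μ m) (a.field v.1 (μ m)) -
    dirDeriv g (μ m) (mfderiv 𝓘(ℝ, EM) 𝓘(ℝ, EN) μ m v.2.1) with hs
  have hs0 : s ≠ 0 := by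
    have h1 : s = c w := by
      rw [← hgc, hs]
      exact (map_sub (diff g (μ m)) _ _).symm
    rwa [h1]
  have hgd : MDifferentiableAt 𝓘(ℝ, EN) 𝓘(ℝ, ℝ) g (μ m) := hg.mdifferentiableAt hne
  have hμd : MDifferentiableAt 𝓘(ℝ, EM) 𝓘(ℝ, EN) μ m := hR.smooth.mdifferentiableAt hne
  have hgμ : MDifferentiableAt 𝓘(ℝ, EM) 𝓘(ℝ, ℝ) (fun m' => g (μ m')) m :=
    (hg.comp hR.smooth).mdifferentiableAt hne
  have hN : ∀ r : ℝ, dirDeriv (fun n' => (g n' - g (μ m)) * r) (μ m) (a.field v.1 (μ m)) =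
      dirDeriv g (μ m) (a.field v.1 (μ m)) * r := fun r => by
    refine (dirDeriv_mul_const (f := fun n' => g n' - g (μ m))
      (hgd.sub mdifferentiableAt_const) r _).trans ?_
    rw [dirDeriv_sub_const hgd]
  have hM : ∀ r : ℝ, dirDeriv (fun m' => (g (μ m) - g (μ m')) * r) m v.2.1 =
      - dirDeriv g (μ m) (mfderiv 𝓘(ℝ, EM) 𝓘(ℝ, EN) μ m v.2.1) * r := fun r => by
    refine (dirDeriv_mul_const (f := fun m' => g (μ m) - g (μ m'))
      (mdifferentiableAt_const.sub hgμ) r _).trans ?_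
    rw [dirDeriv_const_sub hgμ, dirDeriv_comp hgd hμd]
  -- the bracket of `e₁` with `(g n - g (μ m)) • (ζ, 0, dh)` at `(μ m, m)` is `s • (ζ, 0, dh)`
  have key : ∀ (ζ : 𝔡) {h : M → ℝ}, ContMDiff 𝓘(ℝ, EM) 𝓘(ℝ, ℝ) ∞ h →
      (ζ, (0 : Tan EM m), diff h m) ∈ R m := by
    intro ζ h hh
    obtain ⟨e₂, h1, h2, h3⟩ := exists_courantSection_vanishing (EM := EM) hR.smooth ζ hg hh
    have he₂ : ∀ m', e₂.val (μ m') m' ∈ R m' := fun m' => by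
      have : e₂.val (μ m') m' = 0 := by
        simp only [CourantSection.val, h1, h2, h3, sub_self, zero_smul]
        rfl
      rw [this]
      exact (R m').zero_mem
    obtain ⟨u, hu, hbr⟩ := hR.involutive e₁ e₂ he₁ he₂ m
    have hl0 : e₂.lie (μ m) m = 0 := by rw [h1, sub_self, zero_smul]
    have hc0 : e₂.cov (μ m) m = 0 := by rw [h3, sub_self, zero_smul]
    have hv0 : e₂.vec (μ m) = 0 := funext fun m' => h2 (μ m) m'
    have hval : e₂.val (μ m) m = 0 := by
      rw [CourantSection.val, hl0, hc0, h2]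
      rfl
    have ha0 : ∀ F : N → M → ℝ, anchorDeriv a F (μ m) m (0 : 𝔡 × Tan EM m × Cot EM m) = 0 :=
      fun F => by
        simp only [anchorDeriv, Prod.fst_zero, Prod.snd_zero, map_zero, Pi.zero_apply,
          dirDeriv_zero_right, add_zero]
    have hu1 : u.1 = s • ζ := by
      refine sub_eq_zero.1 (hB.nondegenerate.1 _ fun ζ' => ?_)
      have h4 := hbr.lie_eq ζ'
      rw [hval, ha0, hev, hl0, hc0, h2] at h4
      simp only [anchorDeriv, h1, lie_zero, map_zero, map_smul, LinearMap.smul_apply, smul_eq_mul,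
        LinearMap.zero_apply, dirDeriv_const, hN, hM] at h4
      rw [map_sub, LinearMap.sub_apply, map_smul, LinearMap.smul_apply, h4, hs, smul_eq_mul]
      ring
    have hu2 : u.2.1 = 0 := by
      refine (Module.forall_dual_apply_eq_zero_iff ℝ _).1 fun ν => ?_
      have h4 := hbr.vec_eq ν
      rw [hl0, hv0, VectorField.mlieBracket_zero_right] at h4
      simp only [h2, map_zero, Pi.zero_apply, dirDeriv_const, dirDeriv_zero_right] at h4
      rw [h4]
      ring
    have hu3 : u.2.2 = s • diff h m := by
      refine LinearMap.ext fun z => ?_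
      obtain ⟨Z, hZ, rfl⟩ := exists_smoothField m z
      have h4 := hbr.cov_eq Z hZ
      have h5 : dirDeriv (fun m' => B (e₁.lie (μ m) m') (e₂.lie (μ m) m)) m (Z m) = 0 := by
        rw [hl0]
        simp only [map_zero, dirDeriv_const]
      have h6 : dirDeriv (fun m' => e₁.cov (μ m) m' (e₂.vec (μ m) m')) m (Z m) = 0 := by
        simp only [h2, map_zero, dirDeriv_const]
      have h7 : dirDeriv (fun m' => e₂.cov (μ m) m' (Z m')) m v.2.1 =
          - dirDeriv g (μ m) (mfderiv 𝓘(ℝ, EM) 𝓘(ℝ, EN) μ m v.2.1) * diff h m (Z m) := by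
        simp only [h3, LinearMap.smul_apply, smul_eq_mul]
        have hF : MDifferentiableAt 𝓘(ℝ, EM) 𝓘(ℝ, ℝ) (fun m' => g (μ m) - g (μ m')) m :=
          mdifferentiableAt_const.sub hgμ
        have hD : MDifferentiableAt 𝓘(ℝ, EM) 𝓘(ℝ, ℝ) (fun m' => diff h m' (Z m')) m :=
          (SmoothField.contMDiff_dirDeriv hZ hh).mdifferentiableAt hne
        rw [dirDeriv_mul hF hD, dirDeriv_const_sub hgμ, dirDeriv_comp hgd hμd, sub_self, zero_mul,
          zero_add]
      rw [h5, h6, hl0, hc0, h2, hv0, VectorField.mlieBracket_zero_left, hvec, hlie, h7] at h4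
      simp only [h3, LinearMap.smul_apply, smul_eq_mul, hN, map_zero, Pi.zero_apply,
        dirDeriv_zero_right, LinearMap.zero_apply] at h4
      rw [h4, hs, LinearMap.smul_apply, smul_eq_mul]
      ring
    have h4 := (R m).smul_mem s⁻¹ hu
    have h5 : s⁻¹ • u = (ζ, (0 : Tan EM m), diff h m) := by
      refine Prod.ext ?_ (Prod.ext ?_ ?_)
      · change s⁻¹ • u.1 = ζ
        rw [hu1, inv_smul_smul₀ hs0]
      · change s⁻¹ • u.2.1 = 0
        rw [hu2, smul_zero]
      · change s⁻¹ • u.2.2 = diff h m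
        rw [hu3, inv_smul_smul₀ hs0]
    rwa [h5] at h4
  have hpair : ∀ (ζ : 𝔡) {h : M → ℝ}, ContMDiff 𝓘(ℝ, EM) 𝓘(ℝ, ℝ) ∞ h →
      B ζ v.1 = diff h m v.2.1 := fun ζ h hh => by
    have h1 := hR.isotropic (key ζ hh) hv
    simpa using h1
  have hv1 : v.1 = 0 := by
    refine hB.nondegenerate.2 _ fun ζ => ?_
    rw [hpair ζ (contMDiff_const (c := (0 : ℝ)))]
    exact dirDeriv_const 0 m _
  have hv2 : v.2.1 = 0 := by
    refine (Module.forall_dual_apply_eq_zero_iff ℝ _).1 fun ν => ?_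
    obtain ⟨h, hh, rfl⟩ := exists_diff_eq m ν
    rw [← hpair 0 hh, map_zero, LinearMap.zero_apply]
  refine hcon ?_
  rw [hv1, hv2, map_zero, map_zero]
  rfl

end Anchor

/-! ### Derivatives of brackets of functions along the action -/

section Invariance

variable {𝔡 : Type*} [LieRing 𝔡] [LieAlgebra ℝ 𝔡] [FiniteDimensional ℝ 𝔡]
  {EN : Type*} [NormedAddCommGroup EN] [NormedSpace ℝ EN]
  {N : Type*} [TopologicalSpace N] [ChartedSpace EN N] [IsManifold 𝓘(ℝ, EN) ∞ N]
  {EM : Type*} [NormedAddCommGroup EM] [NormedSpace ℝ EM] [FiniteDimensional ℝ EM]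
  {M : Type*} [TopologicalSpace M] [ChartedSpace EM M] [IsManifold 𝓘(ℝ, EM) ∞ M]
  [T2Space M]
  {B : LinearMap.BilinForm ℝ 𝔡} {a : LieAction 𝔡 EN N} {H K : Submodule ℝ 𝔡} {μ : M → N}
  {R : (m : M) → Submodule ℝ (𝔡 × Tan EM m × Cot EM m)}

omit [T2Space M] [FiniteDimensional ℝ 𝔡] [FiniteDimensional ℝ EM] [IsManifold 𝓘(ℝ, EN) ∞ N] in
/-- A smooth section of `𝔡 × 𝕋M` over `M` whose covector is exact, pulled back to `N × M`. -/
theorem exists_courantSection_of_exact {ξ : M → 𝔡} {X : (m : M) → Tan EM m} {f : M → ℝ}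
    (hξ : ∀ l : Module.Dual ℝ 𝔡, ContMDiff 𝓘(ℝ, EM) 𝓘(ℝ, ℝ) ∞ (fun m => l (ξ m)))
    (hX : SmoothField X) (hf : ContMDiff 𝓘(ℝ, EM) 𝓘(ℝ, ℝ) ∞ f) :
    ∃ e : CourantSection 𝔡 EN N EM M, (∀ n, e.lie n = ξ) ∧ (∀ n, e.vec n = X) ∧
      ∀ n, e.cov n = diff f :=
  ⟨⟨fun _ => ξ, fun _ => X, fun _ => diff f, fun l => (hξ l).comp contMDiff_snd,
    ContMDiff.comp hX contMDiff_snd,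
    fun _ hZ => (SmoothField.contMDiff_dirDeriv hZ hf).comp contMDiff_snd⟩,
    fun _ => rfl, fun _ => rfl, fun _ => rfl⟩

/-- The bracket of the section `η + ρ_R(η)` with a section of `R` whose covector is exact lies
in `R`; paired with a further element of `R` this computes the derivative along `ρ_R(η)` of the
bracket of two functions. -/
theorem IsManinMorphism.dirDeriv_rho_dirDeriv (hR : IsManinMorphism B a H μ R)
    (hB : IsInvariantMetric B) (hH : IsLagrangian B H) (hK : IsLagrangian B K)
    (hHK : IsCompl H K) (η : ↥H) {f g : M → ℝ} (hf : ContMDiff 𝓘(ℝ, EM) 𝓘(ℝ, ℝ) ∞ f)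
    (hg : ContMDiff 𝓘(ℝ, EM) 𝓘(ℝ, ℝ) ∞ g) {ξ : M → 𝔡} {X : (m : M) → Tan EM m}
    (hmem : ∀ m, (ξ m, X m, diff f m) ∈ R m) (hX : SmoothField X)
    (hξ : ∀ l : Module.Dual ℝ 𝔡, ContMDiff 𝓘(ℝ, EM) 𝓘(ℝ, ℝ) ∞ (fun m => l (ξ m)))
    {m : M} {ξ' : 𝔡} {X' : Tan EM m} (hmem' : (ξ', X', diff g m) ∈ R m) :
    dirDeriv (fun m' => dirDeriv g m' (X m')) m (hR.rho hB.symm hH m η) =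
      B ⁅(η : 𝔡), ξ m⁆ ξ' + dirDeriv (fun m' => B (ξ m') ξ') m (hR.rho hB.symm hH m η)
        - dirDeriv (fun m' => dirDeriv f m' (hR.rho hB.symm hH m' η)) m X'
        + dirDeriv (fun m' => dirDeriv g m' (hR.rho hB.symm hH m' η)) m (X m) := by
  set ρ : (m : M) → Tan EM m := fun m => hR.rho hB.symm hH m η with hρ
  have hρs : SmoothField ρ := hR.smoothField_rho hB hH hK hHK η
  have hd0 : ∀ m : M, (diff (fun _ : M => (0 : ℝ)) m : Cot EM m) = 0 := fun m =>
    LinearMap.ext fun v => dirDeriv_const 0 m v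
  obtain ⟨e₁, h1l, h1v, h1c⟩ := exists_courantSection_of_exact (EN := EN) (N := N)
    (ξ := fun _ => (η : 𝔡)) (fun _ => contMDiff_const) hρs
    (contMDiff_const (c := (0 : ℝ)))
  obtain ⟨e₂, h2l, h2v, h2c⟩ := exists_courantSection_of_exact (EN := EN) (N := N) hξ hX hf
  have he₁ : ∀ m', e₁.val (μ m') m' ∈ R m' := fun m' => by
    rw [CourantSection.val, h1l, h1v, h1c, hd0]
    exact hR.rho_mem hB.symm hH m' η
  have he₂ : ∀ m', e₂.val (μ m') m' ∈ R m' := fun m' => by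
    rw [CourantSection.val, h2l, h2v, h2c]
    exact hmem m'
  -- the bracket is `([η, ξ] + ℒ_ρ ξ, [ρ, X], d(ρ f))`: the sections do not depend on `n`, so the
  -- remaining terms vanish
  obtain ⟨v, hv, hbr⟩ := hR.involutive e₁ e₂ he₁ he₂ m
  have hv1 : B v.1 ξ' = B ⁅(η : 𝔡), ξ m⁆ ξ' + dirDeriv (fun m' => B (ξ m') ξ') m (ρ m) := by
    have h := hbr.lie_eq ξ'
    simp only [anchorDeriv, CourantSection.val, h1l, h1v, h1c, h2l, h2v, h2c,
      dirDeriv_const] at h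
    rw [h]
    ring
  have hv2 : v.2.1 = VectorField.mlieBracket 𝓘(ℝ, EM) ρ X m := by
    rw [← sub_eq_zero, ← Module.forall_dual_apply_eq_zero_iff ℝ]
    intro ν
    have h := hbr.vec_eq ν
    simp only [h1l, h1v, h2l, h2v, dirDeriv_const] at h
    rw [map_sub, h]
    ring
  have hv3 : v.2.2 = diff (fun m' => dirDeriv f m' (ρ m')) m := by
    refine LinearMap.ext fun z => ?_
    obtain ⟨Z, hZ, rfl⟩ := exists_smoothField m z
    have h := hbr.cov_eq Z hZ
    simp only [h1l, h1v, h1c, h2l, h2v, h2c, dirDeriv_const, diff_apply,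
      dirDeriv_mlieBracket hρs hZ hf] at h
    rw [diff_apply, h]
    ring
  have hpair := hR.toIsCourantMorphism.isotropic hv hmem'
  simp only at hpair
  rw [hv1, hv2, hv3, diff_apply, diff_apply, dirDeriv_mlieBracket hρs hX hg] at hpair
  linarith

end Invariance

/-! ### The reduced bivector at a point -/

section Reduction

variable {𝔡 : Type*} [LieRing 𝔡] [LieAlgebra ℝ 𝔡]
  {EN : Type*} [NormedAddCommGroup EN] [NormedSpace ℝ EN] [FiniteDimensional ℝ EN]
  {N : Type*} [TopologicalSpace N] [ChartedSpace EN N] [IsManifold 𝓘(ℝ, EN) ∞ N] [T2Space N]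
  {EM : Type*} [NormedAddCommGroup EM] [NormedSpace ℝ EM] [FiniteDimensional ℝ EM]
  {M : Type*} [TopologicalSpace M] [ChartedSpace EM M] [IsManifold 𝓘(ℝ, EM) ∞ M] [T2Space M]
  {ES : Type*} [NormedAddCommGroup ES] [NormedSpace ℝ ES]
  {S : Type*} [TopologicalSpace S] [ChartedSpace ES S]
  {EP : Type*} [NormedAddCommGroup EP] [NormedSpace ℝ EP]
  {P : Type*} [TopologicalSpace P] [ChartedSpace EP P]
  {ENr : Type*} [NormedAddCommGroup ENr] [NormedSpace ℝ ENr]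
  {Nr : Type*} [TopologicalSpace Nr] [ChartedSpace ENr Nr]
  {EMr : Type*} [NormedAddCommGroup EMr] [NormedSpace ℝ EMr]
  {Mr : Type*} [TopologicalSpace Mr] [ChartedSpace EMr Mr]
  {B : LinearMap.BilinForm ℝ 𝔡} {a : LieAction 𝔡 EN N} {H K C : Submodule ℝ 𝔡} {μ : M → N}
  {R : (m : M) → Submodule ℝ (𝔡 × Tan EM m × Cot EM m)}
  {hR : IsManinMorphism B a H μ R} {hBs : B.IsSymm} {hH : IsLagrangian B H}
  {iN : S → N} {iM : P → M} {μS : P → S} {qN : S → Nr} {qM : P → Mr}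
  {K' : Submodule ℝ (CoisoQuotient B C)}

/-- Elements of `R` over `P` with `𝔡`-component in `𝔠` are tangent to `P`. -/
theorem IsReductiveData.exists_tangent
    (h : IsReductiveData hR hBs hH C iN iM μS qN qM (ES := ES) (EP := EP) (ENr := ENr)
      (EMr := EMr)) (hB : IsInvariantMetric B) {x : P}
    {v : 𝔡 × Tan EM (iM x) × Cot EM (iM x)} (hv : v ∈ R (iM x)) (hvC : v.1 ∈ C) :
    ∃ u : Tan EP x, mfderiv 𝓘(ℝ, EP) 𝓘(ℝ, EM) iM x u = v.2.1 := by
  obtain ⟨w, hw⟩ := h.invariant v.1 hvC (μS x)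
  have h1 := hR.toIsCourantMorphism.anchor_eq hB hv
  have h2 : ∀ n n' : N, n = n' → (a.field v.1 n : EN) = a.field v.1 n' := by
    rintro _ _ rfl
    rfl
  obtain ⟨u, hu, -⟩ := h.clean x v.2.1 w (hw.trans ((h2 _ _ (h.commutes x)).trans h1.symm))
  exact ⟨u, hu⟩

theorem IsReductiveData.mfderiv_stabAction
    (h : IsReductiveData hR hBs hH C iN iM μS qN qM (ES := ES) (EP := EP) (ENr := ENr)
      (EMr := EMr)) (hB : IsInvariantMetric B) (ζ : ↥(stab B C H)) (x : P) :
    mfderiv 𝓘(ℝ, EP) 𝓘(ℝ, EM) iM x (hR.stabAction hBs hH C iM ζ x) =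
      hR.rho hBs hH (iM x) (ζ : ↥H) :=
  Function.invFun_eq (h.exists_tangent hB (hR.rho_mem hBs hH (iM x) (ζ : ↥H))
    (h.coisotropic ζ.2))

omit [FiniteDimensional ℝ EN] [T2Space N] [T2Space M] in
theorem IsReductiveData.mfderiv_qM_stabAction
    (h : IsReductiveData hR hBs hH C iN iM μS qN qM (ES := ES) (EP := EP) (ENr := ENr)
      (EMr := EMr)) (ζ : ↥(stab B C H)) (x : P) :
    mfderiv 𝓘(ℝ, EP) 𝓘(ℝ, EMr) qM x (hR.stabAction hBs hH C iM ζ x) = 0 :=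
  (h.quotient_M.tangent x _).2 ⟨ζ, rfl⟩

/-- The vertical spaces of `qM` are the tangent spaces of the orbits of `𝔥 ∩ 𝔠^⊥`. -/
theorem IsReductiveData.ker_mfderiv_qM
    (h : IsReductiveData hR hBs hH C iN iM μS qN qM (ES := ES) (EP := EP) (ENr := ENr)
      (EMr := EMr)) (hB : IsInvariantMetric B) (x : P) :
    LinearMap.ker (mfderiv 𝓘(ℝ, EP) 𝓘(ℝ, EMr) qM x).toLinearMap =
      hR.stabTangent hBs hH C iM x := by
  refine le_antisymm (fun u hu => ?_) (h.stabTangent_le x)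
  obtain ⟨ζ, rfl⟩ := (h.quotient_M.tangent x u).1 hu
  exact ⟨ζ, ζ.2, (h.mfderiv_stabAction hB ζ x).symm⟩

/-- The elements of `𝕋Mr` over `qM x` that are related to an element of `K'` by way of the
point `x` of the fibre. -/
def reducedFibre (R : (m : M) → Submodule ℝ (𝔡 × Tan EM m × Cot EM m)) (iM : P → M) (qM : P → Mr)
    (K' : Submodule ℝ (CoisoQuotient B C)) (x : P) : Set (Tan EMr (qM x) × Cot EMr (qM x)) :=
  {p | ∃ v ∈ R (iM x), v.1 ∈ liftSubspace B C K' ∧ ∃ u : Tan EP x,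
    mfderiv 𝓘(ℝ, EP) 𝓘(ℝ, EM) iM x u = v.2.1 ∧ mfderiv 𝓘(ℝ, EP) 𝓘(ℝ, EMr) qM x u = p.1 ∧
    ∀ w : Tan EP x, v.2.2 (mfderiv 𝓘(ℝ, EP) 𝓘(ℝ, EM) iM x w) =
      p.2 (mfderiv 𝓘(ℝ, EP) 𝓘(ℝ, EMr) qM x w)}

/-- An element of `R` with `𝔡`-component in the preimage of `K'`, whose covector restricts to the
pullback of a covector of `Mr`, projects to the reduced fibre: its vector component is tangent
to `P`. -/
theorem IsReductiveData.exists_mem_reducedFibre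
    (h : IsReductiveData hR hBs hH C iN iM μS qN qM (ES := ES) (EP := EP) (ENr := ENr)
      (EMr := EMr)) (hB : IsInvariantMetric B) {x : P}
    {v : 𝔡 × Tan EM (iM x) × Cot EM (iM x)} (hv : v ∈ R (iM x))
    (hvL : v.1 ∈ liftSubspace B C K') {β : Cot EMr (qM x)}
    (hβ : ∀ w : Tan EP x, v.2.2 (mfderiv 𝓘(ℝ, EP) 𝓘(ℝ, EM) iM x w) =
      β (mfderiv 𝓘(ℝ, EP) 𝓘(ℝ, EMr) qM x w)) :
    ∃ u : Tan EP x, mfderiv 𝓘(ℝ, EP) 𝓘(ℝ, EM) iM x u = v.2.1 ∧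
      (mfderiv 𝓘(ℝ, EP) 𝓘(ℝ, EMr) qM x u, β) ∈ reducedFibre (EP := EP) R iM qM K' x := by
  obtain ⟨u, hu⟩ := h.exists_tangent hB hv (liftSubspace_le hvL)
  exact ⟨u, hu, v, hv, hvL, u, hu, rfl, hβ⟩

/-- If the covector of an element of `R` restricts to a pullback from `Mr`, then its
`𝔡`-component, taken modulo the Lagrangian subspace `𝔥`, annihilates `𝔥 ∩ 𝔠^⊥`. -/
theorem IsReductiveData.apply_eq_zero_of_cov
    (h : IsReductiveData hR hBs hH C iN iM μS qN qM (ES := ES) (EP := EP) (ENr := ENr)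
      (EMr := EMr)) (hB : IsInvariantMetric B) {x : P} {ξ w : 𝔡} (hw : w ∈ H)
    {X : Tan EM (iM x)} {α : Cot EM (iM x)} (hv : (ξ + w, X, α) ∈ R (iM x)) {β : Cot EMr (qM x)}
    (hβ : ∀ w : Tan EP x, α (mfderiv 𝓘(ℝ, EP) 𝓘(ℝ, EM) iM x w) =
      β (mfderiv 𝓘(ℝ, EP) 𝓘(ℝ, EMr) qM x w)) :
    ∀ u ∈ H, u ∈ B.orthogonal C → B ξ u = 0 := by
  intro u hu huC
  have h1 := hR.apply_eq_cov_rho hBs hH hv ⟨u, hu⟩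
  have h2 := h.mfderiv_stabAction hB ⟨⟨u, hu⟩, huC⟩ x
  simp only at h1 h2
  rw [← h2, hβ, h.mfderiv_qM_stabAction, map_zero, map_add, LinearMap.add_apply,
    hH.apply_eq_zero hw hu, add_zero] at h1
  exact h1

variable [FiniteDimensional ℝ 𝔡]

/-- Pointwise existence of the reduced bivector. -/
theorem IsReductiveData.existsUnique_graph_eq_reducedFibre
    (h : IsReductiveData hR hBs hH C iN iM μS qN qM (ES := ES) (EP := EP) (ENr := ENr)
      (EMr := EMr)) (hB : IsInvariantMetric B) (hK : IsLagrangian B K) (hHK : IsCompl H K)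
    (hK' : IsLagrangian (reducedForm B hBs C) K')
    (hHK' : IsCompl (reducedSubspace B C H) K') (x : P) :
    ∃! b : Bivector (Tan EMr (qM x)), reducedFibre (EP := EP) R iM qM K' x = b.graph := by
  refine Bivector.existsUnique_graph_eq (fun β => ?_) ?_
  · obtain ⟨g, hg⟩ := LinearMap.exists_leftInverse_of_injective
      (mfderiv 𝓘(ℝ, EP) 𝓘(ℝ, EM) iM x).toLinearMap
      (LinearMap.ker_eq_bot.2 (mfderiv_injective_of_immersion h.immersion_iM x))
    let α : Cot EM (iM x) :=
      (β.comp (mfderiv 𝓘(ℝ, EP) 𝓘(ℝ, EMr) qM x).toLinearMap).comp g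
    have hα : ∀ w : Tan EP x, α (mfderiv 𝓘(ℝ, EP) 𝓘(ℝ, EM) iM x w) =
        β (mfderiv 𝓘(ℝ, EP) 𝓘(ℝ, EMr) qM x w) := fun w =>
      congrArg (fun w => β (mfderiv 𝓘(ℝ, EP) 𝓘(ℝ, EMr) qM x w)) (DFunLike.congr_fun hg w)
    obtain ⟨ξ, hξ, X, hX⟩ := hR.exists_mem hB hK hHK (iM x) 0 α
    have hX' : (ξ + ((0 : ↥H) : 𝔡), X, α) ∈ R (iM x) := by
      rw [add_comm]
      exact hX
    obtain ⟨w, hw, hL⟩ := exists_add_mem_liftSubspace hBs hB.nondegenerate hH hHK'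
      (h.apply_eq_zero_of_cov hB (0 : ↥H).2 hX' hα)
    have hmem : (ξ + w, X + hR.rho hBs hH (iM x) ⟨w, hw⟩, α) ∈ R (iM x) := by
      simpa using (R (iM x)).add_mem hX' (hR.rho_mem hBs hH (iM x) ⟨w, hw⟩)
    obtain ⟨u, -, hu⟩ := h.exists_mem_reducedFibre hB hmem hL hα
    exact ⟨_, hu⟩
  · rintro ⟨_, β⟩ ⟨v, hv, hvL, u, hu, rfl, hβ⟩ ⟨_, β'⟩ ⟨v', hv', hvL', u', hu', rfl, hβ'⟩
    have h1 := hR.toIsCourantMorphism.isotropic hv hv'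
    rw [apply_eq_zero_of_mem_liftSubspace hBs hK' hvL hvL', ← hu, ← hu', hβ, hβ'] at h1
    exact h1.symm

end Reduction

/-! ### Brackets of functions on the reduced space -/

section ReducedBivector

/-- By invariance of the metric, `𝔠^⊥` acts trivially on `𝔠 / 𝔠^⊥`. -/
theorem IsInvariantMetric.apply_lie_eq_zero {𝔡 : Type*} [LieRing 𝔡] [LieAlgebra ℝ 𝔡]
    {B : LinearMap.BilinForm ℝ 𝔡} {C : Submodule ℝ 𝔡} (hB : IsInvariantMetric B)
    (hCl : ∀ x ∈ C, ∀ y ∈ C, ⁅x, y⁆ ∈ C) {ζ c c' : 𝔡} (hζ : ζ ∈ B.orthogonal C) (hc : c ∈ C)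
    (hc' : c' ∈ C) : B ⁅ζ, c⁆ c' = 0 := by
  have h1 : B ζ ⁅c, c'⁆ = 0 := by
    rw [hB.symm.eq]
    exact LinearMap.BilinForm.mem_orthogonal_iff.1 hζ _ (hCl c hc c' hc')
  rw [← lie_skew, map_neg, LinearMap.neg_apply, hB.invariant c ζ c', h1, neg_zero, neg_zero]

variable {𝔡 : Type*} [LieRing 𝔡] [LieAlgebra ℝ 𝔡] [FiniteDimensional ℝ 𝔡]
  {EN : Type*} [NormedAddCommGroup EN] [NormedSpace ℝ EN] [FiniteDimensional ℝ EN]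
  {N : Type*} [TopologicalSpace N] [ChartedSpace EN N] [IsManifold 𝓘(ℝ, EN) ∞ N] [T2Space N]
  {EM : Type*} [NormedAddCommGroup EM] [NormedSpace ℝ EM] [FiniteDimensional ℝ EM]
  {M : Type*} [TopologicalSpace M] [ChartedSpace EM M] [IsManifold 𝓘(ℝ, EM) ∞ M] [T2Space M]
  {ES : Type*} [NormedAddCommGroup ES] [NormedSpace ℝ ES]
  {S : Type*} [TopologicalSpace S] [ChartedSpace ES S]
  {EP : Type*} [NormedAddCommGroup EP] [NormedSpace ℝ EP]
  {P : Type*} [TopologicalSpace P] [ChartedSpace EP P]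
  {ENr : Type*} [NormedAddCommGroup ENr] [NormedSpace ℝ ENr]
  {Nr : Type*} [TopologicalSpace Nr] [ChartedSpace ENr Nr]
  {EMr : Type*} [NormedAddCommGroup EMr] [NormedSpace ℝ EMr]
  {Mr : Type*} [TopologicalSpace Mr] [ChartedSpace EMr Mr]
  {B : LinearMap.BilinForm ℝ 𝔡} {a : LieAction 𝔡 EN N} {H K C : Submodule ℝ 𝔡} {μ : M → N}
  {R : (m : M) → Submodule ℝ (𝔡 × Tan EM m × Cot EM m)}
  {hR : IsManinMorphism B a H μ R} {hBs : B.IsSymm} {hH : IsLagrangian B H}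
  {iN : S → N} {iM : P → M} {μS : P → S} {qN : S → Nr} {qM : P → Mr}
  {K' : Submodule ℝ (CoisoQuotient B C)}

/-- Near a point of `P`, a function on `Mr` is covered by a function `f'` on `M` with a smooth
section of `R` over `df'` whose component in `𝔡` lies, along `P`, in the preimage of `K'`. -/
theorem IsReductiveData.exists_adapted_section
    (h : IsReductiveData hR hBs hH C iN iM μS qN qM (ES := ES) (EP := EP) (ENr := ENr)
      (EMr := EMr)) (hB : IsInvariantMetric B) (hK : IsLagrangian B K) (hHK : IsCompl H K)
    (hHK' : IsCompl (reducedSubspace B C H) K') {f : Mr → ℝ}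
    (hf : ContMDiff 𝓘(ℝ, EMr) 𝓘(ℝ, ℝ) ∞ f) (x₀ : P) :
    ∃ (f' : M → ℝ) (ξ : M → 𝔡) (X : (m : M) → Tan EM m),
      ContMDiff 𝓘(ℝ, EM) 𝓘(ℝ, ℝ) ∞ f' ∧ (∀ m, (ξ m, X m, diff f' m) ∈ R m) ∧ SmoothField X ∧
      (∀ l : Module.Dual ℝ 𝔡, ContMDiff 𝓘(ℝ, EM) 𝓘(ℝ, ℝ) ∞ (fun m => l (ξ m))) ∧
      ∀ᶠ x in 𝓝 x₀, ξ (iM x) ∈ liftSubspace B C K' ∧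
        ∀ w : Tan EP x, diff f' (iM x) (mfderiv 𝓘(ℝ, EP) 𝓘(ℝ, EM) iM x w) =
          diff f (qM x) (mfderiv 𝓘(ℝ, EP) 𝓘(ℝ, EMr) qM x w) := by
  have hne : (∞ : ℕ∞ω) ≠ 0 := by simp
  obtain ⟨T, hT⟩ := exists_linear_twist hB.symm hB.nondegenerate hH hHK hHK' (C := C)
  obtain ⟨f', hf', hext⟩ := exists_extension_of_immersion h.immersion_iM
    (hf.comp h.quotient_M.submersion.contMDiff) x₀
  obtain ⟨ξ, X, hξ, hX, hXs, hξs⟩ := hR.exists_hamiltonian_section hB hH hK hHK T hf'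
  refine ⟨f', fun m => ξ m + (T (ξ m) : 𝔡), X, hf', hX, hXs, hξs, ?_⟩
  filter_upwards [hext.eventually_nhds] with x hx
  have hα : ∀ w : Tan EP x, diff f' (iM x) (mfderiv 𝓘(ℝ, EP) 𝓘(ℝ, EM) iM x w) =
      diff f (qM x) (mfderiv 𝓘(ℝ, EP) 𝓘(ℝ, EMr) qM x w) := by
    intro w
    rw [diff_apply, diff_apply,
      ← dirDeriv_comp (hf'.mdifferentiableAt hne) (h.immersion_iM.contMDiff.mdifferentiableAt hne),
      ← dirDeriv_comp (hf.mdifferentiableAt hne)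
        (h.quotient_M.submersion.contMDiff.mdifferentiableAt hne)]
    exact dirDeriv_congr hx w
  exact ⟨hT _ (hξ _) (h.apply_eq_zero_of_cov hB (T (ξ (iM x))).2 (hX (iM x)) hα), hα⟩

omit [FiniteDimensional ℝ 𝔡] in
/-- The reduced bivector, computed from the vector component of an element of `R`. -/
theorem IsReductiveData.apply_eq_of_graph_eq
    (h : IsReductiveData hR hBs hH C iN iM μS qN qM (ES := ES) (EP := EP) (ENr := ENr)
      (EMr := EMr)) (hB : IsInvariantMetric B) {x : P} {b : Bivector (Tan EMr (qM x))}
    (hb : reducedFibre (EP := EP) R iM qM K' x = b.graph)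
    {v : 𝔡 × Tan EM (iM x) × Cot EM (iM x)} (hv : v ∈ R (iM x))
    (hvL : v.1 ∈ liftSubspace B C K') {β δ : Cot EMr (qM x)} {γ : Cot EM (iM x)}
    (hβ : ∀ w : Tan EP x, v.2.2 (mfderiv 𝓘(ℝ, EP) 𝓘(ℝ, EM) iM x w) =
      β (mfderiv 𝓘(ℝ, EP) 𝓘(ℝ, EMr) qM x w))
    (hγ : ∀ w : Tan EP x, γ (mfderiv 𝓘(ℝ, EP) 𝓘(ℝ, EM) iM x w) =
      δ (mfderiv 𝓘(ℝ, EP) 𝓘(ℝ, EMr) qM x w)) : b ![β, δ] = γ v.2.1 := by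
  obtain ⟨u, hu, hmem⟩ := h.exists_mem_reducedFibre hB hv hvL hβ
  rw [hb] at hmem
  rw [← hu, hγ]
  exact (hmem δ).symm

/-- The brackets of functions on `Mr` are smooth on `P`, and invariant under `𝔥 ∩ 𝔠^⊥`. -/
theorem IsReductiveData.contMDiff_bracket
    (h : IsReductiveData hR hBs hH C iN iM μS qN qM (ES := ES) (EP := EP) (ENr := ENr)
      (EMr := EMr)) (hB : IsInvariantMetric B) (hK : IsLagrangian B K) (hHK : IsCompl H K)
    (hCl : ∀ x ∈ C, ∀ y ∈ C, ⁅x, y⁆ ∈ C)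
    (hK' : IsLagrangian (reducedForm B hBs C) K')
    (hHK' : IsCompl (reducedSubspace B C H) K') {b : (x : P) → Bivector (Tan EMr (qM x))}
    (hb : ∀ x, reducedFibre (EP := EP) R iM qM K' x = (b x).graph) {f g : Mr → ℝ}
    (hf : ContMDiff 𝓘(ℝ, EMr) 𝓘(ℝ, ℝ) ∞ f) (hg : ContMDiff 𝓘(ℝ, EMr) 𝓘(ℝ, ℝ) ∞ g) :
    ContMDiff 𝓘(ℝ, EP) 𝓘(ℝ, ℝ) ∞ (fun x => b x ![diff f (qM x), diff g (qM x)]) ∧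
    ∀ (ζ : ↥(stab B C H)) (x : P),
      dirDeriv (fun x => b x ![diff f (qM x), diff g (qM x)]) x
        (hR.stabAction hBs hH C iM ζ x : Tan EP x) = 0 := by
  have hne : (∞ : ℕ∞ω) ≠ 0 := by simp
  have hi : ContMDiff 𝓘(ℝ, EP) 𝓘(ℝ, EM) ∞ iM := h.immersion_iM.contMDiff
  have key : ∀ x₀ : P,
      ContMDiffAt 𝓘(ℝ, EP) 𝓘(ℝ, ℝ) ∞ (fun x => b x ![diff f (qM x), diff g (qM x)]) x₀ ∧
      ∀ ζ : ↥(stab B C H), dirDeriv (fun x => b x ![diff f (qM x), diff g (qM x)]) x₀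
        (hR.stabAction hBs hH C iM ζ x₀ : Tan EP x₀) = 0 := by
    intro x₀
    obtain ⟨f', ξ, X, hf', hX, hXs, hξs, hfe⟩ :=
      h.exists_adapted_section hB hK hHK hHK' hf x₀
    obtain ⟨g', ξ', X', hg', hX', -, -, hge⟩ :=
      h.exists_adapted_section hB hK hHK hHK' hg x₀
    have hF : ContMDiff 𝓘(ℝ, EM) 𝓘(ℝ, ℝ) ∞ (fun m => dirDeriv g' m (X m)) :=
      hXs.contMDiff_dirDeriv hg'
    have hbr : (fun x => b x ![diff f (qM x), diff g (qM x)]) =ᶠ[𝓝 x₀]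
        fun x => dirDeriv g' (iM x) (X (iM x)) := by
      filter_upwards [hfe, hge] with x hx hx'
      exact h.apply_eq_of_graph_eq hB (hb x) (hX (iM x)) hx.1 hx.2 hx'.2
    refine ⟨(hF.comp hi).contMDiffAt.congr_of_eventuallyEq hbr, fun ζ => ?_⟩
    have hfx := hfe.self_of_nhds
    have hgx := hge.self_of_nhds
    obtain ⟨u, hu⟩ := h.exists_tangent hB (hX (iM x₀)) (liftSubspace_le hfx.1)
    obtain ⟨u', hu'⟩ := h.exists_tangent hB (hX' (iM x₀)) (liftSubspace_le hgx.1)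
    simp only at hu hu'
    -- the derivative along `P` of a function on `M` that vanishes on `P` is zero
    have hvan : ∀ (F : M → ℝ), ContMDiff 𝓘(ℝ, EM) 𝓘(ℝ, ℝ) ∞ F → (∀ᶠ x in 𝓝 x₀, F (iM x) = 0) →
        ∀ w : Tan EP x₀, dirDeriv F (iM x₀) (mfderiv 𝓘(ℝ, EP) 𝓘(ℝ, EM) iM x₀ w) = 0 := by
      intro F hF h0 w
      rw [← dirDeriv_comp (hF.mdifferentiableAt hne) (hi.mdifferentiableAt hne),
        dirDeriv_congr h0 w, dirDeriv_const]
    have hρ : ∀ {e : Mr → ℝ} {e' : M → ℝ} {x : P},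
        (∀ w : Tan EP x, diff e' (iM x) (mfderiv 𝓘(ℝ, EP) 𝓘(ℝ, EM) iM x w) =
          diff e (qM x) (mfderiv 𝓘(ℝ, EP) 𝓘(ℝ, EMr) qM x w)) →
        dirDeriv e' (iM x) (hR.rho hBs hH (iM x) (ζ : ↥H)) = 0 := by
      intro e e' x hx
      have h1 := hx (hR.stabAction hBs hH C iM ζ x)
      rwa [h.mfderiv_stabAction hB, h.mfderiv_qM_stabAction, map_zero, diff_apply] at h1
    have hρs := hR.smoothField_rho hB hH hK hHK (ζ : ↥H)
    -- all terms but the one with the Lie bracket are derivatives along `P` of functions that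
    -- vanish on `P` near `x₀`
    rw [dirDeriv_congr hbr, dirDeriv_comp (hF.mdifferentiableAt hne) (hi.mdifferentiableAt hne),
      h.mfderiv_stabAction hB,
      hR.dirDeriv_rho_dirDeriv hB hH hK hHK (ζ : ↥H) hf' hg' hX hXs hξs (hX' (iM x₀)),
      hB.apply_lie_eq_zero hCl (ζ := ((ζ : ↥H) : 𝔡)) ζ.2 (liftSubspace_le hfx.1)
        (liftSubspace_le hgx.1), ← hu, ← hu',
      hvan _ (hρs.contMDiff_dirDeriv hf') (hfe.mono fun x hx => hρ hx.2),
      hvan _ (hρs.contMDiff_dirDeriv hg') (hge.mono fun x hx => hρ hx.2),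
      ← h.mfderiv_stabAction hB, hvan (fun m => B (ξ m) (ξ' (iM x₀)))
        (hξs ((LinearMap.flip B) (ξ' (iM x₀)))) (hfe.mono fun x hx =>
          apply_eq_zero_of_mem_liftSubspace hBs hK' hx.1 hgx.1)]
    simp
  exact ⟨fun x => (key x).1, fun ζ x => (key x).2 ζ⟩

end ReducedBivector

/-! ### The reduced bivector field -/

section ReducedExistence

variable {𝔡 : Type*} [LieRing 𝔡] [LieAlgebra ℝ 𝔡] [FiniteDimensional ℝ 𝔡]
  {EN : Type*} [NormedAddCommGroup EN] [NormedSpace ℝ EN] [FiniteDimensional ℝ EN]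
  {N : Type*} [TopologicalSpace N] [ChartedSpace EN N] [IsManifold 𝓘(ℝ, EN) ∞ N] [T2Space N]
  {EM : Type*} [NormedAddCommGroup EM] [NormedSpace ℝ EM] [FiniteDimensional ℝ EM]
  {M : Type*} [TopologicalSpace M] [ChartedSpace EM M] [IsManifold 𝓘(ℝ, EM) ∞ M] [T2Space M]
  {ES : Type*} [NormedAddCommGroup ES] [NormedSpace ℝ ES]
  {S : Type*} [TopologicalSpace S] [ChartedSpace ES S]
  {EP : Type*} [NormedAddCommGroup EP] [NormedSpace ℝ EP]
  {P : Type*} [TopologicalSpace P] [ChartedSpace EP P]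
  {ENr : Type*} [NormedAddCommGroup ENr] [NormedSpace ℝ ENr]
  {Nr : Type*} [TopologicalSpace Nr] [ChartedSpace ENr Nr]
  {EMr : Type*} [NormedAddCommGroup EMr] [NormedSpace ℝ EMr] [FiniteDimensional ℝ EMr]
  {Mr : Type*} [TopologicalSpace Mr] [ChartedSpace EMr Mr]
  [IsManifold 𝓘(ℝ, EMr) ∞ Mr] [T2Space Mr]
  {B : LinearMap.BilinForm ℝ 𝔡} {a : LieAction 𝔡 EN N} {H K C : Submodule ℝ 𝔡} {μ : M → N}
  {R : (m : M) → Submodule ℝ (𝔡 × Tan EM m × Cot EM m)}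
  {hR : IsManinMorphism B a H μ R} {hBs : B.IsSymm} {hH : IsLagrangian B H}
  {iN : S → N} {iM : P → M} {μS : P → S} {qN : S → Nr} {qM : P → Mr}
  {K' : Submodule ℝ (CoisoQuotient B C)}

/-- The fibre of `K' ∘ R_{𝔠,S}` over `qM x` can be computed at the single point `x`: brackets of
functions are invariant along the orbits of `𝔥 ∩ 𝔠^⊥`, so all points of the orbit contribute the
same bivector. -/
theorem IsReductiveData.composeSubspace_eq
    (h : IsReductiveData hR hBs hH C iN iM μS qN qM (ES := ES) (EP := EP) (ENr := ENr)
      (EMr := EMr)) (hB : IsInvariantMetric B) (hK : IsLagrangian B K) (hHK : IsCompl H K)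
    (hCl : ∀ x ∈ C, ∀ y ∈ C, ⁅x, y⁆ ∈ C) (hK' : IsLagrangian (reducedForm B hBs C) K')
    (hHK' : IsCompl (reducedSubspace B C H) K') {b : (x : P) → Bivector (Tan EMr (qM x))}
    (hb : ∀ x, reducedFibre (EP := EP) R iM qM K' x = (b x).graph) (x : P) :
    composeSubspace K' (reducedRelation B R C μ iN iM qN qM (EP := EP)) (qM x) =
      (b x).graph := by
  refine Set.Subset.antisymm ?_ fun p hp => ?_
  · rintro ⟨Z, β⟩ ⟨n, ξ', hξ', x', s, ξ, X, α, u, hmem, -, -, hξ, hx', hu, hZ, hβ⟩ ν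
    -- the tangent spaces at `qM x'` and `qM x` are identified along `qM x' = qM x`
    have hcast : ∀ (e : Mr → ℝ) (m m' : Mr), m = m' → ∀ v : EMr,
        (diff e m : Cot EMr m) v = (diff e m' : Cot EMr m') v := by
      rintro e m _ rfl v
      rfl
    obtain ⟨f, hf, hfβ⟩ := exists_diff_eq (qM x) β
    obtain ⟨g, hg, hgν⟩ := exists_diff_eq (qM x) ν
    obtain ⟨hs, h0⟩ := h.contMDiff_bracket hB hK hHK hCl hK' hHK' hb hf hg
    have heq := SameOrbit.eq_of_dirDeriv_eq_zero (hs.mdifferentiable (by simp)) h0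
      ((h.quotient_M.fibre x' x).1 hx')
    have hL : (ξ : 𝔡) ∈ liftSubspace B C K' := by
      refine mem_liftSubspace.2 ⟨ξ.2, ?_⟩
      change Submodule.Quotient.mk ξ ∈ K'
      rwa [hξ]
    have h1 : (mfderiv 𝓘(ℝ, EP) 𝓘(ℝ, EMr) qM x' u, diff f (qM x')) ∈ (b x').graph := by
      rw [← hb]
      refine ⟨_, hmem, hL, u, hu, rfl, fun w => ?_⟩
      refine (hβ w).trans ?_
      rw [← hfβ]
      exact hcast f _ _ hx'.symm _
    have h2 := h1 (diff g (qM x'))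
    simp only at heq h2 hZ
    rw [heq, hfβ, hgν] at h2
    rw [← h2, ← hgν, ← hZ]
    exact hcast g _ _ hx'.symm _
  · rw [← hb] at hp
    obtain ⟨v, hv, hvL, u, hu, hp1, hp2⟩ := hp
    obtain ⟨hvC, hvK⟩ := mem_liftSubspace.1 hvL
    exact ⟨qN (μS x), _, hvK, x, μS x, ⟨v.1, hvC⟩, v.2.1, v.2.2, u, hv, h.commutes x, rfl, rfl,
      rfl, hu, hp1, hp2⟩

/-- The reduced bivector field exists and is unique. -/
theorem IsReductiveData.existsUnique_bivector
    (h : IsReductiveData hR hBs hH C iN iM μS qN qM (ES := ES) (EP := EP) (ENr := ENr)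
      (EMr := EMr)) (hB : IsInvariantMetric B) (hK : IsLagrangian B K) (hHK : IsCompl H K)
    (hCl : ∀ x ∈ C, ∀ y ∈ C, ⁅x, y⁆ ∈ C) (hK' : IsLagrangian (reducedForm B hBs C) K')
    (hHK' : IsCompl (reducedSubspace B C H) K') :
    ∃! πr : (m : Mr) → Bivector (Tan EMr m),
      IsQuasiPoissonBivector K' (reducedRelation B R C μ iN iM qN qM (EP := EP)) πr := by
  choose b hb hbu using h.existsUnique_graph_eq_reducedFibre hB hK hHK hK' hHK'
  have hc := h.composeSubspace_eq hB hK hHK hCl hK' hHK' hb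
  have hex : ∀ m : Mr, ∃! c : Bivector (Tan EMr m),
      composeSubspace K' (reducedRelation B R C μ iN iM qN qM (EP := EP)) m = c.graph := by
    intro m
    obtain ⟨x, rfl⟩ := h.quotient_M.surjective m
    exact ⟨b x, hc x, fun c hc' => hbu x c ((hb x).trans ((hc x).symm.trans hc'))⟩
  choose πr hπr hπru using hex
  refine ⟨πr, ⟨fun f g hf hg => ?_, hπr⟩, fun π' hπ' => funext fun m => hπru m _ (hπ'.graph_eq m)⟩
  refine contMDiff_of_comp_submersion h.quotient_M.submersion h.quotient_M.surjective ?_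
  refine (h.contMDiff_bracket hB hK hHK hCl hK' hHK' hb hf hg).1.congr fun x => ?_
  rw [hbu x (πr (qM x)) ((hb x).trans ((hc x).symm.trans (hπr (qM x))))]

end ReducedExistence

/-! ### Coordinates of functionals -/

section DualBasis

variable {V : Type*} [AddCommGroup V] [Module ℝ V]

theorem Bivector.push_push {W Z : Type*} [AddCommGroup W] [Module ℝ W] [AddCommGroup Z]
    [Module ℝ Z] (f : V →ₗ[ℝ] W) (g : W →ₗ[ℝ] Z) (b : Bivector V) :
    (b.push f).push g = b.push (g.comp f) := by
  refine Bivector.ext_apply fun α β => ?_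
  rw [Bivector.push_apply, Bivector.push_apply, Bivector.push_apply]
  rfl

/-- Coordinates of a functional with respect to functionals `f i` that are given by their values
on vectors `w j`. -/
theorem dual_eq_sum_inv_mulVec [FiniteDimensional ℝ V] {ι : Type*} [Fintype ι] [DecidableEq ι]
    (hι : Fintype.card ι = Module.finrank ℝ V) {f : ι → Module.Dual ℝ V} {w : ι → V}
    (hdet : (Matrix.of fun j i => f i (w j)).det ≠ 0) (α : Module.Dual ℝ V) :
    α = ∑ i, ((Matrix.of fun j i => f i (w j))⁻¹.mulVec (fun j => α (w j))) i • f i := by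
  set A : Matrix ι ι ℝ := Matrix.of fun j i => f i (w j) with hA
  have hmul : ∀ c : ι → ℝ, A.mulVec c = fun j => (∑ i, c i • f i) (w j) := by
    intro c
    funext j
    simp [hA, Matrix.mulVec, dotProduct, LinearMap.sum_apply, mul_comm]
  have hli : LinearIndependent ℝ f := by
    refine Fintype.linearIndependent_iff.2 fun c hc i => ?_
    have h1 : A.mulVec c = 0 := by
      rw [hmul, hc]
      rfl
    exact congrFun (Matrix.eq_zero_of_mulVec_eq_zero hdet h1) i
  have hspan := hli.span_eq_top_of_card_eq_finrank' (hι.trans Subspace.dual_finrank_eq.symm)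
  obtain ⟨c, hc⟩ := (Submodule.mem_span_range_iff_exists_fun ℝ).1
    (hspan ▸ Submodule.mem_top : α ∈ Submodule.span ℝ (Set.range f))
  have h2 : A⁻¹.mulVec (fun j => α (w j)) = c := by
    rw [← hc, ← hmul, Matrix.mulVec_mulVec, Matrix.nonsing_inv_mul _ (Ne.isUnit hdet),
      Matrix.one_mulVec]
  rw [h2, hc]

end DualBasis

/-! ### The lift of the reduced bivector field -/

section Restriction

variable {𝔡 : Type*} [LieRing 𝔡] [LieAlgebra ℝ 𝔡] [FiniteDimensional ℝ 𝔡]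
  {EN : Type*} [NormedAddCommGroup EN] [NormedSpace ℝ EN] [FiniteDimensional ℝ EN]
  {N : Type*} [TopologicalSpace N] [ChartedSpace EN N] [IsManifold 𝓘(ℝ, EN) ∞ N] [T2Space N]
  {EM : Type*} [NormedAddCommGroup EM] [NormedSpace ℝ EM] [FiniteDimensional ℝ EM]
  {M : Type*} [TopologicalSpace M] [ChartedSpace EM M] [IsManifold 𝓘(ℝ, EM) ∞ M] [T2Space M]
  {ES : Type*} [NormedAddCommGroup ES] [NormedSpace ℝ ES]
  {S : Type*} [TopologicalSpace S] [ChartedSpace ES S]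
  {EP : Type*} [NormedAddCommGroup EP] [NormedSpace ℝ EP]
  {P : Type*} [TopologicalSpace P] [ChartedSpace EP P]
  {ENr : Type*} [NormedAddCommGroup ENr] [NormedSpace ℝ ENr]
  {Nr : Type*} [TopologicalSpace Nr] [ChartedSpace ENr Nr]
  {EMr : Type*} [NormedAddCommGroup EMr] [NormedSpace ℝ EMr]
  {Mr : Type*} [TopologicalSpace Mr] [ChartedSpace EMr Mr]
  {B : LinearMap.BilinForm ℝ 𝔡} {a : LieAction 𝔡 EN N} {H K C : Submodule ℝ 𝔡} {μ : M → N}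
  {R : (m : M) → Submodule ℝ (𝔡 × Tan EM m × Cot EM m)}
  {hR : IsManinMorphism B a H μ R} {hBs : B.IsSymm} {hH : IsLagrangian B H}
  {iN : S → N} {iM : P → M} {μS : P → S} {qN : S → Nr} {qM : P → Mr}
  {K' : Submodule ℝ (CoisoQuotient B C)}

omit [FiniteDimensional ℝ 𝔡] in
theorem IsReductiveData.projQuotient_bijective
    (h : IsReductiveData hR hBs hH C iN iM μS qN qM (ES := ES) (EP := EP) (ENr := ENr)
      (EMr := EMr)) (hB : IsInvariantMetric B) (x : P) :
    Function.Bijective (h.projQuotient x) := by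
  constructor
  · refine LinearMap.ker_eq_bot.1 (Submodule.ker_liftQ_eq_bot _ _ _ ?_)
    exact (h.ker_mfderiv_qM hB x).le
  · intro Z
    obtain ⟨u, hu⟩ := mfderiv_surjective_of_submersion h.quotient_M.submersion x Z
    exact ⟨Submodule.Quotient.mk u, hu⟩

/-- The restriction of `π_𝔨 + ρ_R(τ)` to `P` is the lift of the reduced bivector field. -/
theorem IsReductiveData.push_inclQuotient
    (h : IsReductiveData hR hBs hH C iN iM μS qN qM (ES := ES) (EP := EP) (ENr := ENr)
      (EMr := EMr)) (hB : IsInvariantMetric B) (hK : IsLagrangian B K) (hHK : IsCompl H K)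
    (hHK' : IsCompl (reducedSubspace B C H) K') {π : (m : M) → Bivector (Tan EM m)}
    (hπ : IsQuasiPoissonBivector K (graphRelation μ R) π) {τ : Bivector (↥H ⧸ stab B C H)}
    (hτ : IsTwist B C H K K' τ) {x : P} {b : Bivector (Tan EMr (qM x))}
    (hb : reducedFibre (EP := EP) R iM qM K' x = b.graph)
    {σ : Bivector (Tan EP x ⧸ (hR.stabTangent hBs hH C iM x : Submodule ℝ (Tan EP x)))}
    (hσ : σ.push (h.projQuotient x) = b) :
    σ.push (hR.inclQuotient hBs hH C iM x) =
      (π (iM x)).push (hR.stabRange hBs hH C (iM x)).mkQ +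
        τ.push (hR.rhoQuotient hBs hH C (iM x)) := by
  refine Bivector.ext_apply fun α β => ?_
  let e := LinearEquiv.ofBijective (h.projQuotient x) (h.projQuotient_bijective hB x)
  -- covectors of `TM / ρ_R(𝔥 ∩ 𝔠^⊥)` restrict to pullbacks of covectors of `Mr`
  have hcov : ∀ γ : Module.Dual ℝ (Tan EM (iM x) ⧸ hR.stabRange hBs hH C (iM x)),
      ∃ γr : Cot EMr (qM x), γr.comp (h.projQuotient x) =
        γ.comp (hR.inclQuotient hBs hH C iM x) := fun γ =>
    ⟨(γ.comp (hR.inclQuotient hBs hH C iM x)).comp e.symm.toLinearMap,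
      LinearMap.ext fun v => congrArg (fun v => γ (hR.inclQuotient hBs hH C iM x v))
        (e.symm_apply_apply v)⟩
  obtain ⟨αr, hαr⟩ := hcov α
  obtain ⟨βr, hβr⟩ := hcov β
  have hcov' : ∀ {γ : Module.Dual ℝ (Tan EM (iM x) ⧸ hR.stabRange hBs hH C (iM x))}
      {γr : Cot EMr (qM x)}, γr.comp (h.projQuotient x) =
        γ.comp (hR.inclQuotient hBs hH C iM x) → ∀ u : Tan EP x,
      (γ.comp (hR.stabRange hBs hH C (iM x)).mkQ) (mfderiv 𝓘(ℝ, EP) 𝓘(ℝ, EM) iM x u) =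
        γr (mfderiv 𝓘(ℝ, EP) 𝓘(ℝ, EMr) qM x u) := fun hγ u =>
    (DFunLike.congr_fun hγ (Submodule.Quotient.mk u)).symm
  obtain ⟨ξ, hξ, X, hX⟩ := hR.exists_mem hB hK hHK (iM x) 0
    (α.comp (hR.stabRange hBs hH C (iM x)).mkQ)
  rw [ZeroMemClass.coe_zero, zero_add] at hX
  obtain ⟨w, hw, hL⟩ := exists_add_mem_liftSubspace hBs hB.nondegenerate hH hHK'
    (h.apply_eq_zero_of_cov hB (w := 0) H.zero_mem (by rw [add_zero]; exact hX) (hcov' hαr))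
  have hmem : (ξ + w, X + hR.rho hBs hH (iM x) ⟨w, hw⟩,
      α.comp (hR.stabRange hBs hH C (iM x)).mkQ) ∈ R (iM x) := by
    simpa using (R (iM x)).add_mem hX (hR.rho_mem hBs hH (iM x) ⟨w, hw⟩)
  have h1 : b ![αr, βr] = (β.comp (hR.stabRange hBs hH C (iM x)).mkQ)
      (X + hR.rho hBs hH (iM x) ⟨w, hw⟩) :=
    h.apply_eq_of_graph_eq hB hb hmem hL (hcov' hαr) (hcov' hβr)
  have h2 : (X, α.comp (hR.stabRange hBs hH C (iM x)).mkQ) ∈ (π (iM x)).graph := by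
    rw [← hπ.graph_eq]
    exact ⟨μ (iM x), ξ, hξ, rfl, hX⟩
  obtain ⟨ξ', hξ', κ, hκ, w', hww', hτw⟩ := (hτ (ξ + w)).1 hL
  obtain ⟨rfl, hw'⟩ := eq_of_add_eq_add hHK hξ hξ' hw w'.2 hww'
  have hκ' : κ = α.comp (hR.rhoQuotient hBs hH C (iM x)) := by
    refine Submodule.linearMap_qext _ (LinearMap.ext fun u => ?_)
    exact (hκ u).trans (hR.apply_eq_cov_rho hBs hH hX u)
  have h3 := hτw (β.comp (hR.rhoQuotient hBs hH C (iM x)))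
  have hw'' : w' = ⟨w, hw⟩ := Subtype.ext hw'.symm
  rw [hκ', hw''] at h3
  rw [Bivector.push_apply, AlternatingMap.add_apply, Bivector.push_apply, Bivector.push_apply,
    ← hαr, ← hβr, ← Bivector.push_apply, hσ, h1, map_add]
  exact congrArg₂ (· + ·) (h2 _) h3

omit [FiniteDimensional ℝ 𝔡] in
/-- A bivector field that is the lift of a bivector field on the quotient is invariant. -/
theorem IsReductiveData.isInvariant
    (h : IsReductiveData hR hBs hH C iN iM μS qN qM (ES := ES) (EP := EP) (ENr := ENr)
      (EMr := EMr)) (hB : IsInvariantMetric B) {πr : (m : Mr) → Bivector (Tan EMr m)}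
    {σ : (x : P) →
      Bivector (Tan EP x ⧸ (hR.stabTangent hBs hH C iM x : Submodule ℝ (Tan EP x)))}
    (hσ : ∀ x, (σ x).push (h.projQuotient x) = πr (qM x)) :
    IsInvariant (hR.stabAction hBs hH C iM) (hR.stabTangent hBs hH C iM) σ := by
  intro ζ φ ε U hφ t ht x hx
  have hne : (∞ : ℕ∞ω) ≠ 0 := by simp
  have hq : ContMDiff 𝓘(ℝ, EP) 𝓘(ℝ, EMr) ∞ qM := h.quotient_M.submersion.contMDiff
  -- the flow preserves the orbits, which are the fibres of `qM`
  have hqφ : ∀ y ∈ U, qM (φ t y) = qM y := by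
    intro y hy
    refine ((h.quotient_M.fibre _ _).2 (Relation.EqvGen.rel _ _
      ⟨ζ, fun s => φ s y, -ε, ε, hφ.integral y hy, 0, ?_, t, ht, hφ.initial y hy, rfl⟩)).symm
    have := ht.1.trans ht.2
    constructor <;> linarith
  have hφt : MDifferentiableAt 𝓘(ℝ, EP) 𝓘(ℝ, EP) (φ t) x := by
    have h1 : ContMDiffAt (𝓘(ℝ, ℝ).prod 𝓘(ℝ, EP)) 𝓘(ℝ, EP) ∞ (fun p : ℝ × P => φ p.1 p.2) (t, x) :=
      hφ.smooth.contMDiffAt ((isOpen_Ioo.prod hφ.isOpen).mem_nhds ⟨ht, hx⟩)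
    exact (h1.comp x (contMDiffAt_const.prodMk contMDiffAt_id)).mdifferentiableAt hne
  have hd : ∀ v : Tan EP x, (mfderiv 𝓘(ℝ, EP) 𝓘(ℝ, EMr) qM (φ t x)
      (mfderiv 𝓘(ℝ, EP) 𝓘(ℝ, EP) (φ t) x v) : EMr) = mfderiv 𝓘(ℝ, EP) 𝓘(ℝ, EMr) qM x v := by
    intro v
    have h1 : HasMFDerivAt 𝓘(ℝ, EP) 𝓘(ℝ, EMr) (qM ∘ φ t) x
        ((mfderiv 𝓘(ℝ, EP) 𝓘(ℝ, EMr) qM (φ t x)).comp (mfderiv 𝓘(ℝ, EP) 𝓘(ℝ, EP) (φ t) x)) :=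
      ((hq.mdifferentiableAt hne).hasMFDerivAt).comp x hφt.hasMFDerivAt
    have h2 : HasMFDerivAt 𝓘(ℝ, EP) 𝓘(ℝ, EMr) (qM ∘ φ t) x
        (mfderiv 𝓘(ℝ, EP) 𝓘(ℝ, EMr) qM x) :=
      (hq.mdifferentiableAt hne).hasMFDerivAt.congr_of_eventuallyEq
        (Filter.eventuallyEq_of_mem (hφ.isOpen.mem_nhds hx) hqφ)
    exact DFunLike.congr_fun (hasMFDerivAt_unique h1 h2) v
  have hF : hR.stabTangent hBs hH C iM x ≤ (hR.stabTangent hBs hH C iM (φ t x)).comap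
      (mfderiv 𝓘(ℝ, EP) 𝓘(ℝ, EP) (φ t) x).toLinearMap := by
    intro v hv
    rw [Submodule.mem_comap, ← h.ker_mfderiv_qM hB (φ t x)]
    rw [← h.ker_mfderiv_qM hB x] at hv
    have hv0 : mfderiv 𝓘(ℝ, EP) 𝓘(ℝ, EMr) qM x v = 0 := hv
    exact LinearMap.mem_ker.2 ((hd v).trans hv0)
  refine ⟨hF, Bivector.push_injective (f := h.projQuotient (φ t x))
    (h.projQuotient_bijective hB (φ t x)).1 ?_⟩
  rw [hσ, Bivector.push_push]
  refine Bivector.ext_apply fun γ δ => ?_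
  have hcast : ∀ m m' : Mr, m = m' → ∀ γ δ : Module.Dual ℝ EMr,
      πr m ![γ, δ] = πr m' ![γ, δ] := by
    rintro m _ rfl γ δ
    rfl
  have hcomp : ∀ (γ : Cot EMr (qM (φ t x))) (γ' : Cot EMr (qM x)), (∀ v : EMr, γ v = γ' v) →
      γ.comp ((h.projQuotient (φ t x)).comp (Submodule.mapQ _ _
        (mfderiv 𝓘(ℝ, EP) 𝓘(ℝ, EP) (φ t) x).toLinearMap hF)) = γ'.comp (h.projQuotient x) :=
    fun γ γ' hγ => Submodule.linearMap_qext _ (LinearMap.ext fun v =>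
      (congrArg γ (hd v)).trans (hγ _))
  let γ' : Cot EMr (qM x) := γ
  let δ' : Cot EMr (qM x) := δ
  have h1 : σ x ![γ'.comp (h.projQuotient x), δ'.comp (h.projQuotient x)] =
      πr (qM x) ![γ', δ'] := by
    rw [← hσ x, Bivector.push_apply]
  rw [Bivector.push_apply, hcomp γ γ' fun _ => rfl, hcomp δ δ' fun _ => rfl]
  exact h1.trans (hcast _ _ (hqφ x hx).symm γ δ)

end Restriction

section RestrictionSmooth

variable {𝔡 : Type*} [LieRing 𝔡] [LieAlgebra ℝ 𝔡]
  {EN : Type*} [NormedAddCommGroup EN] [NormedSpace ℝ EN] [FiniteDimensional ℝ EN]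
  {N : Type*} [TopologicalSpace N] [ChartedSpace EN N] [IsManifold 𝓘(ℝ, EN) ∞ N] [T2Space N]
  {EM : Type*} [NormedAddCommGroup EM] [NormedSpace ℝ EM] [FiniteDimensional ℝ EM]
  {M : Type*} [TopologicalSpace M] [ChartedSpace EM M] [IsManifold 𝓘(ℝ, EM) ∞ M] [T2Space M]
  {ES : Type*} [NormedAddCommGroup ES] [NormedSpace ℝ ES]
  {S : Type*} [TopologicalSpace S] [ChartedSpace ES S]
  {EP : Type*} [NormedAddCommGroup EP] [NormedSpace ℝ EP] [FiniteDimensional ℝ EP]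
  {P : Type*} [TopologicalSpace P] [ChartedSpace EP P]
  [IsManifold 𝓘(ℝ, EP) ∞ P] [T2Space P]
  {ENr : Type*} [NormedAddCommGroup ENr] [NormedSpace ℝ ENr]
  {Nr : Type*} [TopologicalSpace Nr] [ChartedSpace ENr Nr]
  {EMr : Type*} [NormedAddCommGroup EMr] [NormedSpace ℝ EMr] [FiniteDimensional ℝ EMr]
  {Mr : Type*} [TopologicalSpace Mr] [ChartedSpace EMr Mr]
  [IsManifold 𝓘(ℝ, EMr) ∞ Mr] [T2Space Mr]
  {B : LinearMap.BilinForm ℝ 𝔡} {a : LieAction 𝔡 EN N} {H K C : Submodule ℝ 𝔡} {μ : M → N}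
  {R : (m : M) → Submodule ℝ (𝔡 × Tan EM m × Cot EM m)}
  {hR : IsManinMorphism B a H μ R} {hBs : B.IsSymm} {hH : IsLagrangian B H}
  {iN : S → N} {iM : P → M} {μS : P → S} {qN : S → Nr} {qM : P → Mr}
  {K' : Submodule ℝ (CoisoQuotient B C)}

/-- A section of `⋀² (TP / ρ_R(𝔥 ∩ 𝔠^⊥))` that is the lift of a smooth bivector field on the
quotient is smooth: locally, sections of the dual of `TP / ρ_R(𝔥 ∩ 𝔠^⊥)` are combinations of
differentials of functions on `Mr`. -/
theorem IsReductiveData.smoothQuotientBivector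
    (h : IsReductiveData hR hBs hH C iN iM μS qN qM (ES := ES) (EP := EP) (ENr := ENr)
      (EMr := EMr)) (hB : IsInvariantMetric B) {πr : (m : Mr) → Bivector (Tan EMr m)}
    (hπr : SmoothBivectorField πr)
    {σ : (x : P) →
      Bivector (Tan EP x ⧸ (hR.stabTangent hBs hH C iM x : Submodule ℝ (Tan EP x)))}
    (hσ : ∀ x, (σ x).push (h.projQuotient x) = πr (qM x)) :
    SmoothQuotientBivector (hR.stabTangent hBs hH C iM) σ := by
  intro α β hα hβ x₀
  have hne : (∞ : ℕ∞ω) ≠ 0 := by simp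
  have hq : ContMDiff 𝓘(ℝ, EP) 𝓘(ℝ, EMr) ∞ qM := h.quotient_M.submersion.contMDiff
  let bas := Module.finBasis ℝ EMr
  choose f hf hfd using fun i => exists_diff_eq (E := EMr) (qM x₀) (bas.coord i)
  choose w hw using fun j =>
    mfderiv_surjective_of_submersion h.quotient_M.submersion x₀ (bas j)
  choose W hW hWx using fun j => exists_smoothField x₀ (w j)
  let A : P → Matrix (Fin (Module.finrank ℝ EMr)) (Fin (Module.finrank ℝ EMr)) ℝ := fun x =>
    Matrix.of fun j i => diff (f i) (qM x) (mfderiv 𝓘(ℝ, EP) 𝓘(ℝ, EMr) qM x (W j x))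
  have hA : ∀ j i, ContMDiff 𝓘(ℝ, EP) 𝓘(ℝ, ℝ) ∞ (fun x => A x j i) := by
    intro j i
    refine ((hW j).contMDiff_dirDeriv ((hf i).comp hq)).congr fun x => ?_
    exact (dirDeriv_comp ((hf i).mdifferentiableAt hne) (hq.mdifferentiableAt hne) (W j x)).symm
  have hA0 : A x₀ = 1 := by
    ext j i
    simp only [A, Matrix.of_apply, hWx, hw, hfd, Matrix.one_apply]
    exact (bas.coord_apply i (bas j)).trans (bas.repr_self_apply j i)
  have hdet : (A x₀).det ≠ 0 := by rw [hA0, Matrix.det_one]; exact one_ne_zero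
  have hdet' : ∀ᶠ x in 𝓝 x₀, (A x).det ≠ 0 :=
    (contMDiffAt_det fun j i => (hA j i).contMDiffAt).continuousAt.eventually_ne hdet
  -- the coordinates of a section of the dual with respect to the differentials of the `f i`
  let co : ((x : P) → Module.Dual ℝ (Tan EP x ⧸ (hR.stabTangent hBs hH C iM x :
      Submodule ℝ (Tan EP x)))) → P → Fin (Module.finrank ℝ EMr) → ℝ := fun γ x =>
    (A x)⁻¹.mulVec fun j => γ x (Submodule.Quotient.mk (W j x))
  have hco : ∀ γ : (x : P) → Module.Dual ℝ (Tan EP x ⧸ (hR.stabTangent hBs hH C iM x :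
      Submodule ℝ (Tan EP x))), ∀ x, (A x).det ≠ 0 →
      γ x = (∑ i, co γ x i • diff (f i) (qM x)).comp (h.projQuotient x) := by
    intro γ x hx
    let e := LinearEquiv.ofBijective (h.projQuotient x) (h.projQuotient_bijective hB x)
    have he : ((γ x).comp e.symm.toLinearMap).comp (h.projQuotient x) = γ x :=
      LinearMap.ext fun v => congrArg (γ x) (e.symm_apply_apply v)
    have hcard : Fintype.card (Fin (Module.finrank ℝ EMr)) =
        Module.finrank ℝ (Tan EMr (qM x)) := Fintype.card_fin _
    have h1 : ∀ γr : Cot EMr (qM x), γr = ∑ i, ((A x)⁻¹.mulVec fun j =>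
        γr (mfderiv 𝓘(ℝ, EP) 𝓘(ℝ, EMr) qM x (W j x))) i • diff (f i) (qM x) := fun γr =>
      dual_eq_sum_inv_mulVec (V := Tan EMr (qM x)) (f := fun i => diff (f i) (qM x))
        (w := fun j => mfderiv 𝓘(ℝ, EP) 𝓘(ℝ, EMr) qM x (W j x))
        hcard hx γr
    have h2 : (fun j => ((γ x).comp e.symm.toLinearMap)
        (mfderiv 𝓘(ℝ, EP) 𝓘(ℝ, EMr) qM x (W j x))) =
        fun j => γ x (Submodule.Quotient.mk (W j x)) :=
      funext fun j => DFunLike.congr_fun he (Submodule.Quotient.mk (W j x))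
    have h3 := h1 ((γ x).comp e.symm.toLinearMap)
    rw [h2] at h3
    exact he.symm.trans (congrArg (fun γr : Cot EMr (qM x) => γr.comp (h.projQuotient x)) h3)
  have hcos : ∀ γ : (x : P) → Module.Dual ℝ (Tan EP x ⧸ (hR.stabTangent hBs hH C iM x :
      Submodule ℝ (Tan EP x))), (∀ Z : (x : P) → Tan EP x, SmoothField Z →
        ContMDiff 𝓘(ℝ, EP) 𝓘(ℝ, ℝ) ∞ (fun x => γ x (Submodule.Quotient.mk (Z x)))) → ∀ i,
      ContMDiffAt 𝓘(ℝ, EP) 𝓘(ℝ, ℝ) ∞ (fun x => co γ x i) x₀ := fun γ hγ i =>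
    contMDiffAt_inv_mulVec (fun j i => (hA j i).contMDiffAt)
      (fun j => (hγ (W j) (hW j)).contMDiffAt) hdet i
  have hsum : ContMDiffAt 𝓘(ℝ, EP) 𝓘(ℝ, ℝ) ∞ (fun x => ∑ i, ∑ j, co α x i * co β x j *
      πr (qM x) ![diff (f i) (qM x), diff (f j) (qM x)]) x₀ :=
    contMDiffAt_finsetSum fun i _ => contMDiffAt_finsetSum fun j _ =>
      ((hcos α hα i).mul (hcos β hβ j)).mul
        ((hπr (f i) (f j) (hf i) (hf j)).comp hq).contMDiffAt
  refine hsum.congr_of_eventuallyEq ?_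
  filter_upwards [hdet'] with x hx
  rw [hco α x hx, hco β x hx, ← Bivector.push_apply, hσ, Bivector.apply_sum]

end RestrictionSmooth

end QuasiPoisson

theorem mainTheorem6
    -- the quadratic Lie algebra `𝔡`
    {𝔡 : Type*} [LieRing 𝔡] [LieAlgebra ℝ 𝔡] [FiniteDimensional ℝ 𝔡]
    (B : LinearMap.BilinForm ℝ 𝔡) (hB : IsInvariantMetric B)
    -- the manifold `N` with its `𝔡`-action
    {EN : Type*} [NormedAddCommGroup EN] [NormedSpace ℝ EN] [FiniteDimensional ℝ EN]
    {N : Type*} [TopologicalSpace N] [ChartedSpace EN N] [IsManifold 𝓘(ℝ, EN) ∞ N]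
    [T2Space N] [SecondCountableTopology N]
    (a : LieAction 𝔡 EN N) (ha : ∀ n, B.orthogonal (a.stabilizer n) ≤ a.stabilizer n)
    -- the morphism of Manin pairs `R : (𝕋M, TM) ⇢ (𝔡, 𝔥) × N` over `μ`
    (𝔥 : LieSubalgebra ℝ 𝔡) (h𝔥 : IsLagrangian B 𝔥.toSubmodule)
    {EM : Type*} [NormedAddCommGroup EM] [NormedSpace ℝ EM] [FiniteDimensional ℝ EM]
    {M : Type*} [TopologicalSpace M] [ChartedSpace EM M] [IsManifold 𝓘(ℝ, EM) ∞ M]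
    [T2Space M] [SecondCountableTopology M]
    (μ : M → N) (R : (m : M) → Submodule ℝ (𝔡 × Tan EM m × Cot EM m))
    (hR : IsManinMorphism B a 𝔥.toSubmodule μ R)
    -- the Lagrangian complement `𝔨` of `𝔥`
    (𝔨 : Submodule ℝ 𝔡) (h𝔨 : IsLagrangian B 𝔨) (h𝔥𝔨 : IsCompl 𝔥.toSubmodule 𝔨)
    -- the submanifolds `S` of `N` and `P = μ⁻¹(S)` of `M`
    {ES : Type*} [NormedAddCommGroup ES] [NormedSpace ℝ ES] [FiniteDimensional ℝ ES]
    {S : Type*} [TopologicalSpace S] [ChartedSpace ES S] [IsManifold 𝓘(ℝ, ES) ∞ S]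
    [T2Space S] [SecondCountableTopology S]
    {EP : Type*} [NormedAddCommGroup EP] [NormedSpace ℝ EP] [FiniteDimensional ℝ EP]
    {P : Type*} [TopologicalSpace P] [ChartedSpace EP P] [IsManifold 𝓘(ℝ, EP) ∞ P]
    [T2Space P] [SecondCountableTopology P]
    -- the quotients `Nr = N_{𝔠,S}` of `S` and `Mr = M_{𝔠,S}` of `P`
    {ENr : Type*} [NormedAddCommGroup ENr] [NormedSpace ℝ ENr] [FiniteDimensional ℝ ENr]
    {Nr : Type*} [TopologicalSpace Nr] [ChartedSpace ENr Nr] [IsManifold 𝓘(ℝ, ENr) ∞ Nr]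
    [T2Space Nr] [SecondCountableTopology Nr]
    {EMr : Type*} [NormedAddCommGroup EMr] [NormedSpace ℝ EMr] [FiniteDimensional ℝ EMr]
    {Mr : Type*} [TopologicalSpace Mr] [ChartedSpace EMr Mr] [IsManifold 𝓘(ℝ, EMr) ∞ Mr]
    [T2Space Mr] [SecondCountableTopology Mr]
    -- the reductive data `(𝔠, S)`
    (𝔠 : LieSubalgebra ℝ 𝔡) (iN : S → N) (iM : P → M) (μS : P → S) (qN : S → Nr) (qM : P → Mr)
    (hred : IsReductiveData hR hB.symm h𝔥 𝔠.toSubmodule iN iM μS qN qM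
      (ES := ES) (EP := EP) (ENr := ENr) (EMr := EMr))
    -- the Lagrangian complement `𝔨'_𝔠` of `𝔥_𝔠` in `𝔠 / 𝔠^⊥`
    (𝔨' : Submodule ℝ (CoisoQuotient B 𝔠.toSubmodule))
    (h𝔨' : IsLagrangian (reducedForm B hB.symm 𝔠.toSubmodule) 𝔨')
    (h𝔥𝔨' : IsCompl (reducedSubspace B 𝔠.toSubmodule 𝔥.toSubmodule) 𝔨') :
    -- the objects `π_𝔨`, `τ` and `π_{𝔨'_𝔠}` exist and are unique
    (∃! π : (m : M) → Bivector (Tan EM m),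
      IsQuasiPoissonBivector 𝔨 (graphRelation μ R) π) ∧
    (∃! τ : Bivector (↥𝔥.toSubmodule ⧸ stab B 𝔠.toSubmodule 𝔥.toSubmodule),
      IsTwist B 𝔠.toSubmodule 𝔥.toSubmodule 𝔨 𝔨' τ) ∧
    (∃! πr : (m : Mr) → Bivector (Tan EMr m), IsQuasiPoissonBivector 𝔨'
      (reducedRelation B R 𝔠.toSubmodule μ iN iM qN qM (EP := EP)) πr) ∧
    ∀ (π : (m : M) → Bivector (Tan EM m))
      (τ : Bivector (↥𝔥.toSubmodule ⧸ stab B 𝔠.toSubmodule 𝔥.toSubmodule))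
      (πr : (m : Mr) → Bivector (Tan EMr m)),
      IsQuasiPoissonBivector 𝔨 (graphRelation μ R) π →
      IsTwist B 𝔠.toSubmodule 𝔥.toSubmodule 𝔨 𝔨' τ →
      IsQuasiPoissonBivector 𝔨'
        (reducedRelation B R 𝔠.toSubmodule μ iN iM qN qM (EP := EP)) πr →
      -- the restriction `σ` of `π_𝔨 + ρ_R(τ)` to `P` is a smooth section of
      -- `⋀² (TP / ρ_R(𝔥 ∩ 𝔠^⊥))`, it is invariant, and `qM` maps it to `π_{𝔨'_𝔠}`
      ∃! σ : (x : P) → Bivector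
          (Tan EP x ⧸ (hR.stabTangent hB.symm h𝔥 𝔠.toSubmodule iM x : Submodule ℝ (Tan EP x))),
        (∀ x : P, (σ x).push (hR.inclQuotient hB.symm h𝔥 𝔠.toSubmodule iM x) =
          (π (iM x)).push (hR.stabRange hB.symm h𝔥 𝔠.toSubmodule (iM x)).mkQ +
            τ.push (hR.rhoQuotient hB.symm h𝔥 𝔠.toSubmodule (iM x))) ∧
        SmoothQuotientBivector (hR.stabTangent hB.symm h𝔥 𝔠.toSubmodule iM) σ ∧
        IsInvariant (hR.stabAction hB.symm h𝔥 𝔠.toSubmodule iM)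
          (hR.stabTangent hB.symm h𝔥 𝔠.toSubmodule iM) σ ∧
        ∀ x : P, (σ x).push (hred.projQuotient x) = πr (qM x) := by
  have hCl : ∀ x ∈ 𝔠.toSubmodule, ∀ y ∈ 𝔠.toSubmodule, ⁅x, y⁆ ∈ 𝔠.toSubmodule :=
    fun x hx y hy => 𝔠.lie_mem hx hy
  refine ⟨hR.existsUnique_bivector hB h𝔥 h𝔨 h𝔥𝔨,
    existsUnique_isTwist hB.symm hB.nondegenerate h𝔥 h𝔨 h𝔥𝔨 hred.coisotropic h𝔨' h𝔥𝔨',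
    hred.existsUnique_bivector hB h𝔨 h𝔥𝔨 hCl h𝔨' h𝔥𝔨', fun π τ πr hπ hτ hπr => ?_⟩
  have hb : ∀ x, reducedFibre (EP := EP) R iM qM 𝔨' x = (πr (qM x)).graph := by
    choose b hb _ using hred.existsUnique_graph_eq_reducedFibre hB h𝔨 h𝔥𝔨 h𝔨' h𝔥𝔨'
    intro x
    rw [hb, ← hπr.graph_eq, hred.composeSubspace_eq hB h𝔨 h𝔥𝔨 hCl h𝔨' h𝔥𝔨' hb]
  let e := fun x => LinearEquiv.ofBijective (hred.projQuotient x)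
    (hred.projQuotient_bijective hB x)
  have hσ : ∀ x, ((πr (qM x)).push (e x).symm.toLinearMap).push (hred.projQuotient x) =
      πr (qM x) := by
    intro x
    rw [Bivector.push_push]
    have he : (hred.projQuotient x).comp (e x).symm.toLinearMap = LinearMap.id :=
      LinearMap.ext fun v => (e x).apply_symm_apply v
    rw [he]
    exact Bivector.ext_apply fun _ _ => by rw [Bivector.push_apply]; rfl
  exact ⟨fun x => (πr (qM x)).push (e x).symm.toLinearMap,
    ⟨fun x => hred.push_inclQuotient hB h𝔨 h𝔥𝔨 h𝔥𝔨' hπ hτ (hb x) (hσ x),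
      hred.smoothQuotientBivector hB hπr.smooth hσ, hred.isInvariant hB hσ, hσ⟩,
    fun σ' hσ' => funext fun x => Bivector.push_injective (hred.projQuotient_bijective hB x).1
      ((hσ'.2.2.2 x).trans (hσ x).symm)⟩
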